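/- Let $p$ be a prime number and let $M$ be the maximal abelian extension of $\mathbf{Q}_p$ (the compositum of all abelian extensions of $\mathbf{Q}_p$ in an algebraic closure), with its group $G=\mathrm{Gal}(M|\mathbf{Q}_p)$ of automorphisms. There is an isomorphism of topological groups $$G\longrightarrow\mathbf{Z}_p^\times\times\hat{\mathbf{Z}},\qquad \sigma\mapsto(a,b),$$ given by the action on the roots of unity in $M$: $\sigma(\zeta)=\zeta^{a}$ if $\zeta^{p^n}=1$ for some integer $n\ge0$, and $\sigma(\zeta)=\zeta^{p^{b}}$ if $\zeta^{p^m-1}=1$ for some integer $m\ge1$ (where $p^b$ means $p^{b'}$ for any integer $b'\ge0$ whose class in $\mathbf{Z}/m\mathbf{Z}$ is the image of $b$). Identify $G$ with $\mathbf{Z}_p^\times\times\hat{\mathbf{Z}}$, and $\mathbf{Z}_p^\times$ with the subgroup $\mathbf{Z}_p^\times\times\{0\}$, by this isomorphism. Let $(G^u)_{u\in[-1,+\infty[}$ be the ramification filtration of $G$ in the upper numbering: an element $\sigma\in G$ is in $G^u$ if and only if its restriction to $E$ is in $\mathrm{Gal}(E|\mathbf{Q}_p)^u$ for every finite galoisian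 subextension $E|\mathbf{Q}_p$ of $M$. Then $$G^{-1}=G,\qquad G^0=\mathbf{Z}_p^\times,\qquad G^n=U_n\quad\text{for every integer }n>0,$$ where $U_n$ is the kernel of $\mathbf{Z}_p^\times\to(\mathbf{Z}/p^n\mathbf{Z})^\times$. A break in the filtration is said to occur at $u\in[-1,+\infty[$ if $G^{u+\varepsilon}\ne G^u$ for every $\varepsilon>0$. If $p\ne2$, the breaks occur exactly at the $u\in\{-1\}\cup\mathbf{N}$, where $\mathbf{N}=\{0,1,2,\ldots\}$; if $p=2$, they occur exactly at the $u\in\{-1\}\cup\{1,2,3,\ldots\}$. -/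

import Mathlib

noncomputable section

/-! ### The ring of integers of an algebraic extension of `ℚ_[p]` is local -/

/-- For `L | ℚ_[p]` algebraic, the integers of `L` (the integral closure of `ℤ_[p]`) are the
elements whose norm (for the unique extension of the `p`-adic norm) is at most `1`. -/
theorem isIntegral_iff_spectralNorm_le_one (p : ℕ) [Fact p.Prime] (L : Type*) [Field L]
    [Algebra ℚ_[p] L] [Algebra ℤ_[p] L] [IsScalarTower ℤ_[p] ℚ_[p] L]
    [Algebra.IsAlgebraic ℚ_[p] L] (x : L) :
    IsIntegral ℤ_[p] x ↔ spectralNorm ℚ_[p] L x ≤ 1 := by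
  have hx : IsIntegral ℚ_[p] x := Algebra.IsIntegral.isIntegral x
  rw [spectralNorm, spectralValue_le_one_iff (minpoly.monic hx)]
  constructor
  · intro h n
    rw [minpoly.isIntegrallyClosed_eq_field_fractions' ℚ_[p] h, Polynomial.coeff_map]
    exact PadicInt.norm_le_one _
  · intro h
    have hl : minpoly ℚ_[p] x ∈ Polynomial.lifts (algebraMap ℤ_[p] ℚ_[p]) := by
      rw [Polynomial.lifts_iff_coeff_lifts]
      intro n
      exact ⟨⟨_, h n⟩, rfl⟩
    obtain ⟨q, hq, -, hm⟩ := Polynomial.lifts_and_degree_eq_and_monic hl (minpoly.monic hx)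
    refine ⟨q, hm, ?_⟩
    have := minpoly.aeval ℚ_[p] x
    rwa [← hq, Polynomial.aeval_map_algebraMap] at this

instance isLocalRing_integralClosure (p : ℕ) [Fact p.Prime] (L : Type*) [Field L]
    [Algebra ℚ_[p] L] [Algebra ℤ_[p] L] [IsScalarTower ℤ_[p] ℚ_[p] L]
    [Algebra.IsAlgebraic ℚ_[p] L] : IsLocalRing (integralClosure ℤ_[p] L) := by
  have hmul (x y : L) : spectralNorm ℚ_[p] L (x * y) =
      spectralNorm ℚ_[p] L x * spectralNorm ℚ_[p] L y :=
    map_mul (spectralMulAlgNorm ℚ_[p] L) x y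
  have hone : spectralNorm ℚ_[p] L 1 = 1 := spectralNorm_one
  have hunit (a : integralClosure ℤ_[p] L) (h : spectralNorm ℚ_[p] L (a : L) = 1) :
      IsUnit a := by
    have h0 : (a : L) ≠ 0 := by
      intro h0
      rw [h0, spectralNorm_zero] at h
      exact zero_ne_one h
    have hi : spectralNorm ℚ_[p] L (a : L)⁻¹ = 1 := by
      have := hmul a (a : L)⁻¹
      rw [mul_inv_cancel₀ h0, hone, h, one_mul] at this
      exact this.symm
    refine IsUnit.of_mul_eq_one
      ⟨(a : L)⁻¹, (isIntegral_iff_spectralNorm_le_one p L _).2 hi.le⟩ ?_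
    exact Subtype.ext (mul_inv_cancel₀ h0)
  have hle (a : integralClosure ℤ_[p] L) : spectralNorm ℚ_[p] L (a : L) ≤ 1 :=
    (isIntegral_iff_spectralNorm_le_one p L _).1 a.2
  refine ⟨fun {a b} hab => ?_⟩
  have hab' : (a : L) + b = 1 := congrArg Subtype.val hab
  have h1 := isNonarchimedean_spectralNorm (K := ℚ_[p]) (L := L) (a : L) b
  rw [hab', hone] at h1
  rcases le_max_iff.1 h1 with h | h
  · exact Or.inl (hunit a (le_antisymm (hle a) h))
  · exact Or.inr (hunit b (le_antisymm (hle b) h))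

/-! ### Ramification groups of a finite Galois extension -/

section Ramification

/-- The ramification groups in the lower numbering. For a group `G` acting on a local ring `B`
with maximal ideal `P` and an integer `i ≥ -1`, `G_i` is the set of `σ ∈ G` that operate
trivially on `B / P ^ (i + 1)`; for a real `u ≥ -1`, `G_u = G_i` with `i = ⌈u⌉`. -/
def lowerRamificationGroup (B G : Type*) [CommRing B] [IsLocalRing B] [Group G]
    [MulSemiringAction G B] (u : ℝ) : Subgroup G :=
  (IsLocalRing.maximalIdeal B ^ (⌈u⌉ + 1).toNat).toAddSubgroup.inertia G

/-- `φ(u) = ∫₀ᵘ dt / (G_0 : G_t)`, where `(G_0 : G_t)` means `(G_t : G_0)⁻¹` for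
`t ∈ [-1, 0]`; so the integrand is `|G_t| / |G_0|`. -/
def herbrandPhi (B G : Type*) [CommRing B] [IsLocalRing B] [Group G]
    [MulSemiringAction G B] (u : ℝ) : ℝ :=
  ∫ t in (0 : ℝ)..u,
    (Nat.card (lowerRamificationGroup B G t) : ℝ) / Nat.card (lowerRamificationGroup B G 0)

/-- `ψ`, the inverse of the bijection `φ : [-1, ∞) → [-1, ∞)`. -/
def herbrandPsi (B G : Type*) [CommRing B] [IsLocalRing B] [Group G]
    [MulSemiringAction G B] (v : ℝ) : ℝ :=
  Function.invFunOn (herbrandPhi B G) (Set.Ici (-1)) v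

/-- The ramification groups in the upper numbering, `G^v = G_{ψ(v)}` for real `v ≥ -1`. -/
def upperRamificationGroup (B G : Type*) [CommRing B] [IsLocalRing B] [Group G]
    [MulSemiringAction G B] (v : ℝ) : Subgroup G :=
  lowerRamificationGroup B G (herbrandPsi B G v)

end Ramification

/-- The ramification filtration in the upper numbering on `Gal(M | ℚ_[p])`, for `M` an extension
of `ℚ_[p]`, possibly infinite: the limit of the upper numbering filtrations on the
groups `Gal(E | ℚ_[p])`, with `E` running over the finite Galois subextensions of `M`. That is,
`σ ∈ G^v` if and only if `σ|_E ∈ Gal(E | ℚ_[p])^v` for all `E`. -/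
def galoisUpperRamificationGroup (p : ℕ) [Fact p.Prime]
    (M : IntermediateField ℚ_[p] (AlgebraicClosure ℚ_[p])) (v : ℝ) : Subgroup Gal(M/ℚ_[p]) :=
  ⨅ E : FiniteGaloisIntermediateField ℚ_[p] M,
    (upperRamificationGroup (integralClosure ℤ_[p] E) Gal(E/ℚ_[p]) v).comap
      (AlgEquiv.restrictNormalHom E)

/-- A break (or jump) of a decreasing filtration `(F^u)_{u ∈ [-1, ∞)}` occurs at `u` if
`F^{u + ε} ≠ F^u` for every `ε > 0`. -/
def IsFiltrationBreak {G : Type*} [Group G] (F : ℝ → Subgroup G) (u : ℝ) : Prop :=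
  -1 ≤ u ∧ ∀ ε > 0, F (u + ε) ≠ F u

/-! ### The maximal abelian extension and the groups `U_n` and `Ẑ` -/

/-- The maximal abelian extension of `ℚ_[p]` (inside an algebraic closure): the compositum of
all abelian extensions. -/
def maximalAbelianExtension (p : ℕ) [Fact p.Prime] :
    IntermediateField ℚ_[p] (AlgebraicClosure ℚ_[p]) :=
  sSup {E | IsAbelianGalois ℚ_[p] E}

/-- `U_n`, the kernel of `ℤ_[p]ˣ → (ℤ / p ^ n)ˣ`. -/
def padicPrincipalUnits (p : ℕ) [Fact p.Prime] (n : ℕ) : Subgroup ℤ_[p]ˣ :=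
  (Units.map (PadicInt.toZModPow (p := p) n).toMonoidHom).ker

/-- `Ẑ`, the inverse limit of the groups `ℤ / m`, `m ≥ 1`, inside their product; with the
topology induced by the product of the discrete topologies. -/
def ZHat : AddSubgroup ((m : ℕ+) → ZMod m) where
  carrier := {a | ∀ (d m : ℕ+) (h : (d : ℕ) ∣ m), ZMod.castHom h (ZMod d) (a m) = a d}
  add_mem' {a b} ha hb d m h := by rw [Pi.add_apply, map_add, ha d m h, hb d m h, Pi.add_apply]
  zero_mem' d m h := by rw [Pi.zero_apply, map_zero, Pi.zero_apply]
  neg_mem' {a} ha d m h := by rw [Pi.neg_apply, map_neg, ha d m h, Pi.neg_apply]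

end

/-! The theorem splits into an explicit calculation in cyclotomic fields and a proof that these
fields contain every finite abelian extension of ℚ_p (the local Kronecker–Weber theorem).

Calculation. Let `C` be generated by roots of unity ζ of order p^n and ξ of order p^m - 1, with n, m
≥ 1. Since p is a unit times (ζ - 1)^φ(p^n), inertia has order φ(p^n), it is the stabilizer of ξ,
and ζ - 1 is a uniformizer. Hence the Galois group is as large as the action on ζ and ξ allows. An
element σ of inertia acts trivially modulo P^i exactly when σζ/ζ - 1 lies in P^i, which only depends
on the order of the root of unity σζ/ζ. So the lower filtration can jump only at the numbers p^k -
1, the Herbrand function sends p^k - 1 to k for k ≤ n, and the upper groups are the images of the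
U_k (`mem_padicUpperRamificationGroup_cyclotomic_iff`).

Kronecker–Weber is obtained by counting. Given an abelian L, a cyclotomic C is chosen so that both
Galois groups are killed by the same d. Then d also kills the group of LC, and it suffices to bound
the order of any abelian group killed by d by the order of Gal(C) (`card_gal_le`). Iterating the
p-th power map reduces this to the prime-to-p part and to exponent p. Commutation with a Frobenius
bounds the tame quotient by p - 1 and each wild quotient by p. In a ramified extension of degree p
the only jump j satisfies (p - 1)j ≤ e = p, so it is an integer, at most 1 if p is odd and at most 2
if p = 2. Herbrand's theorem carries this to exponent p, where the degree is at most p^2,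
respectively 8. For p = 2 iterating the bound 8 is too weak: one uses that -1 is not a sum of two
squares in ℚ_2, so that not every involution of the Galois group is a square once i is in the field,
which replaces 8 by 4 after the first step.

Conclusion. Kronecker–Weber makes the action on roots of unity injective, and compactness makes it
surjective. Herbrand's theorem descends the filtration from cyclotomic fields to all finite Galois
subextensions, so G^v corresponds to U_⌈v⌉ × 0 for v > -1. The breaks are then read off from U_(n+1)
≠ U_n, which fails only for p = 2 and n = 0. -/

open IsLocalRing

/-! ### Congruence subgroups of a group acting on a local ring -/

section CongruenceSubgroup

variable (B G : Type*) [CommRing B] [IsLocalRing B] [Group G] [MulSemiringAction G B]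

/-- The subgroup of the elements that act trivially modulo the `n`-th power of the maximal ideal. -/
def congruenceSubgroup (n : ℕ) : Subgroup G :=
  (maximalIdeal B ^ n).toAddSubgroup.inertia G

variable {B G}

theorem mem_congruenceSubgroup {n : ℕ} {σ : G} :
    σ ∈ congruenceSubgroup B G n ↔ ∀ b : B, σ • b - b ∈ maximalIdeal B ^ n := Iff.rfl

theorem lowerRamificationGroup_eq (u : ℝ) :
    lowerRamificationGroup B G u = congruenceSubgroup B G (⌈u⌉ + 1).toNat := rfl

theorem congruenceSubgroup_zero : congruenceSubgroup B G 0 = ⊤ := by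
  ext σ
  simp [mem_congruenceSubgroup]

theorem congruenceSubgroup_antitone : Antitone (congruenceSubgroup B G) :=
  fun _ _ h _ hσ b => Ideal.pow_le_pow_right h (hσ b)

theorem lowerRamificationGroup_antitone : Antitone (lowerRamificationGroup B G) :=
  fun _ _ h => congruenceSubgroup_antitone
    (Int.toNat_le_toNat (by gcongr))

theorem smul_mem_maximalIdeal_pow (σ : G) {n : ℕ} {b : B} (hb : b ∈ maximalIdeal B ^ n) :
    σ • b ∈ maximalIdeal B ^ n := by
  have h : maximalIdeal B ≤ (maximalIdeal B).comap (MulSemiringAction.toRingEquiv G B σ) := by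
    intro x hx
    rw [Ideal.mem_comap, mem_maximalIdeal, mem_nonunits_iff] at *
    intro hu
    exact hx ((MulEquiv.isUnit_map (MulSemiringAction.toRingEquiv G B σ)).1 hu)
  have h2 := (Ideal.pow_right_mono h n).trans (Ideal.le_comap_pow _ n)
  exact h2 hb

/-- The map σ - 1 satisfies the twisted Leibniz rule (σ - 1)(xy) = σx·(σ - 1)y + (σ - 1)x·y, so by
induction on m it raises the valuation by at least j. -/
theorem smul_sub_mem_pow_add {σ : G} {j : ℕ} (hσ : σ ∈ congruenceSubgroup B G (j + 1)) {m : ℕ}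
    {b : B} (hb : b ∈ maximalIdeal B ^ m) : σ • b - b ∈ maximalIdeal B ^ (m + j) := by
  induction m generalizing b with
  | zero =>
    rw [zero_add]
    exact congruenceSubgroup_antitone (Nat.le_succ j) hσ b
  | succ m ih =>
    rw [pow_succ] at hb
    refine Submodule.mul_induction_on hb (fun x hx y hy => ?_) (fun x y hx hy => ?_)
    · have e : σ • (x * y) - x * y = σ • x * (σ • y - y) + (σ • x - x) * y := by
        rw [smul_mul']; ring
      rw [e]
      refine add_mem ?_ ?_
      · have := Ideal.mul_mem_mul (smul_mem_maximalIdeal_pow σ hx) (hσ y)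
        rw [← pow_add] at this
        convert this using 2; ring
      · have := Ideal.mul_mem_mul (ih hx) hy
        rw [← pow_succ] at this
        convert this using 2; ring
    · have e : σ • (x + y) - (x + y) = (σ • x - x) + (σ • y - y) := by
        rw [smul_add]; ring
      rw [e]
      exact add_mem hx hy

/-- The cofactor of x - y in x^q - y^q is congruent to q·x^(q-1), hence to 0, modulo the maximal
ideal. -/
theorem pow_sub_pow_mem_pow_succ {q k : ℕ} (hq : (q : B) ∈ maximalIdeal B) (hk : k ≠ 0) {x y : B}
    (h : x - y ∈ maximalIdeal B ^ k) : x ^ q - y ^ q ∈ maximalIdeal B ^ (k + 1) := by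
  rw [← geom_sum₂_mul, pow_succ']
  refine Ideal.mul_mem_mul ?_ h
  have hxy : Ideal.Quotient.mk (maximalIdeal B) x = Ideal.Quotient.mk (maximalIdeal B) y :=
    Ideal.Quotient.eq.2 (Ideal.pow_le_self hk h)
  rw [← Ideal.Quotient.eq_zero_iff_mem] at hq ⊢
  rw [RingHom.map_geom_sum₂, hxy, geom_sum₂_self, ← map_natCast (Ideal.Quotient.mk (maximalIdeal B)),
    hq, zero_mul]

theorem pow_pow_sub_mem {q : ℕ} (hq : ∀ b : B, b ^ q - b ∈ maximalIdeal B) (k : ℕ) (b : B) :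
    b ^ q ^ k - b ∈ maximalIdeal B := by
  induction k with
  | zero => simp
  | succ k ih =>
    have := add_mem (hq (b ^ q ^ k)) ih
    rw [pow_succ, pow_mul]
    convert this using 1; ring

theorem pow_pow_sub_pow_pow_mem {q : ℕ} (hq : (q : B) ∈ maximalIdeal B) {x y : B}
    (h : x - y ∈ maximalIdeal B) (k : ℕ) :
    x ^ q ^ k - y ^ q ^ k ∈ maximalIdeal B ^ (k + 1) := by
  induction k with
  | zero => simpa using h
  | succ k ih =>
    rw [pow_succ q, pow_mul, pow_mul]
    exact pow_sub_pow_mem_pow_succ hq (Nat.succ_ne_zero k) ih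

/-- An element of the inertia group that moves a uniformizer by an element of `P ^ m` acts
trivially modulo `P ^ m`. -/
theorem mem_congruenceSubgroup_of_uniformizer {q : ℕ} (hq0 : (q : B) ∈ maximalIdeal B)
    (hq : ∀ b : B, b ^ q - b ∈ maximalIdeal B) {π : B} (hπ : maximalIdeal B = Ideal.span {π})
    {σ : G} (hσ : σ ∈ congruenceSubgroup B G 1) {m : ℕ}
    (hm : σ • π - π ∈ maximalIdeal B ^ m) : σ ∈ congruenceSubgroup B G m := by
  suffices H : ∀ k ≤ m, ∀ b : B, σ • b - b ∈ maximalIdeal B ^ k from H m le_rfl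
  intro k
  induction k with
  | zero => intro _ b; simp
  | succ k ih =>
    intro hk b
    -- Writing b = b^(q^k) + πc, the automorphism moves the power by an element of P^(k+1), moves π
    -- by hypothesis, and moves c by an element of P^k by induction. No Teichmüller representatives
    -- or completeness are needed.
    have h1 : b - b ^ q ^ k ∈ maximalIdeal B := by
      have := neg_mem (pow_pow_sub_mem hq k b)
      rwa [neg_sub] at this
    rw [hπ, Ideal.mem_span_singleton] at h1
    obtain ⟨c, hc⟩ := h1
    have hb : σ • b - b ∈ maximalIdeal B := by simpa using hσ b
    have h2 := pow_pow_sub_pow_pow_mem hq0 hb k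
    have e : σ • b - b = ((σ • b) ^ q ^ k - b ^ q ^ k) + (σ • π - π) * σ • c +
        π * (σ • c - c) := by
      have h3 : σ • (b - b ^ q ^ k) = σ • (π * c) := by rw [hc]
      rw [smul_sub, smul_pow', smul_mul'] at h3
      linear_combination h3 - hc
    rw [e]
    refine add_mem (add_mem h2 ?_) ?_
    · exact Ideal.mul_mem_right _ _ (Ideal.pow_le_pow_right hk hm)
    · rw [pow_succ']
      exact Ideal.mul_mem_mul (by rw [hπ]; exact Ideal.mem_span_singleton_self π)
        (ih (Nat.le_of_succ_le hk) c)

/-- The additive endomorphism `σ - 1`. -/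
def smulSubHom (σ : G) : Module.End ℤ B :=
  (DistribSMul.toAddMonoidHom B σ).toIntLinearMap - 1

omit [IsLocalRing B] in
theorem smulSubHom_apply (σ : G) (b : B) : smulSubHom σ b = σ • b - b := rfl

omit [IsLocalRing B] in
theorem smulSubHom_add_one_pow_apply (σ : G) (n : ℕ) (b : B) :
    ((smulSubHom σ + 1 : Module.End ℤ B) ^ n) b = σ ^ n • b := by
  induction n with
  | zero => simp
  | succ n ih =>
    rw [pow_succ', Module.End.mul_apply, ih, LinearMap.add_apply, smulSubHom_apply,
      Module.End.one_apply, sub_add_cancel, pow_succ', mul_smul]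

theorem smulSubHom_pow_succ_mem {σ : G} {j : ℕ} (hσ : σ ∈ congruenceSubgroup B G (j + 1)) {a : ℕ}
    {b : B} (hb : σ • b - b ∈ maximalIdeal B ^ a) (k : ℕ) :
    (smulSubHom σ ^ (k + 1)) b ∈ maximalIdeal B ^ (a + k * j) := by
  induction k with
  | zero => simpa [smulSubHom_apply] using hb
  | succ k ih =>
    rw [pow_succ', Module.End.mul_apply, smulSubHom_apply]
    convert smul_sub_mem_pow_add hσ ih using 2
    ring

/-- Expand σ^p = (1 + δ)^p with δ = σ - 1. Since δ^k b lies in P^(a+(k-1)j), the terms with 2 ≤ k <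
p, whose coefficients are divisible by p, lie in P^(e+a+j), and the term δ^p b lies in P^(a+(p-1)j).
-/
theorem pow_smul_sub_sub_mem {p : ℕ} (hp : p.Prime) {e : ℕ} (he : (p : B) ∈ maximalIdeal B ^ e)
    {σ : G} {j : ℕ} (hσ : σ ∈ congruenceSubgroup B G (j + 1)) {a : ℕ}
    {b : B} (hb : σ • b - b ∈ maximalIdeal B ^ a) {N : ℕ} (h1 : N ≤ a + (p - 1) * j)
    (h2 : N ≤ e + a + j) : σ ^ p • b - b - p * (σ • b - b) ∈ maximalIdeal B ^ N := by
  have key := congrArg (fun f : Module.End ℤ B => f b)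
    ((Commute.one_right (smulSubHom σ)).add_pow p)
  simp only [one_pow, mul_one, LinearMap.sum_apply, smulSubHom_add_one_pow_apply] at key
  rw [key]
  obtain ⟨r, rfl⟩ : ∃ r, p = r + 2 := ⟨p - 2, by have := hp.two_le; omega⟩
  rw [Finset.sum_range_succ', Finset.sum_range_succ']
  have e0 : ∀ k : ℕ, (smulSubHom σ ^ k * ((((r + 2).choose k : ℕ) : Module.End ℤ B)) : Module.End ℤ B) b =
      ((r + 2).choose k : B) * (smulSubHom σ ^ k) b := by
    intro k
    rw [← Nat.cast_comm, ← nsmul_eq_mul, LinearMap.smul_apply, nsmul_eq_mul]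
  simp only [e0]
  -- The terms of degree 0 and 1 of the binomial sum are exactly b and p(σb - b), so only the terms
  -- of degree at least 2 remain.
  rw [show ∀ s : B, s + ((r + 2).choose (0 + 1) : B) * (smulSubHom σ ^ (0 + 1)) b +
      ((r + 2).choose 0 : B) * (smulSubHom σ ^ 0) b - b - ((r + 2 : ℕ) : B) * (σ • b - b) = s by
    intro s
    simp [smulSubHom_apply]]
  refine sum_mem fun k hk => ?_
  rw [Finset.mem_range] at hk
  have h3 := smulSubHom_pow_succ_mem hσ hb (k + 1)
  rcases Nat.lt_or_ge k r with hk' | hk'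
  · obtain ⟨c, hc⟩ := hp.dvd_choose_self (k := k + 1 + 1) (by omega) (by omega)
    rw [hc, Nat.cast_mul, mul_assoc]
    have := Ideal.mul_mem_mul he (Ideal.mul_mem_left _ (c : B) h3)
    rw [← pow_add] at this
    refine Ideal.pow_le_pow_right ?_ this
    nlinarith
  · obtain rfl : k = r := by omega
    refine Ideal.mul_mem_left _ _ (Ideal.pow_le_pow_right ?_ h3)
    simpa using h1

theorem pow_mem_congruenceSubgroup_succ {p : ℕ} (hp : p.Prime) (hpB : (p : B) ∈ maximalIdeal B)
    {σ : G} {j : ℕ} (hj : 1 ≤ j) (hσ : σ ∈ congruenceSubgroup B G (j + 1)) :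
    σ ^ p ∈ congruenceSubgroup B G (j + 2) := by
  intro b
  have := hp.two_le
  have h : j ≤ (p - 1) * j := Nat.le_mul_of_pos_left _ (by omega)
  have h1 := pow_smul_sub_sub_mem hp (e := 1) (by simpa using hpB) hσ (hσ b) (N := j + 2)
    (by omega) (by omega)
  have h2 : (p : B) * (σ • b - b) ∈ maximalIdeal B ^ (j + 2) := by
    rw [pow_succ']
    exact Ideal.mul_mem_mul hpB (hσ b)
  have := add_mem h1 h2
  rwa [sub_add_cancel] at this

theorem pow_prime_pow_mem_congruenceSubgroup {p : ℕ} (hp : p.Prime)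
    (hpB : (p : B) ∈ maximalIdeal B) {σ : G} (hσ : σ ∈ congruenceSubgroup B G 2) (k : ℕ) :
    σ ^ p ^ k ∈ congruenceSubgroup B G (k + 2) := by
  induction k with
  | zero => simpa using hσ
  | succ k ih =>
    rw [pow_succ, pow_mul]
    exact pow_mem_congruenceSubgroup_succ hp hpB (j := k + 1) (by omega) ih

end CongruenceSubgroup

theorem Subgroup.relIndex_le_of_map {G S : Type*} [Group G] {H K : Subgroup G} (s : Set S)
    (hs : s.Finite) (f : G → S) (hf : ∀ σ ∈ K, f σ ∈ s)
    (h : ∀ σ ∈ K, ∀ τ ∈ K, f σ = f τ → σ⁻¹ * τ ∈ H) : H.relIndex K ≤ s.ncard := by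
  have := hs.to_subtype
  rw [Subgroup.relIndex, Subgroup.index, ← Nat.card_coe_set_eq]
  refine Nat.card_le_card_of_injective
    (fun x : K ⧸ H.subgroupOf K => (⟨f x.out, hf _ x.out.2⟩ : s)) fun x y hxy => ?_
  have := h _ x.out.2 _ y.out.2 (congrArg Subtype.val hxy)
  rw [← Quotient.out_eq' x, ← Quotient.out_eq' y]
  exact QuotientGroup.eq.2 this

/-! ### Size of the jumps over a discrete valuation ring -/

section DVR

variable {B G : Type*} [CommRing B] [IsDomain B] [IsDiscreteValuationRing B] [Group G]
  [MulSemiringAction G B]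

theorem maximalIdeal_pow_eq_span {π : B} (hπ : Irreducible π) (n : ℕ) :
    maximalIdeal B ^ n = Ideal.span {π ^ n} := by
  rw [hπ.maximalIdeal_eq, Ideal.span_singleton_pow]

theorem mem_maximalIdeal_pow_iff {π : B} (hπ : Irreducible π) {n : ℕ} {b : B} :
    b ∈ maximalIdeal B ^ n ↔ π ^ n ∣ b := by
  rw [maximalIdeal_pow_eq_span hπ, Ideal.mem_span_singleton]

theorem pow_mul_mem_maximalIdeal_pow_iff {π : B} (hπ : Irreducible π) {m n : ℕ} {b : B} :
    π ^ m * b ∈ maximalIdeal B ^ (m + n) ↔ b ∈ maximalIdeal B ^ n := by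
  rw [mem_maximalIdeal_pow_iff hπ, mem_maximalIdeal_pow_iff hπ, pow_add,
    mul_dvd_mul_iff_left (pow_ne_zero _ hπ.ne_zero)]

/-- If (p - 1)j > e, then σ^p - 1 = 0 is so close to p(σ - 1) that p(σb - b) lies in P^(e+j+2) for
all b. Dividing by p gives σb - b in P^(j+2), against the choice of j. -/
theorem mul_sub_one_le_of_pow_prime_eq_one [FaithfulSMul G B] {p : ℕ} (hp : p.Prime) {e : ℕ}
    (he : maximalIdeal B ^ e = Ideal.span {(p : B)}) {σ : G} (hσp : σ ^ p = 1) {j : ℕ}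
    (hj : 1 ≤ j) (hσ : σ ∈ congruenceSubgroup B G (j + 1))
    (hσ' : σ ∉ congruenceSubgroup B G (j + 2)) : (p - 1) * j ≤ e := by
  by_contra! hlt
  obtain ⟨π, hπ⟩ := IsDiscreteValuationRing.exists_irreducible B
  rw [mem_congruenceSubgroup] at hσ'
  push Not at hσ'
  obtain ⟨b, hb⟩ := hσ'
  have h1 := pow_smul_sub_sub_mem hp (e := e) (by rw [he]; exact Ideal.mem_span_singleton_self _)
    hσ (hσ b) (N := e + (j + 2)) (by omega) (by omega)
  rw [hσp, one_smul, sub_self, zero_sub, neg_mem_iff] at h1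
  rw [maximalIdeal_pow_eq_span hπ, Ideal.span_singleton_eq_span_singleton] at he
  obtain ⟨u, hu⟩ := he
  rw [← hu, mul_assoc, pow_mul_mem_maximalIdeal_pow_iff hπ] at h1
  apply hb
  have := Ideal.mul_mem_left _ (↑u⁻¹ : B) h1
  rwa [Units.inv_mul_cancel_left] at this

open Polynomial in
/-- The bound of the quotients of the ramification groups that comes from commuting with a
Frobenius element. -/
theorem relIndex_congruenceSubgroup_le {p q : ℕ} (hp : p.Prime) (hpB : (p : B) ∈ maximalIdeal B)
    (hq0 : (q : B) ∈ maximalIdeal B) (hq : ∀ b : B, b ^ q - b ∈ maximalIdeal B) {τ : G}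
    (hτ : ∀ b : B, τ • b - b ^ p ∈ maximalIdeal B) (hcomm : ∀ σ : G, σ * τ = τ * σ) (i : ℕ) :
    (congruenceSubgroup B G (i + 2)).relIndex (congruenceSubgroup B G (i + 1)) ≤
      if i = 0 then p - 1 else p := by
  obtain ⟨π, hπ⟩ := IsDiscreteValuationRing.exists_irreducible B
  have hπP : π ∈ maximalIdeal B := by
    rw [hπ.maximalIdeal_eq]; exact Ideal.mem_span_singleton_self π
  have hτπ : ∃ w : B, IsUnit w ∧ τ • π = w * π := by
    have : Irreducible (τ • π) :=
      (MulEquiv.irreducible_iff (MulSemiringAction.toRingEquiv G B τ)).2 hπ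
    obtain ⟨u, hu⟩ := IsDiscreteValuationRing.associated_of_irreducible B hπ this
    exact ⟨u, u.isUnit, by rw [← hu, mul_comm]⟩
  obtain ⟨w, hw, hwπ⟩ := hτπ
  have hu : ∀ σ : G, ∃ u : B, σ ∈ congruenceSubgroup B G (i + 1) → σ • π - π = π ^ (i + 1) * u := by
    intro σ
    by_cases h : σ ∈ congruenceSubgroup B G (i + 1)
    · obtain ⟨u, hu⟩ := (mem_maximalIdeal_pow_iff hπ).1 (h π)
      exact ⟨u, fun _ => hu⟩
    · exact ⟨0, fun h' => absurd h' h⟩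
  choose u hu using hu
  have hres : ∀ {a b : B}, a - b ∈ maximalIdeal B → residue B a = residue B b :=
    fun h => Ideal.Quotient.eq.2 h
  have hinj : ∀ σ ∈ congruenceSubgroup B G (i + 1), ∀ σ' ∈ congruenceSubgroup B G (i + 1),
      residue B (u σ) = residue B (u σ') → σ⁻¹ * σ' ∈ congruenceSubgroup B G (i + 2) := by
    intro σ hσ σ' hσ' h
    refine mem_congruenceSubgroup_of_uniformizer hq0 hq hπ.maximalIdeal_eq
      (congruenceSubgroup_antitone (Nat.succ_pos i) (mul_mem (inv_mem hσ) hσ')) ?_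
    have h1 : σ' • π - σ • π ∈ maximalIdeal B ^ (i + 2) := by
      have e : σ' • π - σ • π = π ^ (i + 1) * (u σ' - u σ) := by
        rw [mul_sub, ← hu σ hσ, ← hu σ' hσ']; ring
      rw [e, show i + 2 = i + 1 + 1 from rfl, pow_mul_mem_maximalIdeal_pow_iff hπ, pow_one]
      exact Ideal.Quotient.eq.1 h.symm
    have := smul_mem_maximalIdeal_pow σ⁻¹ h1
    rwa [smul_sub, inv_smul_smul, ← mul_smul] at this
  -- Apply τ to σπ - π = π^(i+1)u in two ways: directly, with τπ = wπ, and through τσ = στ.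
  -- Comparing leading coefficients in the residue field, where τ is the p-th power map, gives an
  -- equation of degree p for the class of u.
  have hrel : ∀ σ ∈ congruenceSubgroup B G (i + 1),
      residue B w ^ i * residue B (u σ) ^ p = residue B (u σ) := by
    intro σ hσ
    have e1 : τ • (σ • π - π) = w ^ (i + 1) * π ^ (i + 1) * τ • u σ := by
      rw [hu σ hσ, smul_mul', smul_pow', hwπ, mul_pow]
    have e2 : τ • (σ • π - π) = w * (π ^ (i + 1) * u σ) + (σ • w - w) * σ • π := by
      rw [← hu σ hσ, smul_sub, ← mul_smul, ← hcomm, mul_smul, hwπ, smul_mul']; ring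
    have h3 : π ^ (i + 1) * (w ^ (i + 1) * τ • u σ - w * u σ) ∈ maximalIdeal B ^ (i + 1 + 1) := by
      have : π ^ (i + 1) * (w ^ (i + 1) * τ • u σ - w * u σ) = (σ • w - w) * σ • π := by
        linear_combination e2 - e1
      rw [this, pow_succ]
      refine Ideal.mul_mem_mul (hσ w) ?_
      have := smul_mem_maximalIdeal_pow σ (n := 1) (b := π) (by rwa [pow_one])
      rwa [pow_one] at this
    rw [pow_mul_mem_maximalIdeal_pow_iff hπ, pow_one] at h3
    have h4 := hres h3
    rw [map_mul, map_mul, map_pow, hres (hτ (u σ)), map_pow, pow_succ', mul_assoc] at h4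
    refine mul_left_cancel₀ ?_ h4
    exact (hw.map (residue B)).ne_zero
  have hw0 : residue B w ≠ 0 := (hw.map (residue B)).ne_zero
  split_ifs with hi
  -- Tame case: σπ/π = 1 + u is a unit and its class is fixed by the p-th power map, hence is a root
  -- of X^(p-1) - 1.
  · subst hi
    have hinj' : ∀ σ ∈ congruenceSubgroup B G (0 + 1), ∀ σ' ∈ congruenceSubgroup B G (0 + 1),
        1 + residue B (u σ) = 1 + residue B (u σ') → σ⁻¹ * σ' ∈ congruenceSubgroup B G (0 + 2) :=
      fun σ hσ σ' hσ' h => hinj σ hσ σ' hσ' (add_left_cancel h)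
    have hp1 : p - 1 ≠ 0 := by have := hp.two_le; omega
    let f : (ResidueField B)[X] := X ^ (p - 1) - C 1
    have hf : f.Monic := monic_X_pow_sub_C 1 hp1
    have hpk : (p : ResidueField B) = 0 := by
      rw [← map_natCast (residue B)]
      exact Ideal.Quotient.eq_zero_iff_mem.2 hpB
    have : CharP (ResidueField B) p := (CharP.charP_iff_prime_eq_zero hp).2 hpk
    have : Fact p.Prime := ⟨hp⟩
    refine (Subgroup.relIndex_le_of_map (f.rootSet (ResidueField B)) (Polynomial.rootSet_finite _ _)
      (fun σ => 1 + residue B (u σ)) (fun σ hσ => ?_) hinj').trans ?_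
    · rw [mem_rootSet]
      refine ⟨hf.ne_zero, ?_⟩
      have h1 : Irreducible (σ • π) :=
        (MulEquiv.irreducible_iff (MulSemiringAction.toRingEquiv G B σ)).2 hπ
      have h2 : σ • π = π * (1 + u σ) := by linear_combination hu σ hσ
      have h3 : IsUnit (1 + u σ) := by
        rw [h2] at h1
        exact (h1.isUnit_or_isUnit rfl).resolve_left hπ.not_isUnit
      have h4 : 1 + residue B (u σ) ≠ 0 := by
        simpa using (h3.map (residue B)).ne_zero
      have h5 : (1 + residue B (u σ)) ^ p = 1 + residue B (u σ) := by
        have := hrel σ hσ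
        rw [pow_zero, one_mul] at this
        rw [add_pow_char, one_pow, this]
      have h6 : (1 + residue B (u σ)) ^ (p - 1) = 1 := by
        refine mul_right_cancel₀ h4 ?_
        rw [← pow_succ, Nat.sub_add_cancel hp.one_le, h5, one_mul]
      simp [f, h6]
    · refine (Polynomial.ncard_rootSet_le f _).trans ?_
      rw [natDegree_X_pow_sub_C]
  -- Wild case: the class of u is a root of w^i X^p - X, which has at most p roots.
  · let f : (ResidueField B)[X] := C (residue B w ^ i) * X ^ p - X
    have hdeg : f.natDegree = p := by
      have h1 : (C (residue B w ^ i) * X ^ p : (ResidueField B)[X]).natDegree = p :=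
        natDegree_C_mul_X_pow _ _ (pow_ne_zero _ hw0)
      rw [natDegree_sub_eq_left_of_natDegree_lt (by rw [h1, natDegree_X]; exact hp.one_lt), h1]
    have hf0 : f ≠ 0 := fun h => hp.ne_zero (by rw [← hdeg, h, natDegree_zero])
    refine (Subgroup.relIndex_le_of_map (f.rootSet (ResidueField B)) (Polynomial.rootSet_finite _ _)
      (fun σ => residue B (u σ)) (fun σ hσ => ?_) hinj).trans ?_
    · rw [mem_rootSet]
      refine ⟨hf0, ?_⟩
      simp [f, hrel σ hσ]
    · rw [← hdeg]
      exact Polynomial.ncard_rootSet_le f _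

end DVR

/-! ### The function of Herbrand -/

section TruncMin

/-- The minimum of an extended natural number and a real number. -/
noncomputable def truncMin (a : ℕ∞) (x : ℝ) : ℝ := if a = ⊤ then x else min (a.toNat : ℝ) x

@[simp] theorem truncMin_top (x : ℝ) : truncMin ⊤ x = x := if_pos rfl

@[simp] theorem truncMin_coe (n : ℕ) (x : ℝ) : truncMin n x = min (n : ℝ) x := by
  simp [truncMin]

theorem truncMin_le (a : ℕ∞) (x : ℝ) : truncMin a x ≤ x := by
  induction a with
  | top => simp
  | coe n => simp

theorem truncMin_nonneg (a : ℕ∞) {x : ℝ} (hx : 0 ≤ x) : 0 ≤ truncMin a x := by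
  induction a with
  | top => simpa
  | coe n => simpa

theorem truncMin_mono (a : ℕ∞) : Monotone (truncMin a) := by
  intro x y h
  induction a with
  | top => simpa
  | coe n => simpa using Or.inr h

theorem truncMin_zero (a : ℕ∞) : truncMin a 0 = 0 :=
  le_antisymm (truncMin_le a 0) (truncMin_nonneg a le_rfl)

theorem continuous_truncMin (a : ℕ∞) : Continuous (truncMin a) := by
  induction a with
  | top => exact continuous_id.congr fun x => (truncMin_top x).symm
  | coe n =>
    rw [funext (truncMin_coe n)]
    fun_prop

theorem truncMin_min (a b : ℕ∞) (x : ℝ) : truncMin (min a b) x = truncMin a (truncMin b x) := by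
  induction a with
  | top => simp
  | coe n =>
    induction b with
    | top => simp
    | coe m =>
      rw [← (Nat.mono_cast (α := ℕ∞)).map_min]
      simp [min_assoc]

theorem truncMin_eq_self_iff (a : ℕ∞) {u : ℝ} :
    truncMin a (u + 1) = u + 1 ↔ (((⌈u⌉ + 1).toNat : ℕ) : ℕ∞) ≤ a := by
  induction a with
  | top => simp
  | coe n =>
    rw [truncMin_coe, min_eq_right_iff, Nat.cast_le, Int.toNat_le, ← Int.cast_natCast (R := ℝ),
      ← le_sub_iff_add_le, ← le_sub_iff_add_le, Int.ceil_le]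
    push_cast
    rfl

/-- This is the share of a single group element of depth a in the integral of |G_t|: it belongs to
G_t exactly for t ≤ a - 1. -/
theorem integral_indicator_ceil (a : ℕ∞) {u : ℝ} (hu : -1 ≤ u) :
    ∫ t in (-1 : ℝ)..u, (if (((⌈t⌉ + 1).toNat : ℕ) : ℕ∞) ≤ a then (1 : ℝ) else 0) =
      truncMin a (u + 1) := by
  have key : ∀ v, -1 ≤ v → truncMin a (v + 1) = v + 1 →
      ∫ t in (-1 : ℝ)..v, (if (((⌈t⌉ + 1).toNat : ℕ) : ℕ∞) ≤ a then (1 : ℝ) else 0) = v + 1 := by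
    intro v hv h
    rw [intervalIntegral.integral_congr (g := fun _ => (1 : ℝ))]
    · simp
    · intro t ht
      rw [Set.uIcc_of_le hv] at ht
      refine if_pos (((Nat.cast_le (α := ℕ∞)).2 (Int.toNat_le_toNat ?_)).trans
        ((truncMin_eq_self_iff a).1 h))
      have := ht.2
      gcongr
  have hint : ∀ v w : ℝ, IntervalIntegrable
      (fun t : ℝ => if (((⌈t⌉ + 1).toNat : ℕ) : ℕ∞) ≤ a then (1 : ℝ) else 0)
      MeasureTheory.volume v w := by
    intro v w
    refine Antitone.intervalIntegrable fun t t' h => ?_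
    have h1 : (((⌈t⌉ + 1).toNat : ℕ) : ℕ∞) ≤ ((⌈t'⌉ + 1).toNat : ℕ) :=
      Nat.cast_le.2 (Int.toNat_le_toNat (by gcongr))
    split_ifs with h2 h3
    · exact le_rfl
    · exact absurd (h1.trans h2) h3
    · exact zero_le_one
    · exact le_rfl
  by_cases h : truncMin a (u + 1) = u + 1
  · rw [h, key u hu h]
  induction a with
  | top => simp at h
  | coe n =>
    rw [truncMin_coe, min_eq_right_iff, not_le] at h
    rw [truncMin_coe, min_eq_left h.le,
      ← intervalIntegral.integral_add_adjacent_intervals (hint (-1) (n - 1)) (hint (n - 1) u),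
      key (n - 1) (by simp) (by simp), intervalIntegral.integral_of_le (by linarith),
      MeasureTheory.setIntegral_congr_fun (g := fun _ => (0 : ℝ)) measurableSet_Ioc]
    · simp
    · intro t ht
      have h0 : (0 : ℝ) ≤ n := Nat.cast_nonneg n
      refine if_neg fun h3 => ?_
      have := (truncMin_eq_self_iff n).2 h3
      rw [truncMin_coe, min_eq_right_iff] at this
      linarith [ht.1]

end TruncMin

section Phi

variable (B : Type*) {G : Type*} [CommRing B] [IsLocalRing B] [Group G] [MulSemiringAction G B]

/-- The largest `n` such that `σ` acts trivially modulo the `n`-th power of the maximal ideal. -/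
noncomputable def ramificationDepth (σ : G) : ℕ∞ :=
  ⨆ n : {n : ℕ // σ ∈ congruenceSubgroup B G n}, (n : ℕ∞)

variable {B}

theorem le_ramificationDepth_iff {σ : G} {n : ℕ} :
    (n : ℕ∞) ≤ ramificationDepth B σ ↔ σ ∈ congruenceSubgroup B G n := by
  constructor
  · intro h
    cases n with
    | zero => rw [congruenceSubgroup_zero]; trivial
    | succ k =>
      have h1 : (k : ℕ∞) < ramificationDepth B σ :=
        lt_of_lt_of_le (by exact_mod_cast Nat.lt_succ_self k) h
      obtain ⟨⟨m, hm⟩, hkm⟩ := lt_iSup_iff.1 h1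
      exact congruenceSubgroup_antitone (Nat.succ_le_of_lt (by exact_mod_cast hkm)) hm
  · intro h
    exact le_iSup (fun n : {n : ℕ // σ ∈ congruenceSubgroup B G n} => (n : ℕ∞)) ⟨n, h⟩

theorem eq_ramificationDepth {σ : G} {a : ℕ∞}
    (h : ∀ n : ℕ, (n : ℕ∞) ≤ a ↔ σ ∈ congruenceSubgroup B G n) : ramificationDepth B σ = a := by
  refine le_antisymm (ENat.forall_natCast_le_iff_le.1 fun n hn => ?_)
    (ENat.forall_natCast_le_iff_le.1 fun n hn => ?_)
  · exact (h n).2 (le_ramificationDepth_iff.1 hn)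
  · exact le_ramificationDepth_iff.2 ((h n).1 hn)

theorem ramificationDepth_one : ramificationDepth B (1 : G) = ⊤ :=
  eq_ramificationDepth fun _ => ⟨fun _ => one_mem _, fun _ => le_top⟩

theorem min_le_ramificationDepth_mul (σ τ : G) :
    min (ramificationDepth B σ) (ramificationDepth B τ) ≤ ramificationDepth B (σ * τ) := by
  refine ENat.forall_natCast_le_iff_le.1 fun n hn => ?_
  rw [le_min_iff] at hn
  exact le_ramificationDepth_iff.2
    (mul_mem (le_ramificationDepth_iff.1 hn.1) (le_ramificationDepth_iff.1 hn.2))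

theorem ramificationDepth_inv (σ : G) : ramificationDepth B σ⁻¹ = ramificationDepth B σ :=
  eq_ramificationDepth fun n => by rw [le_ramificationDepth_iff, inv_mem_iff]

theorem mem_lowerRamificationGroup_iff {σ : G} {u : ℝ} :
    σ ∈ lowerRamificationGroup B G u ↔ truncMin (ramificationDepth B σ) (u + 1) = u + 1 := by
  rw [truncMin_eq_self_iff, le_ramificationDepth_iff, lowerRamificationGroup_eq]

variable [Fintype G]

theorem natCard_lowerRamificationGroup (t : ℝ) :
    (Nat.card (lowerRamificationGroup B G t) : ℝ) =
      ∑ σ : G, if (((⌈t⌉ + 1).toNat : ℕ) : ℕ∞) ≤ ramificationDepth B σ then (1 : ℝ) else 0 := by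
  classical
  rw [Finset.sum_boole, Nat.card_eq_fintype_card, Fintype.card_subtype]
  congr 3
  ext σ
  rw [le_ramificationDepth_iff, lowerRamificationGroup_eq]

-- Exchanging the integral of |G_t| with the sum over the group turns φ into an average of truncated
-- depths, convenient for fibrewise sums. The summand 1 on the left is the integral over [-1, 0],
-- where the integrand is 1 except at -1.
variable (B G) in
theorem herbrandPhi_add_one {u : ℝ} (hu : -1 ≤ u) :
    herbrandPhi B G u + 1 = (∑ σ : G, truncMin (ramificationDepth B σ) (u + 1)) /
      Nat.card (lowerRamificationGroup B G 0) := by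
  have hint : ∀ a b : ℝ, IntervalIntegrable
      (fun t : ℝ => (Nat.card (lowerRamificationGroup B G t) : ℝ)) MeasureTheory.volume a b := by
    intro a b
    refine Antitone.intervalIntegrable fun t t' h => ?_
    exact_mod_cast Subgroup.card_le_of_le (lowerRamificationGroup_antitone h)
  have h1 : ∀ v : ℝ, -1 ≤ v → ∫ t in (-1 : ℝ)..v, (Nat.card (lowerRamificationGroup B G t) : ℝ) =
      ∑ σ : G, truncMin (ramificationDepth B σ) (v + 1) := by
    intro v hv
    simp_rw [natCard_lowerRamificationGroup]
    rw [intervalIntegral.integral_finsetSum]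
    · exact Finset.sum_congr rfl fun σ _ => integral_indicator_ceil _ hv
    · intro σ _
      refine Antitone.intervalIntegrable fun t t' h => ?_
      have h1 : (((⌈t⌉ + 1).toNat : ℕ) : ℕ∞) ≤ ((⌈t'⌉ + 1).toNat : ℕ) :=
        Nat.cast_le.2 (Int.toNat_le_toNat (by gcongr))
      split_ifs with h2 h3
      · exact le_rfl
      · exact absurd (h1.trans h2) h3
      · exact zero_le_one
      · exact le_rfl
  have h2 : (Nat.card (lowerRamificationGroup B G 0) : ℝ) =
      ∑ σ : G, truncMin (ramificationDepth B σ) 1 := by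
    rw [natCard_lowerRamificationGroup]
    refine Finset.sum_congr rfl fun σ _ => ?_
    have h3 := truncMin_eq_self_iff (ramificationDepth B σ) (u := 0)
    rw [zero_add] at h3
    split_ifs with h
    · exact (h3.2 h).symm
    · generalize ramificationDepth B σ = a at *
      induction a with
      | top => simp at h
      | coe n =>
        rw [truncMin_coe]
        cases n <;> simp at h ⊢
  have h0 : (Nat.card (lowerRamificationGroup B G 0) : ℝ) ≠ 0 :=
    Nat.cast_ne_zero.2 Nat.card_pos.ne'
  rw [herbrandPhi, intervalIntegral.integral_div,
    ← intervalIntegral.integral_interval_sub_left (hint (-1) u) (hint (-1) 0), h1 u hu,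
    h1 0 (by norm_num), zero_add, ← h2, sub_div, div_self h0, sub_add_cancel]

omit [Fintype G] in
theorem strictMonoOn_sum_truncMin {s : Finset G} (hs : 1 ∈ s) :
    StrictMonoOn (fun x => ∑ σ ∈ s, truncMin (ramificationDepth B σ) x) (Set.Ici 0) := by
  intro x _ y _ h
  refine Finset.sum_lt_sum (fun σ _ => truncMin_mono _ h.le) ⟨1, hs, ?_⟩
  simpa [ramificationDepth_one] using h

omit [Fintype G]
variable [Finite G]

variable (B G) in
theorem strictMonoOn_herbrandPhi : StrictMonoOn (herbrandPhi B G) (Set.Ici (-1)) := by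
  have := Fintype.ofFinite G
  intro x hx y hy h
  have h0 : (0 : ℝ) < Nat.card (lowerRamificationGroup B G 0) := Nat.cast_pos.2 Nat.card_pos
  rw [← add_lt_add_iff_right 1, herbrandPhi_add_one B G hx, herbrandPhi_add_one B G hy,
    div_lt_div_iff_of_pos_right h0]
  rw [Set.mem_Ici] at hx hy
  exact strictMonoOn_sum_truncMin (Finset.mem_univ 1) (Set.mem_Ici.2 (by linarith))
    (Set.mem_Ici.2 (by linarith)) (by linarith)

variable (B G) in
theorem herbrandPhi_neg_one : herbrandPhi B G (-1) = -1 := by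
  have := Fintype.ofFinite G
  have := herbrandPhi_add_one B G (u := -1) le_rfl
  simp only [neg_add_cancel, truncMin_zero, Finset.sum_const_zero, zero_div] at this
  linarith

variable (B G) in
theorem neg_one_le_herbrandPhi {u : ℝ} (hu : -1 ≤ u) : -1 ≤ herbrandPhi B G u := by
  rw [← herbrandPhi_neg_one B G]
  exact (strictMonoOn_herbrandPhi B G).monotoneOn Set.self_mem_Ici hu hu

variable (B G) in
theorem surjOn_herbrandPhi :
    Set.SurjOn (herbrandPhi B G) (Set.Ici (-1)) (Set.Ici (-1)) := by
  have := Fintype.ofFinite G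
  intro v hv
  rw [Set.mem_Ici] at hv
  set c : ℝ := (Nat.card (lowerRamificationGroup B G 0) : ℝ) with hc
  have h0 : (1 : ℝ) ≤ c := by
    rw [hc]; exact_mod_cast Nat.one_le_iff_ne_zero.2 Nat.card_pos.ne'
  -- At u = c(v + 1) - 1 the contribution of the identity alone, (u + 1)/c, already gives φ(u) ≥ v,
  -- so the intermediate value theorem applies on [-1, u].
  have hle : (-1 : ℝ) ≤ c * (v + 1) - 1 := by nlinarith
  have hcont : ContinuousOn (herbrandPhi B G) (Set.Icc (-1) (c * (v + 1) - 1)) := by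
    have h1 : ContinuousOn (fun u => (∑ σ : G, truncMin (ramificationDepth B σ) (u + 1)) / c - 1)
        (Set.Icc (-1) (c * (v + 1) - 1)) := by
      refine Continuous.continuousOn ((Continuous.div_const ?_ c).sub continuous_const)
      exact continuous_finsetSum _ fun σ _ =>
        (continuous_truncMin _).comp (continuous_id.add continuous_const)
    refine h1.congr fun u hu => ?_
    have := herbrandPhi_add_one B G hu.1
    rw [← hc] at this
    simp only [← this, add_sub_cancel_right]
  obtain ⟨u, hu, huv⟩ := intermediate_value_Icc hle hcont (show v ∈ _ by
    refine ⟨by rwa [herbrandPhi_neg_one], ?_⟩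
    rw [← add_le_add_iff_right 1, herbrandPhi_add_one B G hle, ← hc, le_div_iff₀ (by linarith)]
    have h1 := Finset.single_le_sum
      (f := fun σ : G => truncMin (ramificationDepth B σ) (c * (v + 1) - 1 + 1))
      (fun σ _ => truncMin_nonneg _ (by nlinarith)) (Finset.mem_univ 1)
    rw [ramificationDepth_one, truncMin_top] at h1
    linarith)
  exact ⟨u, hu.1, huv⟩

theorem neg_one_le_herbrandPsi {v : ℝ} (hv : -1 ≤ v) : -1 ≤ herbrandPsi B G v :=
  Function.invFunOn_mem (surjOn_herbrandPhi B G hv)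

theorem herbrandPhi_herbrandPsi {v : ℝ} (hv : -1 ≤ v) :
    herbrandPhi B G (herbrandPsi B G v) = v :=
  Function.invFunOn_eq (surjOn_herbrandPhi B G hv)

theorem herbrandPsi_herbrandPhi {u : ℝ} (hu : -1 ≤ u) :
    herbrandPsi B G (herbrandPhi B G u) = u :=
  (strictMonoOn_herbrandPhi B G).injOn (neg_one_le_herbrandPsi (neg_one_le_herbrandPhi B G hu)) hu
    (herbrandPhi_herbrandPsi (neg_one_le_herbrandPhi B G hu))

theorem upperRamificationGroup_herbrandPhi {u : ℝ} (hu : -1 ≤ u) :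
    upperRamificationGroup B G (herbrandPhi B G u) = lowerRamificationGroup B G u := by
  rw [upperRamificationGroup, herbrandPsi_herbrandPhi hu]

theorem herbrandPhi_le_iff {u v : ℝ} (hu : -1 ≤ u) (hv : -1 ≤ v) :
    herbrandPhi B G u ≤ v ↔ u ≤ herbrandPsi B G v := by
  conv_lhs => rw [← herbrandPhi_herbrandPsi (B := B) (G := G) hv]
  exact (strictMonoOn_herbrandPhi B G).le_iff_le hu (neg_one_le_herbrandPsi hv)

theorem herbrandPsi_le_iff {u v : ℝ} (hu : -1 ≤ u) (hv : -1 ≤ v) :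
    herbrandPsi B G v ≤ u ↔ v ≤ herbrandPhi B G u := by
  conv_rhs => rw [← herbrandPhi_herbrandPsi (B := B) (G := G) hv]
  exact ((strictMonoOn_herbrandPhi B G).le_iff_le (neg_one_le_herbrandPsi hv) hu).symm

theorem upperRamificationGroup_antitoneOn :
    AntitoneOn (upperRamificationGroup B G) (Set.Ici (-1)) := by
  intro v hv w hw h
  refine lowerRamificationGroup_antitone ?_
  rw [herbrandPsi_le_iff (neg_one_le_herbrandPsi hw) hv, herbrandPhi_herbrandPsi hw]
  exact h

end Phi

/-! ### The theorem of Herbrand -/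

section Herbrand

variable {B G B' G' : Type*} [CommRing B] [IsLocalRing B] [Group G] [MulSemiringAction G B]
  [CommRing B'] [IsLocalRing B'] [Group G'] [MulSemiringAction G' B']

-- Depth is ultrametric: if σ is deepest in its coset of the kernel, then σt has depth min(depth σ,
-- depth t) for every t in the kernel.
open scoped Classical in
theorem exists_sum_fiber_truncMin [Fintype G] {ρ : G →* G'} {σ : G}
    (hσ : ∀ τ : G, ρ τ = ρ σ → ramificationDepth B τ ≤ ramificationDepth B σ) (x : ℝ) :
    ∑ τ with ρ τ = ρ σ, truncMin (ramificationDepth B τ) x =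
      ∑ t with t ∈ ρ.ker, truncMin (ramificationDepth B t)
        (truncMin (ramificationDepth B σ) x) := by
  refine Finset.sum_bij' (fun τ _ => σ⁻¹ * τ) (fun t _ => σ * t) ?_ ?_ ?_ ?_ ?_
  · intro τ hτ
    have hτ : ρ τ = ρ σ := by simpa using hτ
    simp [MonoidHom.mem_ker, hτ]
  · intro t ht
    simpa [MonoidHom.mem_ker] using ht
  · intro τ _; simp
  · intro t _; simp
  · intro τ hτ
    rw [← truncMin_min]
    congr 1
    have hτ : ρ τ = ρ σ := by simpa using hτ
    have h1 := hσ τ hτ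
    have h2 := min_le_ramificationDepth_mul (B := B) σ⁻¹ τ
    have h3 := min_le_ramificationDepth_mul (B := B) σ (σ⁻¹ * τ)
    rw [ramificationDepth_inv, min_eq_right h1] at h2
    rw [mul_inv_cancel_left, min_comm] at h3
    exact le_antisymm (le_min h2 h1) h3

open scoped Classical in
/-- The theorem of Herbrand on the upper numbering of a quotient, with the formula for the
ramification depth in the quotient as a hypothesis. -/
theorem map_upperRamificationGroup_of_sum_eq [Fintype G] [Finite G'] {ρ : G →* G'}
    (hρ : Function.Surjective ρ) {e : ℕ}
    (hcard : Nat.card (lowerRamificationGroup B G 0) = e * Nat.card (lowerRamificationGroup B' G' 0))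
    (hsum : ∀ σ' : G', (e : ℕ∞) * ramificationDepth B' σ' =
      ∑ σ with ρ σ = σ', ramificationDepth B σ) {v : ℝ} (hv : -1 ≤ v) :
    (upperRamificationGroup B G v).map ρ = upperRamificationGroup B' G' v := by
  have := Fintype.ofFinite G'
  have he : e ≠ 0 := by
    rintro rfl
    rw [zero_mul] at hcard
    exact Nat.card_pos.ne' hcard
  have he' : (0 : ℝ) < e := Nat.cast_pos.2 (Nat.pos_of_ne_zero he)
  set T : ℝ → ℝ := fun x => ∑ t with t ∈ ρ.ker, truncMin (ramificationDepth B t) x with hT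
  have hTmono : StrictMonoOn T (Set.Ici 0) :=
    strictMonoOn_sum_truncMin (by simp)
  have hT0 : T 0 = 0 := by simp [hT, truncMin_zero]
  have hTnonneg : ∀ x, 0 ≤ x → 0 ≤ T x :=
    fun x hx => Finset.sum_nonneg fun t _ => truncMin_nonneg _ hx
  have hmax : ∀ σ' : G', ∃ σ : G, ρ σ = σ' ∧
      ∀ τ : G, ρ τ = σ' → ramificationDepth B τ ≤ ramificationDepth B σ := by
    intro σ'
    obtain ⟨σ₀, hσ₀⟩ := hρ σ'
    obtain ⟨σ, hσ, h⟩ := Finset.exists_max_image (Finset.univ.filter fun σ => ρ σ = σ')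
      (ramificationDepth B) ⟨σ₀, by simpa using hσ₀⟩
    exact ⟨σ, by simpa using hσ, fun τ hτ => h τ (by simpa using hτ)⟩
  choose s hs hsmax using hmax
  have hfib : ∀ (σ' : G') (x : ℝ), ∑ τ with ρ τ = σ', truncMin (ramificationDepth B τ) x =
      T (truncMin (ramificationDepth B (s σ')) x) := by
    intro σ' x
    have := exists_sum_fiber_truncMin (B := B) (ρ := ρ) (σ := s σ')
      (by rw [hs]; exact hsmax σ') x
    rwa [hs] at this
  -- The hypothesis on sums says that e times the depth of σ' is T at the depth of the deepest lift.
  -- As T is increasing, truncation commutes with it.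
  have hquot : ∀ (σ' : G') (x : ℝ), 0 ≤ x → e * truncMin (ramificationDepth B' σ') (T x / e) =
      T (truncMin (ramificationDepth B (s σ')) x) := by
    intro σ' x hx
    have h1 := hsum σ'
    rcases eq_or_ne (ramificationDepth B (s σ')) ⊤ with htop | htop
    · have h2 : ramificationDepth B' σ' = ⊤ := by
        have h3 : ∑ σ with ρ σ = σ', ramificationDepth B σ = ⊤ :=
          top_le_iff.1 (htop ▸ Finset.single_le_sum (f := fun σ => ramificationDepth B σ)
            (fun _ _ => zero_le) (by simpa using hs σ'))
        rw [h3] at h1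
        by_contra h4
        obtain ⟨n, hn⟩ := ENat.ne_top_iff_exists.1 h4
        rw [← hn, ← Nat.cast_mul] at h1
        exact ENat.natCast_ne_top _ h1
      rw [htop, h2, truncMin_top, truncMin_top]
      field_simp
    · have hlt : ∀ σ, ρ σ = σ' → ramificationDepth B σ ≠ ⊤ :=
        fun σ hσ h => htop (top_le_iff.1 (h ▸ hsmax σ' σ hσ))
      have h2 : ((∑ σ with ρ σ = σ', (ramificationDepth B σ).toNat : ℕ) : ℕ∞) =
          ∑ σ with ρ σ = σ', ramificationDepth B σ := by
        rw [Nat.cast_sum]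
        refine Finset.sum_congr rfl fun σ hσ => ENat.natCast_toNat (hlt σ (by simpa using hσ))
      rw [← h2] at h1
      have h3 : ramificationDepth B' σ' ≠ ⊤ := by
        intro h
        rw [h, ENat.mul_top (by exact_mod_cast he)] at h1
        exact ENat.natCast_ne_top _ h1.symm
      obtain ⟨n, hn⟩ := ENat.ne_top_iff_exists.1 h3
      obtain ⟨j, hj⟩ := ENat.ne_top_iff_exists.1 htop
      rw [← hn] at h1 ⊢
      have h4 : e * n = ∑ σ with ρ σ = σ', (ramificationDepth B σ).toNat := by exact_mod_cast h1
      have h5 : (e * n : ℝ) = T j := by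
        have h6 := hfib σ' j
        rw [← hj, truncMin_coe, min_self] at h6
        rw [← h6, ← Nat.cast_mul, h4, Nat.cast_sum]
        refine Finset.sum_congr rfl fun σ hσ => ?_
        have hσ : ρ σ = σ' := by simpa using hσ
        obtain ⟨m, hm⟩ := ENat.ne_top_iff_exists.1 (hlt σ hσ)
        have := hsmax σ' σ hσ
        rw [← hm, ← hj, Nat.cast_le] at this
        rw [← hm, truncMin_coe, ENat.toNat_natCast, min_eq_left (by exact_mod_cast this)]
      rw [← hj, truncMin_coe, truncMin_coe, mul_min_of_nonneg _ _ he'.le, h5,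
        mul_div_cancel₀ _ he'.ne']
      rcases le_total (j : ℝ) x with h | h
      · rw [min_eq_left h, min_eq_left (hTmono.monotoneOn (Set.mem_Ici.2 (Nat.cast_nonneg j)) hx h)]
      · rw [min_eq_right h, min_eq_right (hTmono.monotoneOn hx (Set.mem_Ici.2 (Nat.cast_nonneg j)) h)]
  set u := herbrandPsi B G v with hu
  have hu1 : -1 ≤ u := neg_one_le_herbrandPsi hv
  have hu0 : 0 ≤ u + 1 := by linarith
  -- This is the Herbrand function of the kernel at u. The equality `hphi` below is the transitivity
  -- of φ for G, the kernel and the quotient.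
  set w := T (u + 1) / e - 1 with hw
  have hw1 : -1 ≤ w := by
    have := div_nonneg (hTnonneg _ hu0) he'.le
    linarith
  have hw2 : w + 1 = T (u + 1) / e := by rw [hw]; ring
  have hphi : herbrandPhi B' G' w = v := by
    rw [← herbrandPhi_herbrandPsi (B := B) (G := G) hv, ← hu, ← add_left_inj 1,
      herbrandPhi_add_one B' G' hw1, herbrandPhi_add_one B G hu1, hw2, hcard,
      ← Finset.sum_fiberwise Finset.univ ρ]
    simp_rw [hfib, ← hquot _ _ hu0]
    rw [← Finset.mul_sum]
    push_cast
    rw [mul_div_mul_left _ _ he'.ne']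
  rw [← hphi, upperRamificationGroup_herbrandPhi hw1, hphi, upperRamificationGroup, ← hu]
  have hmem : ∀ σ' : G', σ' ∈ lowerRamificationGroup B' G' w ↔
      s σ' ∈ lowerRamificationGroup B G u := by
    intro σ'
    rw [mem_lowerRamificationGroup_iff, mem_lowerRamificationGroup_iff, hw2,
      ← mul_right_inj' he'.ne', hquot _ _ hu0, mul_div_cancel₀ _ he'.ne']
    exact hTmono.injOn.eq_iff (truncMin_nonneg _ hu0) hu0
  ext σ'
  rw [hmem, Subgroup.mem_map]
  constructor
  · rintro ⟨σ, hσ, rfl⟩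
    rw [mem_lowerRamificationGroup_iff, truncMin_eq_self_iff] at hσ ⊢
    exact hσ.trans (hsmax _ σ rfl)
  · intro h
    exact ⟨_, h, hs σ'⟩

end Herbrand

/-! ### The depth formula for a quotient when the rings are generated by one element -/

section Monogenic

open Polynomial
open IsDiscreteValuationRing (addVal addVal_le_iff_dvd)

variable {A B G : Type*} [CommRing A] [CommRing B] [IsDomain B] [IsDiscreteValuationRing B]
  [Algebra A B] [Group G] [MulSemiringAction G B] [SMulCommClass G A B]

theorem natCast_le_addVal_iff {n : ℕ} {b : B} :
    (n : ℕ∞) ≤ addVal B b ↔ b ∈ maximalIdeal B ^ n := by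
  obtain ⟨π, hπ⟩ := IsDiscreteValuationRing.exists_irreducible B
  rw [mem_maximalIdeal_pow_iff hπ, ← addVal_le_iff_dvd, hπ.addVal_pow]

theorem mem_congruenceSubgroup_iff_of_adjoin_eq_top {x : B} (hx : Algebra.adjoin A {x} = ⊤)
    {σ : G} {n : ℕ} :
    σ ∈ congruenceSubgroup B G n ↔ σ • x - x ∈ maximalIdeal B ^ n := by
  refine ⟨fun h => h x, fun h b => ?_⟩
  have : (Ideal.Quotient.mkₐ A (maximalIdeal B ^ n)).comp (MulSemiringAction.toAlgHom A B σ) =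
      Ideal.Quotient.mkₐ A (maximalIdeal B ^ n) := by
    refine AlgHom.ext_of_adjoin_eq_top hx ?_
    rintro _ rfl
    exact Ideal.Quotient.eq.2 h
  exact Ideal.Quotient.eq.1 (DFunLike.congr_fun this b)

theorem ramificationDepth_eq_addVal {x : B} (hx : Algebra.adjoin A {x} = ⊤) (σ : G) :
    ramificationDepth B σ = addVal B (σ • x - x) :=
  eq_ramificationDepth fun n => by
    rw [natCast_le_addVal_iff, mem_congruenceSubgroup_iff_of_adjoin_eq_top hx]

variable {B' G' : Type*} [CommRing B'] [IsDomain B'] [IsDiscreteValuationRing B'] [Algebra A B']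
  [Group G'] [MulSemiringAction G' B'] [SMulCommClass G' A B'] [Algebra B' B]
  [IsScalarTower A B' B]

-- Let F be the product of the X - tx for t in the kernel, a polynomial over B'. The value of σF at
-- x is, up to sign, the product on the right. It is divisible by σy - y because σF - F has
-- coefficients divisible by σy - y. Conversely, if y = g(x) with g over A, then F divides g - y;
-- applying σ and evaluating at x shows that σF(x) divides y - σy.
omit [IsDiscreteValuationRing B] [IsDomain B'] [IsDiscreteValuationRing B'] in
open scoped Classical in
theorem associated_algebraMap_smul_sub_prod [Fintype G] [FaithfulSMul G B] {ρ : G →* G'}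
    (hcompat : ∀ (σ : G) (b : B'), algebraMap B' B (ρ σ • b) = σ • algebraMap B' B b)
    (hfix : ∀ b : B, (∀ t ∈ ρ.ker, t • b = b) → b ∈ (algebraMap B' B).range)
    (hinj : Function.Injective (algebraMap B' B))
    {x : B} (hx : Algebra.adjoin A {x} = ⊤) {y : B'} (hy : Algebra.adjoin A {y} = ⊤) (σ : G) :
    Associated (algebraMap B' B (ρ σ • y - y)) (∏ t with t ∈ ρ.ker, ((σ * t) • x - x)) := by
  set F : B[X] := ∏ t with t ∈ ρ.ker, (X - C (t • x)) with hF
  let φ (τ : G) : B →+* B := MulSemiringAction.toRingHom G B τ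
  have hφ : ∀ (τ : G) b, φ τ b = τ • b := fun _ _ => rfl
  have hφF : ∀ τ : G, F.map (φ τ) = ∏ t with t ∈ ρ.ker, (X - C ((τ * t) • x)) := by
    intro τ
    rw [hF, Polynomial.map_prod]
    refine Finset.prod_congr rfl fun t _ => ?_
    rw [Polynomial.map_sub, map_X, map_C, hφ, mul_smul]
  have hmonic : F.Monic := monic_prod_of_monic _ _ fun t _ => monic_X_sub_C _
  have hFx : F.eval x = 0 := by
    rw [hF, eval_prod]
    exact Finset.prod_eq_zero (i := 1) (by simp) (by simp)
  have hFσ : (F.map (φ σ)).eval x = (-1) ^ (Finset.univ.filter (· ∈ ρ.ker)).card *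
      ∏ t with t ∈ ρ.ker, ((σ * t) • x - x) := by
    rw [hφF, eval_prod, ← Finset.prod_const, ← Finset.prod_mul_distrib]
    refine Finset.prod_congr rfl fun t _ => ?_
    rw [eval_sub, eval_X, eval_C]
    ring
  have hlift : ∃ f : B'[X], f.map (algebraMap B' B) = F := by
    rw [← Polynomial.mem_lifts, lifts_iff_coeff_lifts]
    intro n
    refine hfix _ fun τ hτ => ?_
    have h1 : F.map (φ τ) = F := by
      rw [hφF, hF]
      refine Finset.prod_bij' (fun t _ => τ * t) (fun t _ => τ⁻¹ * t) ?_ ?_ ?_ ?_ ?_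
      · intro t ht
        simp only [Finset.mem_filter, Finset.mem_univ, true_and] at ht ⊢
        exact mul_mem hτ ht
      · intro t ht
        simp only [Finset.mem_filter, Finset.mem_univ, true_and] at ht ⊢
        exact mul_mem (inv_mem hτ) ht
      · intro t _; simp
      · intro t _; simp
      · intro t _; rfl
    have := congrArg (fun g => coeff g n) h1
    rwa [coeff_map] at this
  obtain ⟨f, hf⟩ := hlift
  have hfmonic : f.Monic := by
    refine Polynomial.monic_of_injective hinj ?_
    rwa [hf]
  have hcompat' : (φ σ).comp (algebraMap B' B) =
      (algebraMap B' B).comp (MulSemiringAction.toRingHom G' B' (ρ σ)) :=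
    RingHom.ext fun b => (hcompat σ b).symm
  have hFσ' : F.map (φ σ) =
      (f.map (MulSemiringAction.toRingHom G' B' (ρ σ))).map (algebraMap B' B) := by
    rw [← hf, Polynomial.map_map, Polynomial.map_map, hcompat']
  have hmem : (F.map (φ σ)).eval x ∈ Ideal.span {algebraMap B' B (ρ σ • y - y)} := by
    have h1 : (F.map (φ σ)).eval x = (F.map (φ σ)).eval x - F.eval x := by rw [hFx, sub_zero]
    rw [h1, hFσ', ← hf, ← eval_sub, ← Polynomial.map_sub, eval_map, eval₂_eq_sum_range]
    refine sum_mem fun n _ => Ideal.mul_mem_right _ _ ?_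
    rw [Ideal.mem_span_singleton]
    refine map_dvd _ ?_
    rw [coeff_sub, coeff_map]
    have h2 : (Ideal.Quotient.mkₐ A (Ideal.span {ρ σ • y - y})).comp
        (MulSemiringAction.toAlgHom A B' (ρ σ)) =
        Ideal.Quotient.mkₐ A (Ideal.span {ρ σ • y - y}) := by
      refine AlgHom.ext_of_adjoin_eq_top hy ?_
      rintro _ rfl
      exact Ideal.Quotient.eq.2 (Ideal.mem_span_singleton_self _)
    rw [← Ideal.mem_span_singleton]
    exact Ideal.Quotient.eq.1 (DFunLike.congr_fun h2 (f.coeff n))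
  rw [Ideal.mem_span_singleton] at hmem
  have hunit : IsUnit ((-1 : B) ^ (Finset.univ.filter (· ∈ ρ.ker)).card) := by
    exact (isUnit_one.neg).pow _
  refine associated_of_dvd_dvd ?_ ?_
  · rw [hFσ] at hmem
    exact (hunit.dvd_mul_left).1 hmem
  · have hyx : algebraMap B' B y ∈ Algebra.adjoin A {x} := by rw [hx]; trivial
    rw [Algebra.adjoin_singleton_eq_range_aeval] at hyx
    obtain ⟨g, hg⟩ := hyx
    have hg : aeval x g = algebraMap B' B y := hg
    set h : B'[X] := g.map (algebraMap A B') - C y with hh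
    have hroot : (h.map (algebraMap B' B)).eval x = 0 := by
      rw [hh, Polynomial.map_sub, eval_sub, Polynomial.map_map, map_C, eval_C,
        ← IsScalarTower.algebraMap_eq, eval_map_algebraMap, hg, sub_self]
    -- Division by the monic f can be tested over B, where F is a product of linear factors whose
    -- roots are roots of g - y.
    have hdvd : f ∣ h := by
      rw [← modByMonic_eq_zero_iff_dvd hfmonic]
      refine Polynomial.map_injective _ hinj ?_
      rw [map_modByMonic _ hfmonic, hf, Polynomial.map_zero,
        modByMonic_eq_zero_iff_dvd hmonic]
      rcases eq_or_ne (h.map (algebraMap B' B)) 0 with h0 | h0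
      · rw [h0]; exact dvd_zero _
      have hF' : F = (((Finset.univ.filter (· ∈ ρ.ker)).val.map (fun t => t • x)).map
          (fun a => X - C a)).prod := by
        rw [Multiset.map_map]; rfl
      rw [hF', Multiset.prod_X_sub_C_dvd_iff_le_roots h0, Multiset.le_iff_subset]
      · intro a ha
        obtain ⟨t, ht, rfl⟩ := Multiset.mem_map.1 ha
        have ht : ρ t = 1 := by simpa [MonoidHom.mem_ker] using ht
        rw [mem_roots h0, IsRoot.def]
        have h5 : (φ t).comp (algebraMap B' B) = algebraMap B' B :=
          RingHom.ext fun b => by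
            have := hcompat t b
            rw [ht, one_smul] at this
            exact this.symm
        have := congrArg (φ t) hroot
        rw [map_zero, ← Polynomial.eval_map_apply, Polynomial.map_map, h5] at this
        exact this
      -- The conjugates tx are pairwise distinct because x generates B over A and the action is
      -- faithful.
      · refine Multiset.Nodup.map_on (fun t _ t' _ htt => ?_) (Finset.nodup _)
        refine FaithfulSMul.eq_of_smul_eq_smul (α := B) fun b => ?_
        have h6 : MulSemiringAction.toAlgHom A B t = MulSemiringAction.toAlgHom A B t' := by
          refine AlgHom.ext_of_adjoin_eq_top hx ?_
          rintro _ rfl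
          exact htt
        exact DFunLike.congr_fun h6 b
    obtain ⟨k, hk⟩ := hdvd
    have h3 : algebraMap B' B (ρ σ • y - y) = - ((h.map
        (MulSemiringAction.toRingHom G' B' (ρ σ))).map (algebraMap B' B)).eval x := by
      have h4 : (MulSemiringAction.toRingHom G' B' (ρ σ)).comp (algebraMap A B') =
          algebraMap A B' :=
        (MulSemiringAction.toAlgHom A B' (ρ σ)).comp_algebraMap
      rw [hh, Polynomial.map_sub, Polynomial.map_sub, eval_sub, map_C, map_C, eval_C,
        Polynomial.map_map (algebraMap A B'), h4, Polynomial.map_map, ← IsScalarTower.algebraMap_eq,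
        eval_map_algebraMap, hg, map_sub, neg_sub]
      rfl
    rw [h3, dvd_neg, hk, Polynomial.map_mul, Polynomial.map_mul, eval_mul, ← hFσ', hFσ, mul_assoc]
    exact Dvd.dvd.mul_left (dvd_mul_right _ _) _

-- Depths are valuations of σx - x and σ'y - y, so taking valuations in the preceding association
-- yields exactly the sum formula that the abstract form of Herbrand's theorem requires.
open scoped Classical in
theorem map_upperRamificationGroup_of_monogenic [Finite G] [Finite G'] [FaithfulSMul G B]
    {ρ : G →* G'} (hρ : Function.Surjective ρ)
    (hcompat : ∀ (σ : G) (b : B'), algebraMap B' B (ρ σ • b) = σ • algebraMap B' B b)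
    (hfix : ∀ b : B, (∀ t ∈ ρ.ker, t • b = b) → b ∈ (algebraMap B' B).range)
    (hinj : Function.Injective (algebraMap B' B))
    {x : B} (hx : Algebra.adjoin A {x} = ⊤) {y : B'} (hy : Algebra.adjoin A {y} = ⊤) {e : ℕ}
    (hcard : Nat.card (lowerRamificationGroup B G 0) = e * Nat.card (lowerRamificationGroup B' G' 0))
    (he : ∀ b : B', addVal B (algebraMap B' B b) = e * addVal B' b) {v : ℝ} (hv : -1 ≤ v) :
    (upperRamificationGroup B G v).map ρ = upperRamificationGroup B' G' v := by
  have := Fintype.ofFinite G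
  refine map_upperRamificationGroup_of_sum_eq hρ hcard (fun σ' => ?_) hv
  obtain ⟨σ, rfl⟩ := hρ σ'
  rw [ramificationDepth_eq_addVal hy, ← he,
    (IsDiscreteValuationRing.addVal_eq_iff_associated _ _).2
      (associated_algebraMap_smul_sub_prod hcompat hfix hinj hx hy σ)]
  have hprod : ∀ (s : Finset G) (f : G → B), addVal B (∏ t ∈ s, f t) = ∑ t ∈ s, addVal B (f t) := by
    intro s f
    induction s using Finset.induction_on with
    | empty => simp
    | insert a s ha ih =>
      rw [Finset.prod_insert ha, Finset.sum_insert ha, IsDiscreteValuationRing.addVal_mul, ih]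
  rw [hprod]
  refine Finset.sum_bij' (fun t _ => σ * t) (fun τ _ => σ⁻¹ * τ) ?_ ?_ ?_ ?_ ?_
  · intro t ht
    simpa [MonoidHom.mem_ker] using ht
  · intro τ hτ
    have hτ : ρ τ = ρ σ := by simpa using hτ
    simp [MonoidHom.mem_ker, hτ]
  · intro t _; simp
  · intro τ _; simp
  · intro t _
    rw [ramificationDepth_eq_addVal hx]

end Monogenic

/-! ### The ring of integers of a finite extension of `ℚ_[p]` -/

section RingOfIntegers

variable (p : ℕ) [Fact p.Prime] (L : Type*) [Field L] [Algebra ℚ_[p] L] [Algebra ℤ_[p] L]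
  [IsScalarTower ℤ_[p] ℚ_[p] L] [FiniteDimensional ℚ_[p] L]

instance finite_integralClosure_padicInt : Module.Finite ℤ_[p] (integralClosure ℤ_[p] L) :=
  IsIntegralClosure.finite ℤ_[p] ℚ_[p] L _

instance isDedekindDomain_integralClosure_padicInt :
    IsDedekindDomain (integralClosure ℤ_[p] L) :=
  integralClosure.isDedekindDomain ℤ_[p] ℚ_[p] L

instance isFractionRing_integralClosure_padicInt :
    IsFractionRing (integralClosure ℤ_[p] L) L :=
  integralClosure.isFractionRing_of_finite_extension ℚ_[p] L

instance isGaloisGroup_integralClosure_padicInt [IsGalois ℚ_[p] L] :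
    IsGaloisGroup Gal(L/ℚ_[p]) ℤ_[p] (integralClosure ℤ_[p] L) :=
  IsGaloisGroup.of_isFractionRing _ _ _ ℚ_[p] L

omit [FiniteDimensional ℚ_[p] L] in
theorem algebraMap_padicInt_injective : Function.Injective (algebraMap ℤ_[p] L) := by
  rw [IsScalarTower.algebraMap_eq ℤ_[p] ℚ_[p] L]
  exact (algebraMap ℚ_[p] L).injective.comp (IsFractionRing.injective ℤ_[p] ℚ_[p])

omit [FiniteDimensional ℚ_[p] L] in
theorem algebraMap_integralClosure_padicInt_injective :
    Function.Injective (algebraMap ℤ_[p] (integralClosure ℤ_[p] L)) := by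
  have := algebraMap_padicInt_injective p L
  rw [IsScalarTower.algebraMap_eq ℤ_[p] (integralClosure ℤ_[p] L) L] at this
  rw [RingHom.coe_comp] at this
  exact Function.Injective.of_comp this

instance isTorsionFree_integralClosure_padicInt :
    Module.IsTorsionFree ℤ_[p] (integralClosure ℤ_[p] L) := by
  have : FaithfulSMul ℤ_[p] (integralClosure ℤ_[p] L) :=
    (faithfulSMul_iff_algebraMap_injective _ _).2 (algebraMap_integralClosure_padicInt_injective p L)
  infer_instance

instance liesOver_maximalIdeal_integralClosure_padicInt :
    (maximalIdeal (integralClosure ℤ_[p] L)).LiesOver (maximalIdeal ℤ_[p]) := by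
  have := Ideal.isMaximal_comap_of_isIntegral_of_isMaximal (R := ℤ_[p])
    (maximalIdeal (integralClosure ℤ_[p] L))
  exact ⟨(eq_maximalIdeal this).symm⟩

theorem natCast_mem_maximalIdeal_integralClosure :
    (p : integralClosure ℤ_[p] L) ∈ maximalIdeal (integralClosure ℤ_[p] L) := by
  have h : (p : ℤ_[p]) ∈ maximalIdeal ℤ_[p] := by
    rw [PadicInt.maximalIdeal_eq_span_p]; exact Ideal.mem_span_singleton_self _
  rw [(liesOver_maximalIdeal_integralClosure_padicInt p L).over] at h
  simpa [Ideal.under] using h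

omit [FiniteDimensional ℚ_[p] L] in
theorem natCast_integralClosure_ne_zero : (p : integralClosure ℤ_[p] L) ≠ 0 := by
  rw [← map_natCast (algebraMap ℤ_[p] (integralClosure ℤ_[p] L)), Ne,
    map_eq_zero_iff _ (algebraMap_integralClosure_padicInt_injective p L)]
  exact PadicInt.prime_p.ne_zero

instance isDiscreteValuationRing_integralClosure_padicInt :
    IsDiscreteValuationRing (integralClosure ℤ_[p] L) := by
  have hf : ¬ IsField (integralClosure ℤ_[p] L) := fun h => ?_
  · exact ((IsDiscreteValuationRing.TFAE (integralClosure ℤ_[p] L) hf).out 0 2).2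
      (isDedekindDomain_integralClosure_padicInt p L)
  have := natCast_mem_maximalIdeal_integralClosure p L
  rw [isField_iff_maximalIdeal_eq.1 h, Ideal.mem_bot] at this
  exact natCast_integralClosure_ne_zero p L this

instance faithfulSMul_integralClosure_padicInt :
    FaithfulSMul Gal(L/ℚ_[p]) (integralClosure ℤ_[p] L) := by
  refine ⟨fun {σ τ} h => AlgEquiv.ext fun x => ?_⟩
  obtain ⟨a, b, hb, rfl⟩ := IsFractionRing.div_surjective (integralClosure ℤ_[p] L) x
  have h' : ∀ b : integralClosure ℤ_[p] L, σ (algebraMap _ L b) = τ (algebraMap _ L b) :=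
    fun b => congrArg (algebraMap (integralClosure ℤ_[p] L) L) (h b)
  rw [map_div₀, map_div₀, h', h']

instance finite_residueField_integralClosure_padicInt :
    Finite (ResidueField (integralClosure ℤ_[p] L)) := by
  have : Finite (ResidueField ℤ_[p]) := Finite.of_equiv (ZMod p) (PadicInt.residueField (p := p)).symm.toEquiv
  have : IsLocalHom (algebraMap ℤ_[p] (integralClosure ℤ_[p] L)) :=
    ((Algebra.isIntegral_def.1 (inferInstance : Algebra.IsIntegral ℤ_[p] (integralClosure ℤ_[p] L)))
      |> fun h => RingHom.IsIntegral.isLocalHom h (algebraMap_integralClosure_padicInt_injective p L))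
  exact ResidueField.finite_of_finite (R := ℤ_[p]) inferInstance

theorem card_padicInt_quotient_under :
    Nat.card (ℤ_[p] ⧸ (maximalIdeal (integralClosure ℤ_[p] L)).under ℤ_[p]) = p := by
  rw [← (liesOver_maximalIdeal_integralClosure_padicInt p L).over]
  exact (Nat.card_congr (PadicInt.residueField (p := p)).toEquiv).trans (Nat.card_zmod p)

theorem exists_frobenius_integralClosure [IsGalois ℚ_[p] L] :
    ∃ τ : Gal(L/ℚ_[p]), ∀ b : integralClosure ℤ_[p] L,
      τ • b - b ^ p ∈ maximalIdeal (integralClosure ℤ_[p] L) := by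
  have : Finite (integralClosure ℤ_[p] L ⧸ maximalIdeal (integralClosure ℤ_[p] L)) :=
    finite_residueField_integralClosure_padicInt p L
  obtain ⟨τ, hτ⟩ := IsArithFrobAt.exists_of_isInvariant ℤ_[p] Gal(L/ℚ_[p])
    (maximalIdeal (integralClosure ℤ_[p] L))
  refine ⟨τ, fun b => ?_⟩
  have := hτ b
  rwa [card_padicInt_quotient_under] at this

theorem exists_prime_pow_residueField :
    ∃ q : ℕ, (q : integralClosure ℤ_[p] L) ∈ maximalIdeal (integralClosure ℤ_[p] L) ∧
      ∀ b : integralClosure ℤ_[p] L, b ^ q - b ∈ maximalIdeal (integralClosure ℤ_[p] L) := by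
  have := Fintype.ofFinite (ResidueField (integralClosure ℤ_[p] L))
  refine ⟨Fintype.card (ResidueField (integralClosure ℤ_[p] L)), ?_, fun b => ?_⟩
  · rw [← residue_eq_zero_iff, map_natCast, FiniteField.cast_card_eq_zero]
  · rw [← residue_eq_zero_iff, map_sub, map_pow, FiniteField.pow_card, sub_self]

/-- The residue field is perfect, so the order of inertia is the ramification index. -/
theorem maximalIdeal_pow_card_inertia [IsGalois ℚ_[p] L] :
    maximalIdeal (integralClosure ℤ_[p] L) ^
      Nat.card (lowerRamificationGroup (integralClosure ℤ_[p] L) Gal(L/ℚ_[p]) 0) =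
        Ideal.span {(p : integralClosure ℤ_[p] L)} := by
  have hp0 : maximalIdeal ℤ_[p] ≠ ⊥ := IsDiscreteValuationRing.not_a_field _
  have : Finite (ℤ_[p] ⧸ maximalIdeal ℤ_[p]) :=
    Finite.of_equiv (ZMod p) (PadicInt.residueField (p := p)).symm.toEquiv
  have : PerfectField (maximalIdeal ℤ_[p]).ResidueField := by
    have : Finite (maximalIdeal ℤ_[p]).ResidueField :=
      Finite.of_surjective _
        (Ideal.bijective_algebraMap_quotient_residueField (maximalIdeal ℤ_[p])).2
    infer_instance
  have h1 := Ideal.card_inertia_eq_ramificationIdxIn (G := Gal(L/ℚ_[p])) (maximalIdeal ℤ_[p])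
    (maximalIdeal (integralClosure ℤ_[p] L))
  rw [Ideal.ramificationIdxIn_eq_ramificationIdx (maximalIdeal ℤ_[p])
    (maximalIdeal (integralClosure ℤ_[p] L)) Gal(L/ℚ_[p]),
    ← Ideal.ramificationIdx'_eq_ramificationIdx (maximalIdeal ℤ_[p])
    (maximalIdeal (integralClosure ℤ_[p] L)) hp0] at h1
  have h2 : lowerRamificationGroup (integralClosure ℤ_[p] L) Gal(L/ℚ_[p]) 0 =
      Ideal.inertia Gal(L/ℚ_[p]) (maximalIdeal (integralClosure ℤ_[p] L)) := by
    rw [lowerRamificationGroup, Ideal.inertia]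
    simp
  have h3 : (maximalIdeal ℤ_[p]).map (algebraMap ℤ_[p] (integralClosure ℤ_[p] L)) =
      Ideal.span {(p : integralClosure ℤ_[p] L)} := by
    rw [PadicInt.maximalIdeal_eq_span_p, Ideal.map_span, Set.image_singleton, map_natCast]
  obtain ⟨π, hπ⟩ := IsDiscreteValuationRing.exists_irreducible (integralClosure ℤ_[p] L)
  obtain ⟨n, hn⟩ := IsDiscreteValuationRing.ideal_eq_span_pow_irreducible
    (s := Ideal.span {(p : integralClosure ℤ_[p] L)})
    (by simpa using natCast_integralClosure_ne_zero p L) hπ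
  rw [← maximalIdeal_pow_eq_span hπ] at hn
  rw [h2, h1, hn]
  congr 1
  refine Ideal.ramificationIdx'_spec (by rw [h3, hn]) ?_
  rw [h3, hn]
  exact (Ideal.pow_succ_lt_pow (IsDiscreteValuationRing.not_a_field _) n).not_ge

/-- Choose x lifting a generator of the multiplicative group of the residue field, with x^q - x a
uniformizer. Polynomials in x then represent all classes modulo every power of P, in particular
modulo p, and Nakayama's lemma concludes. -/
theorem exists_adjoin_eq_top_integralClosure :
    ∃ x : integralClosure ℤ_[p] L, Algebra.adjoin ℤ_[p] {x} = ⊤ := by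
  set B := integralClosure ℤ_[p] L with hB
  obtain ⟨g, hg⟩ := IsCyclic.exists_generator (α := (ResidueField B)ˣ)
  obtain ⟨x₀, hx₀⟩ := residue_surjective (g : ResidueField B)
  obtain ⟨q, hq0, hq⟩ := exists_prime_pow_residueField p L
  obtain ⟨π, hπ⟩ := IsDiscreteValuationRing.exists_irreducible B
  have hπP : π ∈ maximalIdeal B := by
    rw [hπ.maximalIdeal_eq]; exact Ideal.mem_span_singleton_self π
  -- If x₀^q - x₀ is already in P^2, replace x₀ by x₀ + π: its q-th power changes only within P^2,
  -- so the difference changes by -π modulo P^2.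
  have hx : ∃ x : B, residue B x = g ∧ x ^ q - x ∉ maximalIdeal B ^ 2 := by
    by_cases h : x₀ ^ q - x₀ ∈ maximalIdeal B ^ 2
    · refine ⟨x₀ + π, ?_, fun h' => ?_⟩
      · rw [map_add, hx₀, (residue_eq_zero_iff π).2 hπP, add_zero]
      · have h1 : (x₀ + π) ^ q - x₀ ^ q ∈ maximalIdeal B ^ (1 + 1) :=
          pow_sub_pow_mem_pow_succ hq0 one_ne_zero (by simpa using hπP)
        have h2 : π ∈ maximalIdeal B ^ 2 := by
          have := add_mem (sub_mem h1 h') h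
          convert this using 1; ring
        rw [mem_maximalIdeal_pow_iff hπ, pow_two] at h2
        exact hπ.not_isUnit (isUnit_of_dvd_one
          ((mul_dvd_mul_iff_left hπ.ne_zero).1 (by rwa [mul_one])))
    · exact ⟨x₀, hx₀, h⟩
  obtain ⟨x, hxg, hx2⟩ := hx
  have hϖ : ∃ v : B, IsUnit v ∧ x ^ q - x = π * v := by
    have h1 := hq x
    rw [hπ.maximalIdeal_eq, Ideal.mem_span_singleton] at h1
    obtain ⟨v, hv⟩ := h1
    refine ⟨v, ?_, hv⟩
    by_contra hu
    apply hx2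
    rw [hv, pow_two]
    exact Ideal.mul_mem_mul hπP hu
  obtain ⟨v, hv, hxv⟩ := hϖ
  refine ⟨x, ?_⟩
  set S := Algebra.adjoin ℤ_[p] {x} with hS
  have hxS : x ∈ S := Algebra.self_mem_adjoin_singleton _ _
  have h0 : ∀ b : B, ∃ s ∈ S, b - s ∈ maximalIdeal B := by
    intro b
    by_cases hb : residue B b = 0
    · exact ⟨0, zero_mem _, by rwa [sub_zero, ← residue_eq_zero_iff]⟩
    · obtain ⟨k, hk⟩ := Subgroup.mem_zpowers_iff.1 (hg (Units.mk0 _ hb))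
      obtain ⟨n, hn⟩ : ∃ n : ℕ, g ^ n = Units.mk0 _ hb := by
        have := Finite.of_injective _ (Units.val_injective (α := ResidueField B))
        have h1 := (mem_powers_iff_mem_zpowers (x := g) (y := Units.mk0 _ hb)).2 ⟨k, hk⟩
        exact h1
      refine ⟨x ^ n, pow_mem hxS n, ?_⟩
      rw [← residue_eq_zero_iff, map_sub, map_pow, hxg, ← Units.val_pow_eq_pow_val, hn,
        Units.val_mk0, sub_self]
  have h1 : ∀ n : ℕ, ∀ b : B, ∃ s ∈ S, b - s ∈ maximalIdeal B ^ n := by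
    intro n
    induction n with
    | zero => exact fun b => ⟨0, zero_mem _, by simp⟩
    | succ n ih =>
      intro b
      obtain ⟨s, hs, hbs⟩ := ih b
      rw [mem_maximalIdeal_pow_iff hπ] at hbs
      obtain ⟨c, hc⟩ := hbs
      obtain ⟨w, hw⟩ := hv.exists_right_inv
      obtain ⟨s', hs', hcs⟩ := h0 (w ^ n * c)
      refine ⟨s + (x ^ q - x) ^ n * s', add_mem hs (mul_mem (pow_mem
        (sub_mem (pow_mem hxS q) hxS) n) hs'), ?_⟩
      have h2 : v ^ n * w ^ n = 1 := by rw [← mul_pow, hw, one_pow]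
      have h3 : b - (s + (x ^ q - x) ^ n * s') = π ^ n * (v ^ n * (w ^ n * c - s')) := by
        rw [hxv, mul_pow]
        linear_combination hc - π ^ n * c * h2
      rw [h3, pow_mul_mem_maximalIdeal_pow_iff hπ, pow_one]
      exact Ideal.mul_mem_left _ _ hcs
  obtain ⟨e, he⟩ : ∃ e : ℕ, maximalIdeal B ^ e = Ideal.span {(p : B)} := by
    obtain ⟨n, hn⟩ := IsDiscreteValuationRing.ideal_eq_span_pow_irreducible
      (s := Ideal.span {(p : B)}) (by simpa using natCast_integralClosure_ne_zero p L) hπ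
    exact ⟨n, by rw [hn, maximalIdeal_pow_eq_span hπ]⟩
  have h2 : (⊤ : Submodule ℤ_[p] B) ≤ Subalgebra.toSubmodule S := by
    refine Submodule.le_of_le_smul_of_le_jacobson_bot (I := maximalIdeal ℤ_[p])
      Module.Finite.fg_top (maximalIdeal_le_jacobson _) fun b _ => ?_
    obtain ⟨s, hs, hbs⟩ := h1 e b
    rw [he, Ideal.mem_span_singleton] at hbs
    obtain ⟨c, hc⟩ := hbs
    rw [eq_add_of_sub_eq' hc]
    refine Submodule.add_mem_sup hs ?_
    have h3 : (p : B) * c = (p : ℤ_[p]) • c := by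
      rw [Algebra.smul_def, map_natCast]
    rw [h3]
    refine Submodule.smul_mem_smul ?_ trivial
    rw [PadicInt.maximalIdeal_eq_span_p]
    exact Ideal.mem_span_singleton_self _
  exact eq_top_iff.2 fun b _ => h2 (Submodule.mem_top (x := b))

end RingOfIntegers

/-! ### Herbrand's theorem for towers over ℚ_p -/

section Tower

variable (p : ℕ) [Fact p.Prime] (E L : Type*) [Field L] [Algebra ℚ_[p] L] [Algebra ℤ_[p] L]
  [IsScalarTower ℤ_[p] ℚ_[p] L] [FiniteDimensional ℚ_[p] L] [IsGalois ℚ_[p] L] [Field E]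
  [Algebra ℚ_[p] E] [Algebra ℤ_[p] E] [IsScalarTower ℤ_[p] ℚ_[p] E] [FiniteDimensional ℚ_[p] E]
  [IsGalois ℚ_[p] E] [Algebra E L] [IsScalarTower ℚ_[p] E L]

theorem addVal_natCast_integralClosure :
    IsDiscreteValuationRing.addVal (integralClosure ℤ_[p] L) (p : integralClosure ℤ_[p] L) =
      (Nat.card (lowerRamificationGroup (integralClosure ℤ_[p] L) Gal(L/ℚ_[p]) 0) : ℕ) := by
  obtain ⟨π, hπ⟩ := IsDiscreteValuationRing.exists_irreducible (integralClosure ℤ_[p] L)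
  have h := maximalIdeal_pow_card_inertia p L
  rw [maximalIdeal_pow_eq_span hπ, Ideal.span_singleton_eq_span_singleton] at h
  rw [← (IsDiscreteValuationRing.addVal_eq_iff_associated _ _).2 h, hπ.addVal_pow]

/-- The theorem of Herbrand for finite Galois extensions of `ℚ_[p]`. -/
theorem map_restrictNormalHom_upperRamificationGroup {v : ℝ} (hv : -1 ≤ v) :
    (upperRamificationGroup (integralClosure ℤ_[p] L) Gal(L/ℚ_[p]) v).map
      (AlgEquiv.restrictNormalHom E) =
        upperRamificationGroup (integralClosure ℤ_[p] E) Gal(E/ℚ_[p]) v := by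
  have : IsScalarTower ℤ_[p] E L := by
    refine IsScalarTower.of_algebraMap_eq fun x => ?_
    rw [IsScalarTower.algebraMap_apply ℤ_[p] ℚ_[p] L, IsScalarTower.algebraMap_apply ℤ_[p] ℚ_[p] E,
      ← IsScalarTower.algebraMap_apply ℚ_[p] E L]
  let ι := (IsScalarTower.toAlgHom ℤ_[p] E L).mapIntegralClosure
  have hι : ∀ b, ((ι b : integralClosure ℤ_[p] L) : L) = algebraMap E L b := fun _ => rfl
  let _ : Algebra (integralClosure ℤ_[p] E) (integralClosure ℤ_[p] L) := ι.toRingHom.toAlgebra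
  have hmap : ∀ b, algebraMap (integralClosure ℤ_[p] E) (integralClosure ℤ_[p] L) b = ι b :=
    fun _ => rfl
  have : IsScalarTower ℤ_[p] (integralClosure ℤ_[p] E) (integralClosure ℤ_[p] L) :=
    IsScalarTower.of_algebraMap_eq fun x => (ι.commutes x).symm
  have hinj : Function.Injective
      (algebraMap (integralClosure ℤ_[p] E) (integralClosure ℤ_[p] L)) := by
    intro a b hab
    exact Subtype.ext ((algebraMap E L).injective (congrArg Subtype.val hab))
  obtain ⟨x, hx⟩ := exists_adjoin_eq_top_integralClosure p L
  obtain ⟨y, hy⟩ := exists_adjoin_eq_top_integralClosure p E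
  obtain ⟨π, hπ⟩ := IsDiscreteValuationRing.exists_irreducible (integralClosure ℤ_[p] E)
  have hfin : IsDiscreteValuationRing.addVal (integralClosure ℤ_[p] L)
      (algebraMap (integralClosure ℤ_[p] E) (integralClosure ℤ_[p] L) π) ≠ ⊤ := by
    rw [Ne, IsDiscreteValuationRing.addVal_eq_top_iff, map_eq_zero_iff _ hinj]
    exact hπ.ne_zero
  -- Here e is the ramification index of L over E, read as the valuation in L of a uniformizer of E.
  -- Comparing the valuations of p in E and L then gives `hcard`.
  obtain ⟨e, he⟩ := ENat.ne_top_iff_exists.1 hfin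
  have hval0 : ∀ b : integralClosure ℤ_[p] E, b ≠ 0 →
      IsDiscreteValuationRing.addVal (integralClosure ℤ_[p] L)
        (algebraMap (integralClosure ℤ_[p] E) (integralClosure ℤ_[p] L) b) =
      e * IsDiscreteValuationRing.addVal (integralClosure ℤ_[p] E) b := by
    intro b hb
    obtain ⟨n, u, rfl⟩ := IsDiscreteValuationRing.eq_unit_mul_pow_irreducible hb hπ
    rw [IsDiscreteValuationRing.addVal_def' u hπ, map_mul, map_pow,
      IsDiscreteValuationRing.addVal_mul, IsDiscreteValuationRing.addVal_pow, ← he,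
      IsDiscreteValuationRing.addVal_eq_zero_iff.2 (u.isUnit.map _), zero_add, nsmul_eq_mul,
      mul_comm]
  have hcard : Nat.card (lowerRamificationGroup (integralClosure ℤ_[p] L) Gal(L/ℚ_[p]) 0) =
      e * Nat.card (lowerRamificationGroup (integralClosure ℤ_[p] E) Gal(E/ℚ_[p]) 0) := by
    have h1 := hval0 p (natCast_integralClosure_ne_zero p E)
    rw [map_natCast, addVal_natCast_integralClosure, addVal_natCast_integralClosure] at h1
    exact_mod_cast h1
  have he0 : e ≠ 0 := by
    rintro rfl
    rw [zero_mul] at hcard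
    exact Nat.card_pos.ne' hcard
  have hval : ∀ b : integralClosure ℤ_[p] E,
      IsDiscreteValuationRing.addVal (integralClosure ℤ_[p] L)
        (algebraMap (integralClosure ℤ_[p] E) (integralClosure ℤ_[p] L) b) =
      e * IsDiscreteValuationRing.addVal (integralClosure ℤ_[p] E) b := by
    intro b
    rcases eq_or_ne b 0 with rfl | hb
    · rw [map_zero, IsDiscreteValuationRing.addVal_zero, IsDiscreteValuationRing.addVal_zero,
        ENat.mul_top (by exact_mod_cast he0)]
    · exact hval0 b hb
  refine map_upperRamificationGroup_of_monogenic (AlgEquiv.restrictNormalHom_surjective L)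
    (fun σ b => ?_) (fun b hb => ?_) hinj hx hy (e := e) hcard hval hv
  · refine Subtype.ext ?_
    exact AlgEquiv.restrictNormal_commutes σ E b
  · have : IsGalois E L := IsGalois.tower_top_of_isGalois ℚ_[p] E L
    have : FiniteDimensional E L := FiniteDimensional.right ℚ_[p] E L
    have h1 : (b : L) ∈ Set.range (algebraMap E L) := by
      rw [IsGalois.mem_range_algebraMap_iff_fixed]
      intro g
      refine congrArg Subtype.val (hb (AlgEquiv.restrictScalars ℚ_[p] g) ?_)
      rw [MonoidHom.mem_ker]
      ext z
      refine (algebraMap E L).injective ?_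
      rw [AlgEquiv.one_apply]
      exact (AlgEquiv.restrictNormal_commutes _ E z).trans (g.commutes z)
    obtain ⟨z, hz⟩ := h1
    have hzi : IsIntegral ℤ_[p] z := by
      rw [← isIntegral_algebraMap_iff (algebraMap E L).injective, hz]
      exact b.2
    exact ⟨⟨z, hzi⟩, Subtype.ext hz⟩

end Tower

/-! ### Ramification groups of an abelian extension of `ℚ_[p]` -/

section AbelianRamification

variable (p : ℕ) [Fact p.Prime] (L : Type*) [Field L] [Algebra ℚ_[p] L] [Algebra ℤ_[p] L]
  [IsScalarTower ℤ_[p] ℚ_[p] L] [FiniteDimensional ℚ_[p] L]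

/-- The ramification group `G_{n - 1}` of a finite extension of `ℚ_[p]`, for an integer `n`. -/
noncomputable abbrev padicRamificationGroup (n : ℕ) : Subgroup Gal(L/ℚ_[p]) :=
  congruenceSubgroup (integralClosure ℤ_[p] L) Gal(L/ℚ_[p]) n

/-- The ramification groups in the upper numbering of a finite extension of `ℚ_[p]`. -/
noncomputable abbrev padicUpperRamificationGroup (v : ℝ) : Subgroup Gal(L/ℚ_[p]) :=
  upperRamificationGroup (integralClosure ℤ_[p] L) Gal(L/ℚ_[p]) v

theorem lowerRamificationGroup_zero_eq :
    lowerRamificationGroup (integralClosure ℤ_[p] L) Gal(L/ℚ_[p]) 0 =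
      padicRamificationGroup p L 1 := by
  rw [lowerRamificationGroup_eq]
  simp

theorem exists_notMem_padicRamificationGroup {σ : Gal(L/ℚ_[p])} (hσ : σ ≠ 1) :
    ∃ n, σ ∉ padicRamificationGroup p L n := by
  by_contra! h
  apply hσ
  refine FaithfulSMul.eq_of_smul_eq_smul (α := integralClosure ℤ_[p] L) fun b => ?_
  rw [one_smul, ← sub_eq_zero, ← IsDiscreteValuationRing.addVal_eq_top_iff, ENat.eq_top_iff_forall_ge]
  exact fun n => natCast_le_addVal_iff.2 (h n b)

theorem exists_padicRamificationGroup_eq_bot : ∃ n, padicRamificationGroup p L n = ⊥ := by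
  have h : ∀ σ : Gal(L/ℚ_[p]), ∃ n, σ ∈ padicRamificationGroup p L n → σ = 1 := by
    intro σ
    by_cases hσ : σ = 1
    · exact ⟨0, fun _ => hσ⟩
    · obtain ⟨n, hn⟩ := exists_notMem_padicRamificationGroup p L hσ
      exact ⟨n, fun h => absurd h hn⟩
  choose n hn using h
  have := Fintype.ofFinite Gal(L/ℚ_[p])
  refine ⟨Finset.univ.sup n, (Subgroup.eq_bot_iff_forall _).2 fun σ hσ => hn σ ?_⟩
  exact congruenceSubgroup_antitone (Finset.le_sup (Finset.mem_univ σ)) hσ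

theorem exists_pow_prime_pow_eq_one {σ : Gal(L/ℚ_[p])} (hσ : σ ∈ padicRamificationGroup p L 2) :
    ∃ k, σ ^ p ^ k = 1 := by
  obtain ⟨n, hn⟩ := exists_padicRamificationGroup_eq_bot p L
  refine ⟨n, ?_⟩
  rw [← Subgroup.mem_bot, ← hn]
  exact congruenceSubgroup_antitone (Nat.le_add_right n 2) (pow_prime_pow_mem_congruenceSubgroup
    (Fact.out : p.Prime) (natCast_mem_maximalIdeal_integralClosure p L) hσ n)

/-- The automorphism induced on the finite residue field is a power of Frobenius. -/
theorem exists_smul_sub_pow_mem (σ : Gal(L/ℚ_[p])) : ∃ n : ℕ, ∀ b : integralClosure ℤ_[p] L,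
    σ • b - b ^ p ^ n ∈ maximalIdeal (integralClosure ℤ_[p] L) := by
  set B := integralClosure ℤ_[p] L
  have hpk : (p : ResidueField B) = 0 := by
    rw [← map_natCast (residue B)]
    exact (residue_eq_zero_iff _).2 (natCast_mem_maximalIdeal_integralClosure p L)
  have : CharP (ResidueField B) p := (CharP.charP_iff_prime_eq_zero Fact.out).2 hpk
  let _ := ZMod.algebra (ResidueField B) p
  let f := ResidueField.mapEquiv (MulSemiringAction.toRingEquiv Gal(L/ℚ_[p]) B σ)
  let f' : Gal(ResidueField B/ZMod p) := AlgEquiv.ofRingEquiv (f := f) fun x => by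
    exact DFunLike.congr_fun (Subsingleton.elim
      ((f : ResidueField B →+* ResidueField B).comp (algebraMap (ZMod p) (ResidueField B)))
      (algebraMap (ZMod p) (ResidueField B))) x
  obtain ⟨n, hn⟩ := (FiniteField.bijective_frobeniusAlgEquivOfAlgebraic_pow (ZMod p)
    (ResidueField B)).2 f'
  refine ⟨n, fun b => ?_⟩
  have h1 : f' (residue B b) = residue B (σ • b) := rfl
  rw [← residue_eq_zero_iff, map_sub, ← h1, ← hn, map_pow, sub_eq_zero]
  simp only [AlgEquiv.coe_pow, FiniteField.coe_frobeniusAlgEquivOfAlgebraic_iterate, ZMod.card]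
  rfl

theorem exists_frobenius_pow_inv_mul_mem [IsGalois ℚ_[p] L] {τ : Gal(L/ℚ_[p])}
    (hτ : ∀ b : integralClosure ℤ_[p] L, τ • b - b ^ p ∈ maximalIdeal (integralClosure ℤ_[p] L))
    (σ : Gal(L/ℚ_[p])) : ∃ n : ℕ, (τ ^ n)⁻¹ * σ ∈ padicRamificationGroup p L 1 := by
  obtain ⟨n, hn⟩ := exists_smul_sub_pow_mem p L σ
  have h1 : ∀ b : integralClosure ℤ_[p] L,
      τ ^ n • b - b ^ p ^ n ∈ maximalIdeal (integralClosure ℤ_[p] L) := by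
    clear hn
    induction n with
    | zero => simp
    | succ n ih =>
      intro b
      have h2 := add_mem (hτ (τ ^ n • b)) (Ideal.Quotient.eq.1 (congrArg (· ^ p)
        (Ideal.Quotient.eq.2 (ih b))))
      rw [pow_succ', mul_smul, pow_succ p, pow_mul]
      convert h2 using 1
      ring
  refine ⟨n, fun b => ?_⟩
  have h2 := sub_mem (hn b) (h1 b)
  rw [sub_sub_sub_cancel_right] at h2
  rw [← pow_one (maximalIdeal _)] at h2
  have h3 := smul_mem_maximalIdeal_pow (τ ^ n)⁻¹ h2
  rwa [smul_sub, inv_smul_smul, ← mul_smul] at h3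

variable {L} in
theorem relIndex_le_of_frobenius {K : Subgroup Gal(L/ℚ_[p])} {d : ℕ} (hd : 0 < d)
    {t : Gal(L/ℚ_[p])} (ht : t ^ d = 1)
    (hK : ∀ σ ∈ K, ∃ n : ℕ, (t ^ n)⁻¹ * σ ∈ padicRamificationGroup p L 1) :
    (padicRamificationGroup p L 1).relIndex K ≤ d := by
  have h : ∀ σ : Gal(L/ℚ_[p]), ∃ n : ℕ, n < d ∧
      (σ ∈ K → (t ^ n)⁻¹ * σ ∈ padicRamificationGroup p L 1) := by
    intro σ
    by_cases hσ : σ ∈ K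
    · obtain ⟨n, hn⟩ := hK σ hσ
      refine ⟨n % d, Nat.mod_lt n hd, fun _ => ?_⟩
      rwa [← pow_mod_orderOf, Nat.mod_mod_of_dvd _ (orderOf_dvd_of_pow_eq_one ht), pow_mod_orderOf]
    · exact ⟨0, hd, fun h => absurd h hσ⟩
  choose f hf hf' using h
  refine (Subgroup.relIndex_le_of_map (Set.Iio d) (Set.finite_Iio d) f (fun σ _ => hf σ)
    fun σ hσ σ' hσ' h => ?_).trans ?_
  · have := mul_mem (inv_mem (hf' σ hσ)) (hf' σ' hσ')
    rw [h] at this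
    convert this using 1
    group
  · rw [← Nat.card_coe_set_eq]
    simp

theorem index_inertia_le [IsGalois ℚ_[p] L] {d : ℕ} (hd : 0 < d)
    (h : ∀ σ : Gal(L/ℚ_[p]), σ ^ d = 1) : (padicRamificationGroup p L 1).index ≤ d := by
  obtain ⟨τ, hτ⟩ := exists_frobenius_integralClosure p L
  rw [← Subgroup.relIndex_top_right]
  exact relIndex_le_of_frobenius p hd (h τ)
    fun σ _ => exists_frobenius_pow_inv_mul_mem p L hτ σ

theorem relIndex_padicRamificationGroup_le [IsAbelianGalois ℚ_[p] L] (i : ℕ) :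
    (padicRamificationGroup p L (i + 2)).relIndex (padicRamificationGroup p L (i + 1)) ≤
      if i = 0 then p - 1 else p := by
  obtain ⟨τ, hτ⟩ := exists_frobenius_integralClosure p L
  obtain ⟨q, hq0, hq⟩ := exists_prime_pow_residueField p L
  exact relIndex_congruenceSubgroup_le Fact.out (natCast_mem_maximalIdeal_integralClosure p L)
    hq0 hq hτ (fun σ => mul_comm' σ τ) i

end AbelianRamification

/-! ### Abelian extensions of exponent p -/

theorem herbrandPhi_eq_self {B G : Type*} [CommRing B] [IsLocalRing B] [Group G]
    [MulSemiringAction G B] [Finite G] {u w : ℝ}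
    (h : lowerRamificationGroup B G u = lowerRamificationGroup B G 0) (hw : -1 ≤ w) (hwu : w ≤ u) :
    herbrandPhi B G w = w := by
  classical
  have := Fintype.ofFinite G
  have h0 : (Nat.card (lowerRamificationGroup B G 0) : ℝ) ≠ 0 :=
    Nat.cast_ne_zero.2 Nat.card_pos.ne'
  rw [← add_left_inj 1, herbrandPhi_add_one B G hw, div_eq_iff h0, mul_comm,
    natCard_lowerRamificationGroup, Finset.sum_mul]
  refine Finset.sum_congr rfl fun σ _ => ?_
  split_ifs with hσ
  · rw [one_mul]
    have h1 : σ ∈ lowerRamificationGroup B G u := by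
      rw [h, mem_lowerRamificationGroup_iff, truncMin_eq_self_iff]; exact hσ
    exact mem_lowerRamificationGroup_iff.1 (lowerRamificationGroup_antitone hwu h1)
  · have h1 : ramificationDepth B σ = 0 := by
      by_contra h2
      refine hσ ?_
      simpa using Order.one_le_iff_ne_zero.2 h2
    rw [h1, zero_mul, ← Nat.cast_zero, truncMin_coe, Nat.cast_zero, min_eq_left (by linarith)]

theorem Subgroup.eq_of_relIndex_lt {G : Type*} [Group G] [Finite G] {p k : ℕ} (hp : p.Prime)
    (hG : Nat.card G ∣ p ^ k) {H K : Subgroup G} (h : H ≤ K) (hlt : H.relIndex K < p) : H = K := by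
  have h1 : H.relIndex K ∣ p ^ k := by
    have h2 := Subgroup.relIndex_mul_relIndex ⊥ H K bot_le h
    rw [Subgroup.relIndex_bot_left, Subgroup.relIndex_bot_left] at h2
    exact (Dvd.intro_left _ h2).trans ((Subgroup.card_subgroup_dvd_card K).trans hG)
  obtain ⟨i, -, hi⟩ := (Nat.dvd_prime_pow hp).1 h1
  cases i with
  | zero => exact le_antisymm h (Subgroup.relIndex_eq_one.1 (by simpa using hi))
  | succ i =>
    rw [hi, pow_succ] at hlt
    have := Nat.le_mul_of_pos_left p (pow_pos hp.pos i)
    omega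

/-- Take N maximal among the subgroups containing S and avoiding σ. For g outside N, maximality puts
σ in N⟨g⟩, and exponent p lets this be solved for g, so σ generates the quotient, which has order p.
-/
theorem Subgroup.exists_index_prime_of_notMem {G : Type*} [Group G] [Finite G]
    (hcomm : ∀ a b : G, a * b = b * a) {p : ℕ} (hp : p.Prime) (hG : ∀ a : G, a ^ p = 1)
    {S : Subgroup G} {σ : G} (hσ : σ ∉ S) : ∃ N : Subgroup G, S ≤ N ∧ σ ∉ N ∧ N.index = p := by
  obtain ⟨N, hSN, hN⟩ := Finite.exists_le_maximal (p := fun N : Subgroup G => σ ∉ N) hσ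
  refine ⟨N, hSN, hN.1, ?_⟩
  have hNn : N.Normal := ⟨fun a ha b => by rwa [hcomm b a, mul_inv_cancel_right]⟩
  have hgen : ∀ g : G, ∃ k : ℤ, (σ ^ k)⁻¹ * g ∈ N := by
    intro g
    by_cases hg : g ∈ N
    · exact ⟨0, by simpa using hg⟩
    have h1 : σ ∈ N ⊔ Subgroup.zpowers g := by
      by_contra h
      exact hg (hN.2 h le_sup_left (Subgroup.mem_sup_right (Subgroup.mem_zpowers g)))
    obtain ⟨n, hn, z, hz, rfl⟩ := Subgroup.mem_sup_of_normal_left.1 h1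
    obtain ⟨i, rfl⟩ := Subgroup.mem_zpowers_iff.1 hz
    have hi : ¬ (p : ℤ) ∣ i := by
      rintro ⟨j, rfl⟩
      apply hN.1
      rw [zpow_mul, zpow_natCast, hG, one_zpow, mul_one]
      exact hn
    obtain ⟨a, b, hab⟩ := ((Nat.prime_iff_prime_int.1 hp).coprime_iff_not_dvd.2 hi)
    refine ⟨b, ?_⟩
    have h2 : g = g ^ (b * i) := by
      conv_lhs => rw [← zpow_one g, ← hab, zpow_add, mul_comm a, zpow_mul, zpow_natCast, hG,
        one_zpow, one_mul]
    have h3 : (n * g ^ i) ^ b = n ^ b * g ^ (i * b) := by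
      rw [(show Commute n (g ^ i) from hcomm _ _).mul_zpow, zpow_mul]
    rw [h3, mul_inv_rev, mul_assoc, hcomm (n ^ b)⁻¹ g, ← mul_assoc]
    nth_rw 2 [h2]
    rw [mul_comm i b, inv_mul_cancel, one_mul]
    exact inv_mem (zpow_mem hn b)
  have hord : orderOf (QuotientGroup.mk σ : G ⧸ N) = p := by
    have : Fact p.Prime := ⟨hp⟩
    refine orderOf_eq_prime ?_ ?_
    · rw [← QuotientGroup.mk_pow, hG, QuotientGroup.mk_one]
    · rw [Ne, QuotientGroup.eq_one_iff]; exact hN.1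
  rw [← hord, Subgroup.index]
  refine (orderOf_eq_card_of_forall_mem_zpowers fun x => ?_).symm
  obtain ⟨g, rfl⟩ := QuotientGroup.mk_surjective x
  obtain ⟨k, hk⟩ := hgen g
  exact ⟨k, QuotientGroup.eq.2 hk⟩

section ExponentPrime

variable (p : ℕ) [Fact p.Prime] (L : Type*) [Field L] [Algebra ℚ_[p] L] [Algebra ℤ_[p] L]
  [IsScalarTower ℤ_[p] ℚ_[p] L] [FiniteDimensional ℚ_[p] L]

/-- The last break in the upper numbering of the abelian extensions of `ℚ_[p]` of exponent `p`. -/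
def lastExponentPrimeBreak : ℕ := if p = 2 then 2 else 1

theorem le_lastExponentPrimeBreak {n : ℕ} (h : (p - 1) * n ≤ p) :
    n ≤ lastExponentPrimeBreak p := by
  have hp := (Fact.out : p.Prime).two_le
  unfold lastExponentPrimeBreak
  split_ifs with h2
  · subst h2; omega
  · by_contra! hn
    have : (p - 1) * 2 ≤ (p - 1) * n := Nat.mul_le_mul_left _ hn
    omega

/-- A group of order p leaves room for one jump, and φ is the identity up to it, so upper and lower
jumps agree and are integers. If the extension is ramified, e = p and the jump j satisfies (p - 1)j
≤ p. -/
theorem padicUpperRamificationGroup_of_card_eq_prime [IsAbelianGalois ℚ_[p] L]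
    (hG : Nat.card Gal(L/ℚ_[p]) = p) {v : ℝ} (hv : -1 ≤ v) :
    padicUpperRamificationGroup p L v = padicUpperRamificationGroup p L ⌈v⌉ ∧
      (lastExponentPrimeBreak p < v → padicUpperRamificationGroup p L v = ⊥) := by
  classical
  have hp : p.Prime := Fact.out
  have hpG : Fact (Nat.Prime (Nat.card Gal(L/ℚ_[p]))) := ⟨by rwa [hG]⟩
  have hvc : (-1 : ℝ) ≤ ⌈v⌉ := hv.trans (Int.le_ceil v)
  set R := padicRamificationGroup p L with hR
  rcases (R 1).eq_bot_or_eq_top_of_prime_card with h1 | h1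
  · have hid : ∀ w : ℝ, -1 ≤ w → padicUpperRamificationGroup p L w =
        lowerRamificationGroup (integralClosure ℤ_[p] L) Gal(L/ℚ_[p]) w := by
      intro w hw
      conv_lhs => rw [← herbrandPhi_eq_self (B := integralClosure ℤ_[p] L) (G := Gal(L/ℚ_[p]))
        (u := max w 0) (by
          rw [lowerRamificationGroup_zero_eq, ← hR, h1, eq_bot_iff, ← h1, hR,
            ← lowerRamificationGroup_zero_eq]
          exact lowerRamificationGroup_antitone (le_max_right _ _)) hw (le_max_left _ _)]
      exact upperRamificationGroup_herbrandPhi hw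
    refine ⟨?_, fun hlt => ?_⟩
    · rw [hid v hv, hid _ hvc, lowerRamificationGroup_eq, lowerRamificationGroup_eq, Int.ceil_intCast]
    · rw [hid v hv, eq_bot_iff, ← h1, hR, ← lowerRamificationGroup_zero_eq]
      exact lowerRamificationGroup_antitone ((Nat.cast_nonneg _).trans hlt.le)
  -- The tame quotient has order at most p - 1 and is a p-group, hence is trivial.
  · have hR2 : R 2 = R 1 := Subgroup.eq_of_relIndex_lt hp (k := 1) (by rw [hG, pow_one])
      (congruenceSubgroup_antitone one_le_two)
      ((relIndex_padicRamificationGroup_le p L 0).trans_lt (by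
        rw [if_pos rfl]; exact Nat.sub_lt hp.pos one_pos))
    obtain ⟨m, hm⟩ := exists_padicRamificationGroup_eq_bot p L
    have htb : (⊤ : Subgroup Gal(L/ℚ_[p])) ≠ ⊥ := by
      intro h
      have := Subgroup.card_top (G := Gal(L/ℚ_[p]))
      rw [h, Subgroup.card_bot, hG] at this
      exact hp.one_lt.ne this
    have hex : ∃ m, R m ≠ ⊤ := ⟨m, by rw [hR, hm]; exact htb.symm⟩
    -- With `R i` equal to G_(i-1), the first proper `R (n + 3)` means that the lower jump is n + 1.
    obtain ⟨n, hn⟩ : ∃ n, Nat.find hex = n + 3 := by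
      refine ⟨Nat.find hex - 3, ?_⟩
      have : 2 < Nat.find hex := by
        rw [Nat.lt_find_iff]
        intro k hk
        rw [not_not, eq_top_iff, ← h1, ← hR2]
        exact congruenceSubgroup_antitone hk
      omega
    have htop : R (n + 2) = ⊤ := not_not.1 (Nat.find_min hex (by omega))
    have hbot : R (n + 3) = ⊥ := by
      have := Nat.find_spec hex
      rw [hn] at this
      exact (R (n + 3)).eq_bot_or_eq_top_of_prime_card.resolve_right this
    have hle : n + 1 ≤ lastExponentPrimeBreak p := by
      refine le_lastExponentPrimeBreak p ?_
      obtain ⟨σ, hσ⟩ : ∃ σ : Gal(L/ℚ_[p]), σ ≠ 1 := by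
        by_contra! h
        exact htb (by ext x; simp [h x])
      have he := maximalIdeal_pow_card_inertia p L
      rw [lowerRamificationGroup_zero_eq, ← hR, h1, Subgroup.card_top, hG] at he
      refine mul_sub_one_le_of_pow_prime_eq_one hp he (σ := σ) ?_ (by omega) (show σ ∈ R (n + 2) by
        rw [htop]; trivial) (show σ ∉ R (n + 3) by rwa [hbot, Subgroup.mem_bot])
      exact (congrArg (σ ^ ·) hG.symm).trans pow_card_eq_one'
    have hlow : lowerRamificationGroup (integralClosure ℤ_[p] L) Gal(L/ℚ_[p]) ((n + 1 : ℕ) : ℝ) =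
        R (n + 2) := by
      rw [lowerRamificationGroup_eq, hR, Int.ceil_natCast]
      congr 1
    have hphi : ∀ w : ℝ, -1 ≤ w → w ≤ ((n + 1 : ℕ) : ℝ) →
        herbrandPhi (integralClosure ℤ_[p] L) Gal(L/ℚ_[p]) w = w := by
      intro w hw hw'
      refine herbrandPhi_eq_self ?_ hw hw'
      rw [hlow, lowerRamificationGroup_zero_eq, ← hR, h1, htop]
    have hsmall : ∀ w : ℝ, -1 ≤ w → w ≤ ((n + 1 : ℕ) : ℝ) →
        padicUpperRamificationGroup p L w = ⊤ := by
      intro w hw hw'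
      have h2 := upperRamificationGroup_herbrandPhi (B := integralClosure ℤ_[p] L)
        (G := Gal(L/ℚ_[p])) hw
      rw [hphi w hw hw'] at h2
      rw [padicUpperRamificationGroup, h2, eq_top_iff, ← htop, ← hlow]
      exact lowerRamificationGroup_antitone hw'
    have hbig : ∀ w : ℝ, ((n + 1 : ℕ) : ℝ) < w → padicUpperRamificationGroup p L w = ⊥ := by
      intro w hw
      have hw1 : -1 ≤ w := by
        have := Nat.cast_nonneg (α := ℝ) (n + 1)
        linarith
      have h2 : ((n + 1 : ℕ) : ℝ) < herbrandPsi (integralClosure ℤ_[p] L) Gal(L/ℚ_[p]) w := by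
        have hn0 := Nat.cast_nonneg (α := ℝ) (n + 1)
        by_contra! h3
        rw [herbrandPsi_le_iff (by linarith) hw1, hphi _ (by linarith) le_rfl] at h3
        linarith
      rw [padicUpperRamificationGroup, upperRamificationGroup, eq_bot_iff, ← hbot, hR,
        lowerRamificationGroup_eq]
      refine congruenceSubgroup_antitone ?_
      have h3 : ((n + 1 : ℕ) : ℤ) < ⌈herbrandPsi (integralClosure ℤ_[p] L) Gal(L/ℚ_[p]) w⌉ :=
        Int.lt_ceil.2 (by exact_mod_cast h2)
      omega
    refine ⟨?_, fun hlt => hbig v (lt_of_le_of_lt (Nat.cast_le.2 hle) hlt)⟩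
    rcases le_or_gt v ((n + 1 : ℕ) : ℝ) with h | h
    · have : (⌈v⌉ : ℝ) ≤ ((n + 1 : ℕ) : ℝ) := by
        have : ⌈v⌉ ≤ ((n + 1 : ℕ) : ℤ) := Int.ceil_le.2 (by exact_mod_cast h)
        exact_mod_cast this
      rw [hsmall v hv h, hsmall _ hvc this]
    · rw [hbig v h, hbig _ (h.trans_le (Int.le_ceil v))]

end ExponentPrime

section ExponentPrime

variable (p : ℕ) [Fact p.Prime] (L : Type*) [Field L] [Algebra ℚ_[p] L] [Algebra ℤ_[p] L]
  [IsScalarTower ℤ_[p] ℚ_[p] L] [FiniteDimensional ℚ_[p] L]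

theorem ker_restrictNormalHom_fixedField {K L : Type*} [Field K] [Field L] [Algebra K L]
    [FiniteDimensional K L] [IsAbelianGalois K L] (N : Subgroup Gal(L/K)) :
    (AlgEquiv.restrictNormalHom (F := K) (K₁ := L) (IntermediateField.fixedField N)).ker = N := by
  rw [IntermediateField.restrictNormalHom_ker, IntermediateField.fixingSubgroup_fixedField]

theorem card_gal_fixedField {K L : Type*} [Field K] [Field L] [Algebra K L]
    [FiniteDimensional K L] [IsAbelianGalois K L] (N : Subgroup Gal(L/K)) :
    Nat.card Gal(IntermediateField.fixedField N/K) = N.index := by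
  rw [← ker_restrictNormalHom_fixedField N, Subgroup.index_ker,
    MonoidHom.range_eq_top.2 (AlgEquiv.restrictNormalHom_surjective L), Subgroup.card_top,
    ker_restrictNormalHom_fixedField N]

/-- By Herbrand's theorem, containment in N is triviality of the upper group of the fixed field of
N, which has degree p. -/
theorem padicUpperRamificationGroup_le_of_index_eq_prime [IsAbelianGalois ℚ_[p] L]
    {N : Subgroup Gal(L/ℚ_[p])} (hN : N.index = p) {v : ℝ} (hv : -1 ≤ v) :
    (padicUpperRamificationGroup p L ⌈v⌉ ≤ N → padicUpperRamificationGroup p L v ≤ N) ∧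
      (lastExponentPrimeBreak p < v → padicUpperRamificationGroup p L v ≤ N) := by
  have h := padicUpperRamificationGroup_of_card_eq_prime p (IntermediateField.fixedField N)
    ((card_gal_fixedField N).trans hN) hv
  have hmap : ∀ w : ℝ, -1 ≤ w → (padicUpperRamificationGroup p L w ≤ N ↔
      padicUpperRamificationGroup p (IntermediateField.fixedField N) w = ⊥) := by
    intro w hw
    rw [padicUpperRamificationGroup, padicUpperRamificationGroup,
      ← map_restrictNormalHom_upperRamificationGroup p (IntermediateField.fixedField N) L hw,
      Subgroup.map_eq_bot_iff, ker_restrictNormalHom_fixedField]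
  rw [hmap v hv, hmap _ (hv.trans (Int.le_ceil v)), ← h.1]
  exact ⟨id, h.2⟩

variable {L}

/-- Integrality of the upper jumps (Hasse–Arf in exponent p): an element outside G^⌈v⌉ is separated
from it by a subgroup of index p, and there the degree p case applies. -/
theorem padicUpperRamificationGroup_eq_ceil [IsAbelianGalois ℚ_[p] L]
    (hexp : ∀ σ : Gal(L/ℚ_[p]), σ ^ p = 1) {v : ℝ} (hv : -1 ≤ v) :
    padicUpperRamificationGroup p L v = padicUpperRamificationGroup p L ⌈v⌉ := by
  refine le_antisymm (fun σ hσ => ?_) (upperRamificationGroup_antitoneOn hv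
    (hv.trans (Int.le_ceil v)) (Int.le_ceil v))
  by_contra h
  obtain ⟨N, hSN, hσN, hN⟩ := Subgroup.exists_index_prime_of_notMem mul_comm'
    (Fact.out : p.Prime) hexp h
  exact hσN ((padicUpperRamificationGroup_le_of_index_eq_prime p L hN hv).1 hSN hσ)

theorem padicUpperRamificationGroup_eq_bot [IsAbelianGalois ℚ_[p] L]
    (hexp : ∀ σ : Gal(L/ℚ_[p]), σ ^ p = 1) {v : ℝ} (hv : lastExponentPrimeBreak p < v) :
    padicUpperRamificationGroup p L v = ⊥ := by
  refine (Subgroup.eq_bot_iff_forall _).2 fun σ hσ => ?_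
  by_contra h
  obtain ⟨N, -, hσN, hN⟩ := Subgroup.exists_index_prime_of_notMem mul_comm'
    (Fact.out : p.Prime) hexp (S := ⊥) h
  have := Nat.cast_nonneg (α := ℝ) (lastExponentPrimeBreak p)
  exact hσN ((padicUpperRamificationGroup_le_of_index_eq_prime p L hN (by linarith)).2 hv hσ)

theorem card_dvd_pow_of_forall_pow_eq_one {G : Type*} [Group G] [Finite G] {p : ℕ} [Fact p.Prime]
    (h : ∀ g : G, g ^ p = 1) : ∃ k, Nat.card G ∣ p ^ k := by
  obtain ⟨k, hk⟩ := IsPGroup.iff_card.1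
    (fun g => ⟨1, by rw [pow_one, h]⟩ : IsPGroup p G)
  exact ⟨k, hk.dvd⟩

/-- Inertia equals G^1, the group is trivial after `lastExponentPrimeBreak`, and by integrality each
step from G^k to G^(k+1) is covered by a single lower step, of index at most p. -/
theorem card_inertia_le_of_exponent_prime [IsAbelianGalois ℚ_[p] L]
    (hexp : ∀ σ : Gal(L/ℚ_[p]), σ ^ p = 1) :
    Nat.card (padicRamificationGroup p L 1) ≤ p ^ lastExponentPrimeBreak p := by
  have hp : p.Prime := Fact.out
  obtain ⟨k, hk⟩ := card_dvd_pow_of_forall_pow_eq_one hexp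
  have hR2 : padicRamificationGroup p L 2 = padicRamificationGroup p L 1 :=
    Subgroup.eq_of_relIndex_lt hp hk (congruenceSubgroup_antitone one_le_two)
      ((relIndex_padicRamificationGroup_le p L 0).trans_lt (by
        rw [if_pos rfl]; exact Nat.sub_lt hp.pos one_pos))
  have hlow1 : lowerRamificationGroup (integralClosure ℤ_[p] L) Gal(L/ℚ_[p]) 1 =
      padicRamificationGroup p L 2 := by
    rw [lowerRamificationGroup_eq, Int.ceil_one]; rfl
  have hphi1 : herbrandPhi (integralClosure ℤ_[p] L) Gal(L/ℚ_[p]) 1 = 1 :=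
    herbrandPhi_eq_self (u := 1) (by rw [hlow1, lowerRamificationGroup_zero_eq, hR2])
      (by norm_num) le_rfl
  have hup1 : padicUpperRamificationGroup p L ((1 : ℕ) : ℝ) = padicRamificationGroup p L 1 := by
    have := upperRamificationGroup_herbrandPhi (B := integralClosure ℤ_[p] L)
      (G := Gal(L/ℚ_[p])) (u := 1) (by norm_num)
    rw [hphi1, hlow1, hR2] at this
    rw [Nat.cast_one]; exact this
  have hstep : ∀ k : ℕ, 1 ≤ k → (padicUpperRamificationGroup p L ((k + 1 : ℕ) : ℝ)).relIndex
      (padicUpperRamificationGroup p L (k : ℝ)) ≤ p := by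
    intro k hk
    have hk1 : (1 : ℝ) ≤ k := by exact_mod_cast hk
    set ψ := herbrandPsi (integralClosure ℤ_[p] L) Gal(L/ℚ_[p]) with hψ
    have hw1 : 1 ≤ ψ k := by
      rw [← herbrandPhi_le_iff (by norm_num) (by linarith), hphi1]
      exact hk1
    set w := ψ k with hw
    have hw0 : -1 ≤ w := by linarith
    have hfloor : 1 ≤ ⌊w⌋ := Int.le_floor.2 (by exact_mod_cast hw1)
    obtain ⟨i, hi⟩ := Int.eq_ofNat_of_zero_le (show 0 ≤ ⌊w⌋ by omega)
    have hww : w < ψ ((k + 1 : ℕ) : ℝ) := by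
      push_cast
      by_contra! h
      rw [herbrandPsi_le_iff hw0 (by linarith), hw, herbrandPhi_herbrandPsi (by linarith)] at h
      linarith
    -- This u lies after ψ(k) but not beyond the next integer or ψ(k + 1). Then φ(u) is in (k, k +
    -- 1], so G_u = G^(k+1) by integrality, while G_u contains G_(i+1) and G^k is contained in G_i,
    -- where i = ⌊ψ(k)⌋ ≥ 1.
    set u := min ((⌊w⌋ : ℝ) + 1) (ψ ((k + 1 : ℕ) : ℝ)) with hu
    have hwu : w < u := lt_min (Int.lt_floor_add_one w) hww
    have hu1 : -1 ≤ u := by linarith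
    have hphiu : padicUpperRamificationGroup p L ((k + 1 : ℕ) : ℝ) =
        lowerRamificationGroup (integralClosure ℤ_[p] L) Gal(L/ℚ_[p]) u := by
      rw [← upperRamificationGroup_herbrandPhi hu1]
      have h1 : herbrandPhi (integralClosure ℤ_[p] L) Gal(L/ℚ_[p]) u ≤ (k + 1 : ℕ) := by
        rw [herbrandPhi_le_iff hu1 (by push_cast; linarith)]
        exact min_le_right _ _
      have h2 : (k : ℝ) < herbrandPhi (integralClosure ℤ_[p] L) Gal(L/ℚ_[p]) u := by
        rw [← herbrandPhi_herbrandPsi (B := integralClosure ℤ_[p] L) (G := Gal(L/ℚ_[p]))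
          (v := (k : ℝ)) (by linarith)]
        exact strictMonoOn_herbrandPhi _ _ hw0 hu1 hwu
      have h3 : ⌈herbrandPhi (integralClosure ℤ_[p] L) Gal(L/ℚ_[p]) u⌉ = ((k + 1 : ℕ) : ℤ) := by
        rw [Int.ceil_eq_iff]
        push_cast at h1 ⊢
        constructor <;> linarith
      have h4 := padicUpperRamificationGroup_eq_ceil p hexp (neg_one_le_herbrandPhi
        (integralClosure ℤ_[p] L) Gal(L/ℚ_[p]) hu1)
      rw [h3] at h4
      exact h4.symm
    have hle1 : padicRamificationGroup p L (i + 2) ≤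
        padicUpperRamificationGroup p L ((k + 1 : ℕ) : ℝ) := by
      rw [hphiu, lowerRamificationGroup_eq]
      refine congruenceSubgroup_antitone ?_
      have : ⌈u⌉ ≤ ⌊w⌋ + 1 := Int.ceil_le.2 (by push_cast; exact min_le_left _ _)
      omega
    have hle2 : padicUpperRamificationGroup p L (k : ℝ) ≤ padicRamificationGroup p L (i + 1) := by
      rw [padicUpperRamificationGroup, upperRamificationGroup, lowerRamificationGroup_eq]
      refine congruenceSubgroup_antitone ?_
      have : ⌊w⌋ ≤ ⌈w⌉ := Int.floor_le_ceil w
      rw [← hψ, ← hw]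
      omega
    have h1 := Subgroup.relIndex_le_of_le_left hle1 
      (Subgroup.index_ne_zero_of_finite (H := (padicRamificationGroup p L (i + 2)).subgroupOf
        (padicUpperRamificationGroup p L (k : ℝ))))
    have h2 := Subgroup.relIndex_le_of_le_right hle2 
      (Subgroup.index_ne_zero_of_finite (H := (padicRamificationGroup p L (i + 2)).subgroupOf
        (padicRamificationGroup p L (i + 1))))
    refine h1.trans (h2.trans ((relIndex_padicRamificationGroup_le p L i).trans ?_))
    rw [if_neg (by omega)]
  have hind : ∀ k : ℕ, (padicUpperRamificationGroup p L ((k + 1 : ℕ) : ℝ)).relIndex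
      (padicUpperRamificationGroup p L ((1 : ℕ) : ℝ)) ≤ p ^ k := by
    intro k
    induction k with
    | zero => simp
    | succ k ih =>
      have hmem : ∀ k : ℕ, ((k + 1 : ℕ) : ℝ) ∈ Set.Ici (-1 : ℝ) := fun k => by
        have := Nat.cast_nonneg (α := ℝ) (k + 1)
        rw [Set.mem_Ici]; linarith
      rw [← Subgroup.relIndex_mul_relIndex _ (padicUpperRamificationGroup p L ((k + 1 : ℕ) : ℝ)) _
        (upperRamificationGroup_antitoneOn (hmem _) (hmem _) (by push_cast; linarith))
        (upperRamificationGroup_antitoneOn (hmem 0) (hmem _) (by push_cast; simp)),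
        pow_succ, mul_comm]
      exact Nat.mul_le_mul ih (hstep (k + 1) (by omega))
  have := hind (lastExponentPrimeBreak p)
  rwa [padicUpperRamificationGroup_eq_bot p hexp (by push_cast; linarith),
    Subgroup.relIndex_bot_left, hup1] at this

theorem card_le_of_exponent_prime [IsAbelianGalois ℚ_[p] L]
    (hexp : ∀ σ : Gal(L/ℚ_[p]), σ ^ p = 1) :
    Nat.card Gal(L/ℚ_[p]) ≤ p ^ (lastExponentPrimeBreak p + 1) := by
  rw [← Subgroup.card_mul_index (padicRamificationGroup p L 1), pow_succ]
  exact Nat.mul_le_mul (card_inertia_le_of_exponent_prime p hexp)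
    (index_inertia_le p L (Fact.out : p.Prime).pos hexp)

end ExponentPrime

/-! ### Counting a finite abelian group through iterated p-th powers -/

section PowerMaps

variable {G : Type*} [CommGroup G]

theorem Subgroup.card_eq_card_map_mul_card_inf_ker (f : G →* G) (H : Subgroup G) :
    Nat.card H = Nat.card (H.map f) * Nat.card (H ⊓ f.ker : Subgroup G) := by
  have h := Subgroup.relIndex_mul_relIndex ⊥ (H ⊓ f.ker) H bot_le inf_le_left
  rw [Subgroup.relIndex_bot_left, Subgroup.relIndex_bot_left, Subgroup.inf_relIndex_left,
    Subgroup.relIndex_ker] at h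
  rw [← h, mul_comm]

theorem map_powMonoidHom_range (m n : ℕ) :
    (powMonoidHom m : G →* G).range.map (powMonoidHom n) = (powMonoidHom (m * n)).range := by
  rw [MonoidHom.map_range]
  congr 1
  ext g
  simp [pow_mul]

/-- The first p-th power map divides the order by at most a. Each later one starts from a group of
p-th powers, so its kernel lies in the intersection bounded by b. -/
theorem card_le_mul_card_range_powMonoidHom [Finite G] {p a b : ℕ}
    (ha : Nat.card (powMonoidHom p : G →* G).ker ≤ a)
    (hb : Nat.card ((powMonoidHom p : G →* G).range ⊓ (powMonoidHom p).ker : Subgroup G) ≤ b)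
    (r : ℕ) : Nat.card G ≤ Nat.card (powMonoidHom (p ^ (r + 1)) : G →* G).range * (a * b ^ r) := by
  induction r with
  | zero =>
    have := Subgroup.card_eq_card_map_mul_card_inf_ker (powMonoidHom p) (⊤ : Subgroup G)
    rw [top_inf_eq, Subgroup.card_top, ← MonoidHom.range_eq_map] at this
    rw [this]
    rw [zero_add, pow_one, pow_zero, mul_one]
    exact Nat.mul_le_mul_left _ ha
  | succ r ih =>
    refine ih.trans ?_
    rw [Subgroup.card_eq_card_map_mul_card_inf_ker (powMonoidHom p), map_powMonoidHom_range,
      ← pow_succ, mul_assoc]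
    refine Nat.mul_le_mul_left _ ?_
    rw [pow_succ b, ← mul_assoc a, mul_comm]
    refine Nat.mul_le_mul_left _ (le_trans (Subgroup.card_le_of_le ?_) hb)
    refine inf_le_inf_right _ ?_
    rintro _ ⟨g, rfl⟩
    exact ⟨g ^ p ^ r, by simp [← pow_mul, pow_succ]⟩

theorem card_ker_powMonoidHom [Finite G] (n : ℕ) :
    Nat.card (powMonoidHom n : G →* G).ker = (powMonoidHom n : G →* G).range.index := by
  have h1 := Subgroup.card_mul_index (powMonoidHom n : G →* G).range
  have h2 := Subgroup.card_mul_index (powMonoidHom n : G →* G).ker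
  rw [Subgroup.index_ker, mul_comm, ← h1] at h2
  exact Nat.eq_of_mul_eq_mul_left Nat.card_pos h2

end PowerMaps

/-! ### Sums of two squares and cyclic quartic extensions containing i -/

section SumOfSquares

theorem PadicInt.one_add_sq_add_sq_ne_zero (x y : ℤ_[2]) : 1 + x ^ 2 + y ^ 2 ≠ 0 := by
  intro h
  have h4 := congrArg (PadicInt.toZModPow (p := 2) 2) h
  simp only [map_add, map_one, map_pow, map_zero] at h4
  have key : ∀ a b : ZMod (2 ^ 2), 1 + a ^ 2 + b ^ 2 ≠ 0 := by decide
  exact key _ _ h4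

/-- A solution can be divided by its larger coordinate when that is not integral, giving in all
cases a 2-adic integral solution of 1 + x^2 + y^2 = 0, impossible modulo 4. -/
theorem Padic.sq_add_sq_ne_neg_one (a b : ℚ_[2]) : a ^ 2 + b ^ 2 ≠ -1 := by
  have hint : ∀ x y : ℚ_[2], ‖x‖ ≤ 1 → ‖y‖ ≤ 1 → 1 + x ^ 2 + y ^ 2 ≠ 0 := fun x y hx hy h =>
    PadicInt.one_add_sq_add_sq_ne_zero ⟨x, hx⟩ ⟨y, hy⟩ (Subtype.ext (by push_cast; exact h))
  have hlarge : ∀ x y : ℚ_[2], ‖y‖ ≤ ‖x‖ → 1 < ‖x‖ → x ^ 2 + y ^ 2 ≠ -1 := by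
    intro x y hyx hx h
    have hx0 : x ≠ 0 := norm_pos_iff.1 (one_pos.trans hx)
    refine hint (y / x) (1 / x) ?_ ?_ ?_
    · rw [norm_div]
      exact div_le_one_of_le₀ hyx (norm_nonneg _)
    · rw [norm_div, norm_one]
      exact div_le_one_of_le₀ hx.le (norm_nonneg _)
    · field_simp
      linear_combination h
  intro h
  rcases le_or_gt ‖a‖ 1 with ha | ha
  · rcases le_or_gt ‖b‖ 1 with hb | hb
    · exact hint a b ha hb (by linear_combination h)
    · exact hlarge b a (ha.trans hb.le) hb (by linear_combination h)
  · rcases le_total ‖b‖ ‖a‖ with hab | hab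
    · exact hlarge a b hab ha h
    · exact hlarge b a hab (ha.trans_le hab) (by linear_combination h)

/-- Here N has index 2, and the point is to find H with G/H cyclic of order 4, generated by the
class of g₀. A subgroup H of N maximal among those containing no square of an element outside N
works. -/
theorem Subgroup.exists_le_eq_sq_cosets {G : Type*} [CommGroup G] [Finite G] {N : Subgroup G}
    {g₀ : G} (hg₀ : g₀ ∉ N) (hN : ∀ x y, x ∉ N → y ∉ N → x * y ∈ N)
    (hsq : ∀ g, g ^ 2 = 1 → g ∈ N) :
    ∃ H ≤ N, (∀ x ∈ N, x ^ 2 ∈ H) ∧ g₀ ^ 2 ∉ H ∧ ∀ x ∈ N, x ∈ H ∨ x * (g₀ ^ 2)⁻¹ ∈ H := by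
  obtain ⟨H, -, hH⟩ := (Set.toFinite {H : Subgroup G | H ≤ N ∧ ∀ g ∉ N, g ^ 2 ∉ H}).exists_le_maximal
    (a := ⊥) ⟨bot_le, fun g hg h => hg (hsq g (Subgroup.mem_bot.1 h))⟩
  obtain ⟨hHN, hHg⟩ := hH.prop
  have hmax : ∀ n ∈ N, n ∉ H → ∃ g ∉ N, ∃ k : ℤ, g ^ 2 * n ^ k ∈ H := by
    intro n hn hnH
    by_contra! hcon
    refine hnH (hH.le_of_ge (y := H ⊔ Subgroup.zpowers n)
      ⟨sup_le hHN ((Subgroup.zpowers_le).2 hn), fun g hg h => ?_⟩ le_sup_left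
      (le_sup_right (a := H) (Subgroup.mem_zpowers n)))
    obtain ⟨y, hy, z, hz, hyz⟩ := Subgroup.mem_sup.1 h
    obtain ⟨k, rfl⟩ := Subgroup.mem_zpowers_iff.1 hz
    refine hcon g hg (-k) ?_
    rw [← hyz, zpow_neg, mul_inv_cancel_right]
    exact hy
  have hmul : ∀ {g n}, g ∉ N → n ∈ N → g * n ∉ N := fun hg hn h =>
    hg ((Subgroup.mul_mem_cancel_right N hn).1 h)
  have hNsq : ∀ x ∈ N, x ^ 2 ∈ H := by
    intro n hn
    by_contra h
    obtain ⟨g, hg, k, hk⟩ := hmax _ (N.pow_mem hn 2) h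
    refine hHg _ (hmul hg (N.zpow_mem hn k)) ?_
    convert hk using 1
    rw [mul_pow, ← zpow_natCast (n ^ k), ← zpow_natCast n, ← zpow_mul, ← zpow_mul, mul_comm k]
  have hcoset : ∀ n ∈ N, n ∉ H → ∃ g ∉ N, g ^ 2 * n ∈ H := by
    intro n hn hnH
    obtain ⟨g, hg, k, hk⟩ := hmax n hn hnH
    refine ⟨g, hg, ?_⟩
    have hev : ∀ j : ℤ, n ^ (2 * j) ∈ H := fun j => by
      rw [zpow_mul]
      exact H.zpow_mem (by exact_mod_cast hNsq n hn) j
    rcases Int.even_or_odd' k with ⟨j, rfl | rfl⟩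
    · exact absurd ((Subgroup.mul_mem_cancel_right H (hev j)).1 hk) (hHg g hg)
    · rw [add_comm, zpow_add, zpow_one, ← mul_assoc] at hk
      exact (Subgroup.mul_mem_cancel_right H (hev j)).1 hk
  refine ⟨H, hHN, hNsq, hHg _ hg₀, fun x hx => or_iff_not_imp_left.2 fun hxH => ?_⟩
  by_contra h
  have hx' : x * (g₀ ^ 2)⁻¹ ∈ N := N.mul_mem hx (N.inv_mem (by rw [sq]; exact hN _ _ hg₀ hg₀))
  obtain ⟨g₁, hg₁, h₁⟩ := hcoset x hx hxH
  obtain ⟨g₂, hg₂, h₂⟩ := hcoset _ hx' h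
  -- If neither x nor x·g₀^(-2) were in H, then H would contain g₁^2·x and g₂^2·x·g₀^(-2), hence the
  -- square of g₁g₂^(-1)g₀, a product of three elements outside N and so itself outside N.
  refine hHg (g₁ * (g₂⁻¹ * g₀)) (hmul hg₁ (hN _ _ (by simpa) hg₀)) ?_
  convert H.mul_mem h₁ (H.inv_mem h₂) using 1
  simp only [mul_pow, inv_pow, mul_inv, inv_inv]
  rw [mul_assoc (g₁ ^ 2), mul_left_comm x, mul_inv_cancel_left]

-- When i is not in K, the hypothesis on involutions yields a cyclic quartic extension of K
-- containing i. From it one builds c in K(i) of norm -1 to K; writing c = a + bi gives a^2 + b^2 =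
-- -1.
open scoped IsMulCommutative in
theorem exists_sq_add_sq_eq_neg_one {K L : Type*} [Field K] [Field L] [Algebra K L] [CharZero K]
    [FiniteDimensional K L] [IsAbelianGalois K L] {ι : L} (hι : ι ^ 2 = -1)
    (hsq : ∀ σ : Gal(L/K), σ ^ 2 = 1 → ∃ τ, τ ^ 2 = σ) : ∃ a b : K, a ^ 2 + b ^ 2 = -1 := by
  have : CharZero L := charZero_of_injective_algebraMap (algebraMap K L).injective
  have hbot : ∀ x : L, (∀ σ : Gal(L/K), σ x = x) → ∃ a, algebraMap K L a = x := fun x hx =>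
    IntermediateField.mem_bot.1 ((IsGalois.mem_bot_iff_fixed x).2 hx)
  have hmapι : ∀ σ : Gal(L/K), σ ι = ι ∨ σ ι = -ι := fun σ => by
    rw [← sq_eq_sq_iff_eq_or_eq_neg, ← map_pow, hι, map_neg, map_one]
  by_cases hfix : ∀ σ : Gal(L/K), σ ι = ι
  · obtain ⟨a, ha⟩ := hbot ι hfix
    refine ⟨a, 0, (algebraMap K L).injective ?_⟩
    rw [zero_pow two_ne_zero, add_zero, map_pow, ha, hι, map_neg, map_one]
  push Not at hfix
  obtain ⟨g, hg⟩ := hfix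
  set N : Subgroup Gal(L/K) := MulAction.stabilizer Gal(L/K) ι with hNdef
  have hmemN : ∀ σ : Gal(L/K), σ ∈ N ↔ σ ι = ι := fun σ => MulAction.mem_stabilizer_iff
  have hNmul : ∀ x y, x ∉ N → y ∉ N → x * y ∈ N := by
    intro x y hx hy
    rw [hmemN] at hx hy ⊢
    rw [AlgEquiv.mul_apply, (hmapι y).resolve_left hy, map_neg, (hmapι x).resolve_left hx, neg_neg]
  obtain ⟨H, hHN, hNsq, hgH, hcos⟩ := Subgroup.exists_le_eq_sq_cosets (N := N) (g₀ := g)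
    (by rwa [hmemN]) hNmul (fun σ hσ => by
      obtain ⟨τ, rfl⟩ := hsq σ hσ
      by_cases hτ : τ ∈ N
      · exact N.pow_mem hτ 2
      · rw [sq]; exact hNmul _ _ hτ hτ)
  -- By Galois theory g^2, not being in H, moves some element of the quartic field. Then w = z -
  -- g^2z is a nonzero element with g^2w = -w.
  obtain ⟨z, hzH, hz⟩ : ∃ z : L, (∀ h ∈ H, h z = z) ∧ (g ^ 2) z ≠ z := by
    by_contra! hcon
    refine hgH ?_
    rw [← IntermediateField.fixingSubgroup_fixedField H, IntermediateField.mem_fixingSubgroup_iff]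
    exact fun x hx => hcon x fun h hh => hx ⟨h, hh⟩
  have hcomm : ∀ (σ τ : Gal(L/K)) (x : L), σ (τ x) = τ (σ x) := fun σ τ x => by
    rw [← AlgEquiv.mul_apply, mul_comm, AlgEquiv.mul_apply]
  have hgN : g ^ 2 ∈ N := by
    rw [sq]; exact hNmul _ _ (by rwa [hmemN]) (by rwa [hmemN])
  set w := z - (g ^ 2) z with hw
  have hw0 : w ≠ 0 := sub_ne_zero.2 (Ne.symm hz)
  have hwH : ∀ h ∈ H, h w = w := fun h hh => by rw [hw, map_sub, hcomm, hzH h hh]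
  have hgw : g (g w) = -w := by
    have h4 : (g ^ 2) ((g ^ 2) z) = z := by
      rw [← AlgEquiv.mul_apply, ← sq]
      exact hzH _ (hNsq _ hgN)
    rw [← AlgEquiv.mul_apply, ← sq, hw, map_sub, h4, neg_sub]
  have hgw0 : g w ≠ 0 := (map_ne_zero g).2 hw0
  have hι0 : ι ≠ 0 := fun h => by simp [h] at hι
  -- Since g(gw) = -w, one has c·g(c) = -1. The elements (c - 1/c)/2 and (c + 1/c)/(2i) are the
  -- coordinates of c in the basis 1, i.
  set c := g w / w with hc
  have hc0 : c ≠ 0 := div_ne_zero hgw0 hw0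
  have hgc : g c = -c⁻¹ := by
    rw [hc, map_div₀, hgw, inv_div, neg_div]
  have hcH : ∀ h ∈ H, h c = c := fun h hh => by rw [hc, map_div₀, hcomm, hwH h hh]
  have hgι : g ι = -ι := (hmapι g).resolve_left hg
  have hfixed : ∀ x : L, (∀ h ∈ H, h x = x) → g x = x → ∀ σ : Gal(L/K), σ x = x := by
    intro x hxH hgx
    have hN : ∀ σ ∈ N, σ x = x := by
      intro σ hσ
      rcases hcos σ hσ with h | h
      · exact hxH σ h
      · have := hxH _ h
        have hgx2 : (g ^ 2) x = x := by rw [sq, AlgEquiv.mul_apply, hgx, hgx]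
        rwa [← inv_mul_cancel_right σ (g ^ 2), AlgEquiv.mul_apply, hgx2]
    intro σ
    by_cases hσ : σ ∈ N
    · exact hN σ hσ
    · have := hN _ (hNmul σ g hσ (by rwa [hmemN]))
      rwa [AlgEquiv.mul_apply, hgx] at this
  obtain ⟨a, ha⟩ := hbot ((c - c⁻¹) / 2) (hfixed _
    (fun h hh => by rw [map_div₀, map_sub, map_inv₀, hcH h hh, map_ofNat])
    (by rw [map_div₀, map_sub, map_inv₀, hgc, map_ofNat, inv_neg, inv_inv]; ring))
  obtain ⟨b, hb⟩ := hbot ((c + c⁻¹) / (2 * ι)) (hfixed _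
    (fun h hh => by
      rw [map_div₀, map_add, map_inv₀, hcH h hh, map_mul, map_ofNat, (hmemN h).1 (hHN hh)])
    (by rw [map_div₀, map_add, map_inv₀, hgc, map_mul, map_ofNat, inv_neg, inv_inv, hgι]
        field_simp; ring))
  refine ⟨a, b, (algebraMap K L).injective ?_⟩
  clear_value c
  rw [map_add, map_pow, map_pow, ha, hb, map_neg, map_one]
  field_simp
  linear_combination (c ^ 2 + 1) ^ 2 * hι

end SumOfSquares

/-! ### Order of an abelian Galois group of given exponent -/

section AbelianBound

variable (p : ℕ) [Fact p.Prime] (L : Type*) [Field L] [Algebra ℚ_[p] L] [Algebra ℤ_[p] L]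
  [IsScalarTower ℤ_[p] ℚ_[p] L] [FiniteDimensional ℚ_[p] L] [IsAbelianGalois ℚ_[p] L]

open scoped IsMulCommutative

theorem range_powMonoidHom_inf_eq_bot {r d : ℕ} (hd : p.Coprime d)
    (h : ∀ σ : Gal(L/ℚ_[p]), σ ^ (p ^ r * d) = 1) :
    padicRamificationGroup p L 2 ⊓ (powMonoidHom (p ^ r) : Gal(L/ℚ_[p]) →* _).range = ⊥ := by
  refine (Subgroup.eq_bot_iff_forall _).2 ?_
  rintro _ ⟨hσ, σ, rfl⟩
  obtain ⟨k, hk⟩ := exists_pow_prime_pow_eq_one p L hσ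
  have hd' : (powMonoidHom (p ^ r) σ) ^ d = 1 := by
    rw [powMonoidHom_apply, ← pow_mul, h]
  have := Nat.dvd_gcd (orderOf_dvd_of_pow_eq_one hk) (orderOf_dvd_of_pow_eq_one hd')
  rw [(hd.pow_left k).gcd_eq_one, Nat.dvd_one, orderOf_eq_one_iff] at this
  exact this

/-- Wild inertia is a p-group and so meets the p^r-th powers trivially. What remains is the tame
part, at most p - 1, and the part generated by Frobenius, at most d. -/
theorem card_range_powMonoidHom_le {r d : ℕ} (hd : p.Coprime d) (hd0 : 0 < d)
    (h : ∀ σ : Gal(L/ℚ_[p]), σ ^ (p ^ r * d) = 1) :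
    Nat.card (powMonoidHom (p ^ r) : Gal(L/ℚ_[p]) →* _).range ≤ d * (p - 1) := by
  set Q := (powMonoidHom (p ^ r) : Gal(L/ℚ_[p]) →* _).range with hQ
  obtain ⟨τ, hτ⟩ := exists_frobenius_integralClosure p L
  have h1 : (padicRamificationGroup p L 1).relIndex Q ≤ d := by
    refine relIndex_le_of_frobenius p (t := τ ^ p ^ r) hd0 (by rw [← pow_mul, h]) ?_
    rintro _ ⟨σ, rfl⟩
    obtain ⟨n, hn⟩ := exists_frobenius_pow_inv_mul_mem p L hτ σ
    refine ⟨n, ?_⟩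
    convert Subgroup.pow_mem _ hn (p ^ r) using 1
    rw [powMonoidHom_apply, mul_pow, inv_pow, ← pow_mul, ← pow_mul, mul_comm n]
  have h2 := Subgroup.relIndex_mul_relIndex (padicRamificationGroup p L 2 ⊓ Q)
    (padicRamificationGroup p L 1 ⊓ Q) Q
    (inf_le_inf_right _ (congruenceSubgroup_antitone one_le_two)) inf_le_right
  rw [Subgroup.inf_relIndex_right, range_powMonoidHom_inf_eq_bot p L hd h,
    Subgroup.relIndex_bot_left, Subgroup.relIndex_bot_left] at h2
  have h3 : Nat.card (padicRamificationGroup p L 1 ⊓ Q : Subgroup _) ≤ p - 1 := by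
    have h4 := Subgroup.relIndex_le_of_le_right
      (inf_le_left : padicRamificationGroup p L 1 ⊓ Q ≤ padicRamificationGroup p L 1)
      (Subgroup.index_ne_zero_of_finite (H := (padicRamificationGroup p L 2).subgroupOf
        (padicRamificationGroup p L 1)))
    have h5 := (relIndex_padicRamificationGroup_le p L 0)
    rw [if_pos rfl] at h5
    refine le_trans (le_of_eq ?_) (h4.trans h5)
    rw [← Subgroup.inf_relIndex_right, ← inf_assoc,
      inf_eq_left.2 (congruenceSubgroup_antitone one_le_two :
        padicRamificationGroup p L 2 ≤ padicRamificationGroup p L 1),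
      range_powMonoidHom_inf_eq_bot p L hd h, Subgroup.relIndex_bot_left]
  rw [← h2, mul_comm]
  exact Nat.mul_le_mul h1 h3

/-- The p-torsion has the order of the quotient by p-th powers, which is the Galois group of an
extension of exponent p. -/
theorem card_ker_powMonoidHom_le :
    Nat.card (powMonoidHom p : Gal(L/ℚ_[p]) →* _).ker ≤ p ^ (lastExponentPrimeBreak p + 1) := by
  rw [card_ker_powMonoidHom, ← card_gal_fixedField]
  refine card_le_of_exponent_prime p fun σ => ?_
  obtain ⟨τ, rfl⟩ := AlgEquiv.restrictNormalHom_surjective (F := ℚ_[p]) (E := L) (K₁ := 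
    IntermediateField.fixedField (powMonoidHom p : Gal(L/ℚ_[p]) →* _).range) σ
  rw [← map_pow, ← MonoidHom.mem_ker, ker_restrictNormalHom_fixedField]
  exact ⟨τ, rfl⟩

theorem card_gal_le_of_odd (hp : p ≠ 2) {r d : ℕ} (hd : p.Coprime d) (hd0 : 0 < d)
    (h : ∀ σ : Gal(L/ℚ_[p]), σ ^ (p ^ (r + 1) * d) = 1) :
    Nat.card Gal(L/ℚ_[p]) ≤ (p ^ (r + 1) * d) * (p ^ r * p * (p - 1)) := by
  have hker := card_ker_powMonoidHom_le p L
  rw [lastExponentPrimeBreak, if_neg hp] at hker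
  refine (card_le_mul_card_range_powMonoidHom hker
    ((Subgroup.card_le_of_le inf_le_right).trans hker) r).trans ?_
  refine (Nat.mul_le_mul_right _ (card_range_powMonoidHom_le p L hd hd0 h)).trans (le_of_eq ?_)
  ring

end AbelianBound

section AbelianBoundTwo

variable (L : Type*) [Field L] [Algebra ℚ_[2] L] [Algebra ℤ_[2] L]
  [IsScalarTower ℤ_[2] ℚ_[2] L] [FiniteDimensional ℚ_[2] L] [IsAbelianGalois ℚ_[2] L]

open scoped IsMulCommutative

/-- If every element killed by 2 were a square, -1 would be a sum of two squares in ℚ_2. So the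
intersection is a proper subgroup of a group of order at most 8. -/
theorem card_range_inf_ker_powMonoidHom_two_le {ι : L} (hι : ι ^ 2 = -1) :
    Nat.card ((powMonoidHom 2 : Gal(L/ℚ_[2]) →* _).range ⊓ (powMonoidHom 2).ker : Subgroup _)
      ≤ 4 := by
  have hker := card_ker_powMonoidHom_le 2 L
  rw [lastExponentPrimeBreak, if_pos rfl] at hker
  set K := (powMonoidHom 2 : Gal(L/ℚ_[2]) →* _).ker with hK
  set R := (powMonoidHom 2 : Gal(L/ℚ_[2]) →* _).range with hR
  have hne : R ⊓ K ≠ K := by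
    intro h
    obtain ⟨a, b, hab⟩ := exists_sq_add_sq_eq_neg_one hι (K := ℚ_[2]) fun σ hσ =>
      (inf_eq_right.1 h) (show σ ∈ K from hσ)
    exact Padic.sq_add_sq_ne_neg_one a b hab
  obtain ⟨k, hk⟩ := Subgroup.card_dvd_of_le (inf_le_right : R ⊓ K ≤ K)
  have hk0 : k ≠ 0 := fun h0 => by
    rw [h0, mul_zero] at hk
    exact Nat.card_pos.ne' hk
  have hk1 : k ≠ 1 := fun h1 => by
    rw [h1, mul_one] at hk
    exact hne (Subgroup.eq_of_le_of_card_ge inf_le_right hk.le)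
  have := Nat.mul_le_mul_left (Nat.card (R ⊓ K : Subgroup _)) (show 2 ≤ k by omega)
  omega

theorem card_gal_le_of_two {ι : L} (hι : ι ^ 2 = -1) {r d : ℕ} (hd : Nat.Coprime 2 d) (hd0 : 0 < d)
    (h : ∀ σ : Gal(L/ℚ_[2]), σ ^ (2 ^ (r + 1) * d) = 1) :
    Nat.card Gal(L/ℚ_[2]) ≤ (2 ^ (r + 1) * d) * 2 ^ (r + 2) := by
  have hker := card_ker_powMonoidHom_le 2 L
  rw [lastExponentPrimeBreak, if_pos rfl] at hker
  refine (card_le_mul_card_range_powMonoidHom hker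
    (card_range_inf_ker_powMonoidHom_two_le L hι) r).trans ?_
  refine (Nat.mul_le_mul_right _ (card_range_powMonoidHom_le 2 L hd hd0 h)).trans (le_of_eq ?_)
  rw [show 4 = 2 ^ 2 by norm_num, ← pow_mul]
  ring

end AbelianBoundTwo

/-! ### Ramification in cyclotomic extensions -/

section RootsOfUnityLocal

variable {B : Type*} [CommRing B] [IsDomain B]

/-- For an N-th root of unity z ≠ 1, the element z - 1 divides N, so it cannot lie in the maximal
ideal when N does not. -/
theorem eq_of_pow_eq_one_of_sub_mem [IsLocalRing B] {N : ℕ} (hN : (N : B) ∉ maximalIdeal B) {x y : B}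
    (hx : x ^ N = 1) (hy : y ^ N = 1) (h : x - y ∈ maximalIdeal B) : x = y := by
  have hN0 : N ≠ 0 := by
    rintro rfl
    exact hN (by simp)
  have hyy : y ^ (N - 1) * y = 1 := by
    rw [← pow_succ, Nat.sub_add_cancel (Nat.one_le_iff_ne_zero.2 hN0), hy]
  have h1 : x * y ^ (N - 1) = 1 := by
    by_contra hne
    refine hN (Ideal.mem_of_dvd _ (sub_one_dvd_natCast_of_pow_eq_one (n := N) ?_ hne) ?_)
    · rw [mul_pow, ← pow_mul, mul_comm (N - 1), pow_mul, hx, hy, one_pow, one_mul]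
    · convert Ideal.mul_mem_right (y ^ (N - 1)) _ h using 1
      rw [sub_mul, ← hyy, mul_comm y]
  rw [← mul_one x, ← hyy, ← mul_assoc, h1, one_mul]

/-- The value at 1 of the cyclotomic polynomial of order p^(s+1) is p, and its factors 1 - μ are all
associated to η - 1. -/
theorem IsPrimitiveRoot.associated_sub_one_pow_totient {p s : ℕ} [hp : Fact p.Prime] {η : B}
    (hη : IsPrimitiveRoot η (p ^ (s + 1))) :
    Associated ((η - 1) ^ (p ^ (s + 1)).totient) (p : B) := by
  have h1 := Polynomial.eval_one_cyclotomic_prime_pow (R := B) (p := p) s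
  rw [Polynomial.cyclotomic_eq_prod_X_sub_primitiveRoots hη, Polynomial.eval_prod] at h1
  rw [← h1, ← hη.card_primitiveRoots, ← Finset.prod_const]
  refine Associated.prod _ _ _ fun μ hμ => ?_
  obtain ⟨i, -, hi, rfl⟩ := hη.isPrimitiveRoot_iff.1 ((mem_primitiveRoots (pow_pos hp.out.pos _)).1 hμ)
  rw [Polynomial.eval_sub, Polynomial.eval_X, Polynomial.eval_C, ← neg_sub (η ^ i)]
  exact (hη.associated_sub_one_pow_sub_one_of_coprime hi).neg_right

end RootsOfUnityLocal

theorem herbrandPhi_sub_herbrandPhi {B G : Type*} [CommRing B] [IsLocalRing B] [Group G]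
    [MulSemiringAction G B] [Finite G] {u v : ℝ} (huv : u ≤ v)
    (h : ∀ t ∈ Set.Ioc u v, lowerRamificationGroup B G t = lowerRamificationGroup B G v) :
    herbrandPhi B G v - herbrandPhi B G u = (v - u) *
      ((Nat.card (lowerRamificationGroup B G v) : ℝ) / Nat.card (lowerRamificationGroup B G 0)) := by
  have hanti : Antitone fun t => (Nat.card (lowerRamificationGroup B G t) : ℝ) /
      Nat.card (lowerRamificationGroup B G 0) := fun s t hst => by
    dsimp only
    gcongr
    exact Subgroup.card_le_of_le (lowerRamificationGroup_antitone hst)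
  rw [herbrandPhi, herbrandPhi, intervalIntegral.integral_interval_sub_left
    hanti.intervalIntegrable hanti.intervalIntegrable, intervalIntegral.integral_of_le huv,
    MeasureTheory.setIntegral_congr_fun (g := fun _ => (Nat.card (lowerRamificationGroup B G v) : ℝ)
      / Nat.card (lowerRamificationGroup B G 0)) measurableSet_Ioc (fun t ht => by
        dsimp only; rw [h t ht]), MeasureTheory.setIntegral_const]
  simp [huv]

section Cyclotomic

variable {p : ℕ} [Fact p.Prime] {L : Type*} [Field L] [Algebra ℚ_[p] L] [Algebra ℤ_[p] L]
  [IsScalarTower ℤ_[p] ℚ_[p] L] [FiniteDimensional ℚ_[p] L] [IsAbelianGalois ℚ_[p] L]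
  {n m : ℕ} {ζ ξ : integralClosure ℤ_[p] L}

variable (p L) in
theorem natCast_pow_sub_one_notMem (hm : m ≠ 0) :
    ((p ^ m - 1 : ℕ) : integralClosure ℤ_[p] L) ∉ maximalIdeal (integralClosure ℤ_[p] L) := by
  intro h
  rw [Nat.cast_sub (Nat.one_le_pow _ _ (Fact.out : p.Prime).pos), Nat.cast_pow, Nat.cast_one] at h
  refine (Ideal.ne_top_iff_one _).1 (maximalIdeal.isMaximal (integralClosure ℤ_[p] L)).ne_top ?_
  simpa using sub_mem (Ideal.pow_mem_of_mem _ (natCast_mem_maximalIdeal_integralClosure p L) m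
    (Nat.pos_of_ne_zero hm)) h

theorem smul_eq_self_of_mem_inertia (hm : m ≠ 0) (hξ : IsPrimitiveRoot ξ (p ^ m - 1))
    {σ : Gal(L/ℚ_[p])} (hσ : σ ∈ padicRamificationGroup p L 1) : σ • ξ = ξ := by
  refine eq_of_pow_eq_one_of_sub_mem (natCast_pow_sub_one_notMem p L hm) ?_ hξ.pow_eq_one ?_
  · rw [← smul_pow', hξ.pow_eq_one, smul_one]
  · simpa using hσ ξ

theorem smul_eq_pow_of_frobenius (hm : m ≠ 0) (hξ : ξ ^ (p ^ m - 1) = 1)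
    {τ : Gal(L/ℚ_[p])} (hτ : ∀ b : integralClosure ℤ_[p] L,
      τ • b - b ^ p ∈ maximalIdeal (integralClosure ℤ_[p] L)) : τ • ξ = ξ ^ p := by
  refine eq_of_pow_eq_one_of_sub_mem (natCast_pow_sub_one_notMem p L hm) ?_ ?_ (hτ ξ)
  · rw [← smul_pow', hξ, smul_one]
  · rw [← pow_mul, mul_comm, pow_mul, hξ, one_pow]

theorem sub_one_mem_maximalIdeal (hζ : ζ ^ p ^ n = 1) :
    ζ - 1 ∈ maximalIdeal (integralClosure ℤ_[p] L) := by
  set B := integralClosure ℤ_[p] L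
  have hpk : (p : ResidueField B) = 0 := by
    rw [← map_natCast (residue B)]
    exact (residue_eq_zero_iff _).2 (natCast_mem_maximalIdeal_integralClosure p L)
  have : CharP (ResidueField B) p := (CharP.charP_iff_prime_eq_zero Fact.out).2 hpk
  rw [← residue_eq_zero_iff]
  refine pow_eq_zero_iff (n := p ^ n) (pow_pos (Fact.out : p.Prime).pos n).ne' |>.1 ?_
  rw [map_sub, map_one, sub_pow_char_pow, one_pow, ← map_pow, hζ, map_one, sub_self]

omit [FiniteDimensional ℚ_[p] L] [IsAbelianGalois ℚ_[p] L] in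
theorem exists_injective_stabilizer_primitiveRoots (hζ : IsPrimitiveRoot ζ (p ^ n))
    (hgen : ∀ σ : Gal(L/ℚ_[p]), σ • ζ = ζ → σ • ξ = ξ → σ = 1) :
    ∃ f : MulAction.stabilizer Gal(L/ℚ_[p]) ξ → primitiveRoots (p ^ n) (integralClosure ℤ_[p] L),
      Function.Injective f ∧ ∀ σ, (f σ : integralClosure ℤ_[p] L) = σ.1 • ζ := by
  have hpos := pow_pos (Fact.out : p.Prime).pos n
  have hprim : ∀ σ : Gal(L/ℚ_[p]), IsPrimitiveRoot (σ • ζ) (p ^ n) := fun σ =>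
    hζ.map_of_injective (MulSemiringAction.toRingEquiv Gal(L/ℚ_[p]) (integralClosure ℤ_[p] L)
      σ).injective
  refine ⟨fun σ => ⟨σ.1 • ζ, (mem_primitiveRoots hpos).2 (hprim σ.1)⟩, ?_, fun _ => rfl⟩
  rintro ⟨σ, hσ⟩ ⟨τ, hτ⟩ h
  have h1 : σ • ζ = τ • ζ := congrArg Subtype.val h
  refine Subtype.ext (inv_mul_eq_one.1 (hgen _ ?_ ?_)).symm
  · rw [mul_smul, h1, inv_smul_smul]
  · rw [mul_smul, MulAction.mem_stabilizer_iff.1 hσ, inv_smul_eq_iff,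
      MulAction.mem_stabilizer_iff.1 hτ]

/-- Two inequalities squeeze the order e of inertia. The relation between p and (ζ - 1)^φ(p^n) gives
e ≥ φ(p^n); inertia fixes ξ and hence embeds in the set of primitive p^n-th roots, which gives e ≤
φ(p^n). -/
theorem uniformizer_and_card_inertia (hn : n ≠ 0) (hm : m ≠ 0) (hζ : IsPrimitiveRoot ζ (p ^ n))
    (hξ : IsPrimitiveRoot ξ (p ^ m - 1))
    (hgen : ∀ σ : Gal(L/ℚ_[p]), σ • ζ = ζ → σ • ξ = ξ → σ = 1) :
    padicRamificationGroup p L 1 = MulAction.stabilizer Gal(L/ℚ_[p]) ξ ∧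
      Nat.card (padicRamificationGroup p L 1) = (p ^ n).totient ∧
      maximalIdeal (integralClosure ℤ_[p] L) = Ideal.span {ζ - 1} := by
  have hle : padicRamificationGroup p L 1 ≤ MulAction.stabilizer Gal(L/ℚ_[p]) ξ :=
    fun σ hσ => smul_eq_self_of_mem_inertia hm hξ hσ
  have hcard : Nat.card (MulAction.stabilizer Gal(L/ℚ_[p]) ξ) ≤ (p ^ n).totient := by
    obtain ⟨f, hf, -⟩ := exists_injective_stabilizer_primitiveRoots hζ hgen
    rw [← hζ.card_primitiveRoots, ← Fintype.card_coe, ← Nat.card_eq_fintype_card]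
    exact Nat.card_le_card_of_injective f hf
  obtain ⟨k, rfl⟩ := Nat.exists_eq_succ_of_ne_zero hn
  have hass := hζ.associated_sub_one_pow_totient
  obtain ⟨ϖ, hϖ⟩ := IsDiscreteValuationRing.exists_irreducible (integralClosure ℤ_[p] L)
  have hP := maximalIdeal_pow_card_inertia p L
  rw [lowerRamificationGroup_zero_eq] at hP
  have hmem := sub_one_mem_maximalIdeal hζ.pow_eq_one
  set e := Nat.card (padicRamificationGroup p L 1)
  have hspan : maximalIdeal (integralClosure ℤ_[p] L) ^ e =
      Ideal.span {ζ - 1} ^ (p ^ (k + 1)).totient := by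
    rw [hP, Ideal.span_singleton_pow, Ideal.span_singleton_eq_span_singleton]
    exact hass.symm
  have he : (p ^ (k + 1)).totient ≤ e := by
    have h1 : maximalIdeal (integralClosure ℤ_[p] L) ^ e ≤
        maximalIdeal (integralClosure ℤ_[p] L) ^ (p ^ (k + 1)).totient := by
      rw [hspan]
      exact Ideal.pow_right_mono ((Ideal.span_singleton_le_iff_mem _).2 hmem) _
    by_contra! hlt
    exact (h1.trans (Ideal.pow_le_pow_right hlt)).not_gt (Ideal.pow_succ_lt_pow
      (IsDiscreteValuationRing.not_a_field _) e)
  have hS : Nat.card (MulAction.stabilizer Gal(L/ℚ_[p]) ξ) ≤ e := hcard.trans he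
  have heq := Subgroup.eq_of_le_of_card_ge hle hS
  have he' : e = (p ^ (k + 1)).totient := le_antisymm ((Subgroup.card_le_of_le hle).trans hcard) he
  refine ⟨heq, he', ?_⟩
  rw [← he', hϖ.maximalIdeal_eq, Ideal.span_singleton_pow, Ideal.span_singleton_pow,
    Ideal.span_singleton_eq_span_singleton, Associated.pow_iff Nat.card_pos.ne'] at hspan
  rw [hϖ.maximalIdeal_eq, Ideal.span_singleton_eq_span_singleton]
  exact hspan

/-- If η ≠ 1 has order p^s, then η - 1 is associated to (ζ - 1)^(p^(n-s)), so only the order of η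
matters. The hypothesis on k replaces the inequality i ≤ p^j by k ≤ j. -/
theorem sub_one_mem_pow_iff (hP : maximalIdeal (integralClosure ℤ_[p] L) = Ideal.span {ζ - 1})
    (hζ : IsPrimitiveRoot ζ (p ^ n)) {η : integralClosure ℤ_[p] L} (hη : η ^ p ^ n = 1) {i k : ℕ}
    (hik : ∀ j < n, i ≤ p ^ j ↔ k ≤ j) :
    η - 1 ∈ maximalIdeal (integralClosure ℤ_[p] L) ^ i ↔ η ^ p ^ (n - k) = 1 := by
  have hp : p.Prime := Fact.out
  obtain ⟨s, hs, hsη⟩ := (Nat.dvd_prime_pow hp).1 (orderOf_dvd_of_pow_eq_one hη)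
  have hprim := IsPrimitiveRoot.orderOf η
  rw [hsη] at hprim
  rw [hprim.pow_eq_one_iff_dvd, Nat.pow_dvd_pow_iff_le_right hp.one_lt]
  cases s with
  | zero =>
    rw [pow_zero, IsPrimitiveRoot.one_right_iff] at hprim
    simp [hprim]
  | succ s =>
    obtain ⟨t, rfl⟩ := Nat.exists_eq_add_of_le hs
    have h1 := hprim.associated_sub_one_pow_totient
    rw [show s + 1 + t = (s + t) + 1 by omega] at hζ
    have h2 := hζ.associated_sub_one_pow_totient
    rw [show (p ^ (s + t + 1)).totient = p ^ t * (p ^ (s + 1)).totient by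
      rw [Nat.totient_prime_pow_succ hp, Nat.totient_prime_pow_succ hp]; ring, pow_mul] at h2
    have h3 := (Associated.pow_iff (Nat.totient_pos.2 (pow_pos hp.pos _)).ne').1 (h1.trans h2.symm)
    have h0 : Irreducible (ζ - 1) := IsDiscreteValuationRing.irreducible_of_span_eq_maximalIdeal _
      (fun h => IsDiscreteValuationRing.not_a_field (integralClosure ℤ_[p] L) (by rw [hP, h]; simp)) hP
    rw [hP, Ideal.span_singleton_pow, Ideal.mem_span_singleton, h3.dvd_iff_dvd_right,
      pow_dvd_pow_iff h0.ne_zero h0.not_isUnit, hik t (by omega)]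
    omega

end Cyclotomic

theorem pow_pow_eq_of_modEq {M : Type*} [Monoid M] {p m : ℕ} (hp : 0 < p) {ξ : M}
    (hξ : ξ ^ (p ^ m - 1) = 1) {i j : ℕ} (hij : i ≡ j [MOD m]) : ξ ^ p ^ i = ξ ^ p ^ j := by
  have h1 : ξ ^ p ^ m = ξ := by
    rw [← Nat.sub_add_cancel (Nat.one_le_pow m p hp), pow_succ, hξ, one_mul]
  have h2 : ∀ k, ξ ^ p ^ (m * k) = ξ := by
    intro k
    induction k with
    | zero => simp
    | succ k ih => rw [Nat.mul_succ, pow_add, pow_mul, ih, h1]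
  have h3 : ∀ i, ξ ^ p ^ i = ξ ^ p ^ (i % m) := fun i => by
    conv_lhs => rw [← Nat.div_add_mod i m, pow_add, pow_mul, h2]
  rw [h3 i, h3 j, hij]

theorem IsPrimitiveRoot.pow_pow_eq_iff {M : Type*} [CommMonoid M] {p m : ℕ} (hp : 1 < p)
    (hm : m ≠ 0) {ξ : M} (hξ : IsPrimitiveRoot ξ (p ^ m - 1)) (i j : ℕ) :
    ξ ^ p ^ i = ξ ^ p ^ j ↔ i ≡ j [MOD m] := by
  refine ⟨fun h => ?_, pow_pow_eq_of_modEq (by omega) hξ.pow_eq_one⟩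
  have h3 : ∀ i, ξ ^ p ^ i = ξ ^ p ^ (i % m) := fun i =>
    pow_pow_eq_of_modEq (by omega) hξ.pow_eq_one (Nat.mod_modEq i m).symm
  rw [h3 i, h3 j] at h
  -- For p = 2 and m = 1 the order p^m - 1 is 1 and the bound `hlt` fails; modulo 1 there is nothing
  -- to prove.
  obtain rfl | hm1 : m = 1 ∨ 2 ≤ m := by omega
  · exact Nat.modEq_one
  have hlt : ∀ i, p ^ (i % m) < p ^ m - 1 := fun i => by
    have h4 : p ^ (i % m) ≤ p ^ (m - 1) :=
      Nat.pow_le_pow_right (by omega) (Nat.le_sub_one_of_lt (Nat.mod_lt _ (by omega)))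
    have h5 : p ^ m = p ^ (m - 1) * p := by rw [← pow_succ, Nat.sub_add_cancel (by omega)]
    have h6 : 2 ≤ p ^ (m - 1) := hp.trans_le (Nat.le_self_pow (by omega) p)
    have h7 := Nat.mul_le_mul_left (p ^ (m - 1)) hp
    omega
  exact Nat.pow_right_injective hp (hξ.pow_inj (hlt i) (hlt j) h)

section Cyclotomic

variable {p : ℕ} [Fact p.Prime] {L : Type*} [Field L] [Algebra ℚ_[p] L] [Algebra ℤ_[p] L]
  [IsScalarTower ℤ_[p] ℚ_[p] L] [FiniteDimensional ℚ_[p] L] [IsAbelianGalois ℚ_[p] L]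
  {n m : ℕ} {ζ ξ : integralClosure ℤ_[p] L}

/-- By the count of inertia the stabilizer of ξ acts transitively on the primitive p^n-th roots. A
power of Frobenius adjusts the action on ξ, and its effect on ζ is compensated through b. -/
theorem exists_smul_eq_pow (hn : n ≠ 0) (hm : m ≠ 0) (hζ : IsPrimitiveRoot ζ (p ^ n))
    (hξ : IsPrimitiveRoot ξ (p ^ m - 1))
    (hgen : ∀ σ : Gal(L/ℚ_[p]), σ • ζ = ζ → σ • ξ = ξ → σ = 1) {a : ℕ} (ha : a.Coprime p) (j : ℕ) :
    ∃ σ : Gal(L/ℚ_[p]), σ • ζ = ζ ^ a ∧ σ • ξ = ξ ^ p ^ j := by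
  have hp : p.Prime := Fact.out
  obtain ⟨h1, h2, -⟩ := uniformizer_and_card_inertia hn hm hζ hξ hgen
  obtain ⟨f, hf, hfσ⟩ := exists_injective_stabilizer_primitiveRoots hζ hgen
  have hbij := hf.bijective_of_nat_card_le (by
    rw [← h1, h2, Nat.card_eq_fintype_card, Fintype.card_coe, hζ.card_primitiveRoots])
  obtain ⟨τ, hτ⟩ := exists_frobenius_integralClosure p L
  have hτξ : ∀ j : ℕ, τ ^ j • ξ = ξ ^ p ^ j := by
    intro j
    induction j with
    | zero => simp
    | succ j ih =>
      rw [pow_succ', mul_smul, ih, smul_pow', smul_eq_pow_of_frobenius hm hξ.pow_eq_one hτ,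
        ← pow_mul, pow_succ']
  have hprim : IsPrimitiveRoot (τ ^ j • ζ) (p ^ n) :=
    hζ.map_of_injective (MulSemiringAction.toRingEquiv Gal(L/ℚ_[p]) (integralClosure ℤ_[p] L)
      (τ ^ j)).injective
  obtain ⟨b, -, -, hb⟩ := hprim.isPrimitiveRoot_iff.1 (hζ.pow_of_coprime a (ha.pow_right n))
  have hbc : IsPrimitiveRoot (ζ ^ b) (p ^ n) := by
    have h3 := (hζ.pow_of_coprime a (ha.pow_right n)).map_of_injective
      (MulSemiringAction.toRingEquiv Gal(L/ℚ_[p]) (integralClosure ℤ_[p] L) (τ ^ j)⁻¹).injective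
    rw [MulSemiringAction.toRingEquiv_apply_apply, ← hb, smul_pow', inv_smul_smul] at h3
    exact h3
  obtain ⟨⟨σ, hσ⟩, hσζ⟩ := hbij.2 ⟨ζ ^ b, (mem_primitiveRoots (pow_pos hp.pos n)).2 hbc⟩
  have hσζ' : σ • ζ = ζ ^ b := by rw [← hfσ ⟨σ, hσ⟩, hσζ]
  refine ⟨τ ^ j * σ, ?_, ?_⟩
  · rw [mul_smul, hσζ', smul_pow', hb]
  · rw [mul_smul, MulAction.mem_stabilizer_iff.1 hσ, hτξ]

theorem mul_totient_le_card_gal (hn : n ≠ 0) (hm : m ≠ 0) (hζ : IsPrimitiveRoot ζ (p ^ n))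
    (hξ : IsPrimitiveRoot ξ (p ^ m - 1))
    (hgen : ∀ σ : Gal(L/ℚ_[p]), σ • ζ = ζ → σ • ξ = ξ → σ = 1) :
    m * (p ^ n).totient ≤ Nat.card Gal(L/ℚ_[p]) := by
  have hp : p.Prime := Fact.out
  obtain ⟨h1, h2, -⟩ := uniformizer_and_card_inertia hn hm hζ hξ hgen
  rw [← Subgroup.card_mul_index (MulAction.stabilizer Gal(L/ℚ_[p]) ξ), ← h1, h2, h1, mul_comm,
    MulAction.index_stabilizer]
  refine Nat.mul_le_mul_left _ ?_
  have hinj : Set.InjOn (fun j => ξ ^ p ^ j) (Finset.range m : Set ℕ) := by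
    intro i hi j hj h
    have h3 := (hξ.pow_pow_eq_iff hp.one_lt hm i j).1 h
    exact h3.eq_of_lt_of_lt (by simpa using hi) (by simpa using hj)
  have h4 := hinj.ncard_image
  rw [Set.ncard_coe_finset, Finset.card_range] at h4
  rw [← h4]
  refine Set.ncard_le_ncard ?_ (Set.finite_range _)
  rintro _ ⟨j, -, rfl⟩
  obtain ⟨σ, -, hσ⟩ := exists_smul_eq_pow hn hm hζ hξ hgen (Nat.coprime_one_left p) j
  exact ⟨σ, hσ⟩

/-- Since ζ - 1 is a uniformizer, an element of inertia is tested on ζ alone, through the root of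
unity σζ/ζ; in the proof ζ^(p^n - 1) plays the part of 1/ζ. -/
theorem mem_padicRamificationGroup_cyclotomic_iff (hn : n ≠ 0) (hm : m ≠ 0)
    (hζ : IsPrimitiveRoot ζ (p ^ n)) (hξ : IsPrimitiveRoot ξ (p ^ m - 1))
    (hgen : ∀ σ : Gal(L/ℚ_[p]), σ • ζ = ζ → σ • ξ = ξ → σ = 1) {i k : ℕ} (hi : 1 ≤ i)
    (hik : ∀ j < n, i ≤ p ^ j ↔ k ≤ j) {σ : Gal(L/ℚ_[p])} :
    σ ∈ padicRamificationGroup p L i ↔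
      σ • ξ = ξ ∧ σ • (ζ ^ p ^ (n - k)) = ζ ^ p ^ (n - k) := by
  have hp : p.Prime := Fact.out
  obtain ⟨h1, -, hP⟩ := uniformizer_and_card_inertia hn hm hζ hξ hgen
  have hmem1 : σ ∈ padicRamificationGroup p L 1 ↔ σ • ξ = ξ := by
    rw [h1, MulAction.mem_stabilizer_iff]
  rw [← hmem1]
  have hζN : ζ * ζ ^ (p ^ n - 1) = 1 := by
    rw [← pow_succ', Nat.sub_add_cancel (Nat.one_le_pow _ _ hp.pos), hζ.pow_eq_one]
  have key : σ ∈ padicRamificationGroup p L 1 → (σ ∈ padicRamificationGroup p L i ↔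
      σ • (ζ ^ p ^ (n - k)) = ζ ^ p ^ (n - k)) := by
    intro hσ
    have h2 : σ ∈ padicRamificationGroup p L i ↔
        σ • ζ - ζ ∈ maximalIdeal (integralClosure ℤ_[p] L) ^ i := by
      refine ⟨fun h => h ζ, fun h => ?_⟩
      obtain ⟨q, hq0, hq⟩ := exists_prime_pow_residueField p L
      refine mem_congruenceSubgroup_of_uniformizer hq0 hq hP hσ ?_
      rwa [smul_sub, smul_one, sub_sub_sub_cancel_right]
    have h3 : σ • ζ - ζ ∈ maximalIdeal (integralClosure ℤ_[p] L) ^ i ↔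
        σ • ζ * ζ ^ (p ^ n - 1) - 1 ∈ maximalIdeal (integralClosure ℤ_[p] L) ^ i := by
      constructor <;> intro h
      · convert Ideal.mul_mem_right (ζ ^ (p ^ n - 1)) _ h using 1
        rw [sub_mul, hζN]
      · convert Ideal.mul_mem_right ζ _ h using 1
        linear_combination (- (σ • ζ)) * hζN
    rw [h2, h3, sub_one_mem_pow_iff hP hζ _ hik, mul_pow, smul_pow']
    · have hunit : ζ ^ p ^ (n - k) * (ζ ^ (p ^ n - 1)) ^ p ^ (n - k) = 1 := by
        rw [← mul_pow, hζN, one_pow]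
      constructor <;> intro h
      · linear_combination ζ ^ p ^ (n - k) * h - (σ • ζ) ^ p ^ (n - k) * hunit
      · rw [h, hunit]
    · rw [mul_pow, ← smul_pow', hζ.pow_eq_one, smul_one, one_mul, ← pow_mul, mul_comm, pow_mul,
        hζ.pow_eq_one, one_pow]
  exact ⟨fun h => ⟨congruenceSubgroup_antitone hi h, (key (congruenceSubgroup_antitone hi h)).1 h⟩,
    fun h => (key h.1).2 h.2⟩

theorem padicRamificationGroup_eq_of_forall_le_iff (hn : n ≠ 0) (hm : m ≠ 0)
    (hζ : IsPrimitiveRoot ζ (p ^ n)) (hξ : IsPrimitiveRoot ξ (p ^ m - 1))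
    (hgen : ∀ σ : Gal(L/ℚ_[p]), σ • ζ = ζ → σ • ξ = ξ → σ = 1) {i k : ℕ} (hi : 1 ≤ i)
    (hik : ∀ j < n, i ≤ p ^ j ↔ k ≤ j) :
    padicRamificationGroup p L i = padicRamificationGroup p L (p ^ k) := by
  have hp : p.Prime := Fact.out
  ext σ
  rw [mem_padicRamificationGroup_cyclotomic_iff hn hm hζ hξ hgen hi hik,
    mem_padicRamificationGroup_cyclotomic_iff hn hm hζ hξ hgen (Nat.one_le_pow _ _ hp.pos)
      fun j _ => Nat.pow_le_pow_iff_right hp.one_lt]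

/-- The bounds p - 1 and p on consecutive quotients have product φ(p^n), the order of inertia, so
all are attained. Going down from inertia gives the lower bound, going up from the trivial group the
upper bound. -/
theorem card_padicRamificationGroup_cyclotomic (hn : n ≠ 0) (hm : m ≠ 0)
    (hζ : IsPrimitiveRoot ζ (p ^ n)) (hξ : IsPrimitiveRoot ξ (p ^ m - 1))
    (hgen : ∀ σ : Gal(L/ℚ_[p]), σ • ζ = ζ → σ • ξ = ξ → σ = 1) {k : ℕ} (hk0 : k ≠ 0) (hkn : k ≤ n) :
    Nat.card (padicRamificationGroup p L (p ^ k)) = p ^ (n - k) := by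
  have hp : p.Prime := Fact.out
  obtain ⟨-, h2, -⟩ := uniformizer_and_card_inertia hn hm hζ hξ hgen
  have hstep : ∀ k, Nat.card (padicRamificationGroup p L (p ^ k)) ≤
      (if k = 0 then p - 1 else p) * Nat.card (padicRamificationGroup p L (p ^ (k + 1))) := by
    intro k
    have h3 : padicRamificationGroup p L (p ^ k + 1) = padicRamificationGroup p L (p ^ (k + 1)) :=
      padicRamificationGroup_eq_of_forall_le_iff hn hm hζ hξ hgen (by omega) fun j _ => by
        rw [Nat.succ_le_iff, Nat.pow_lt_pow_iff_right hp.one_lt, Nat.succ_le_iff]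
    obtain ⟨i, hi⟩ := Nat.exists_eq_succ_of_ne_zero (pow_pos hp.pos k).ne'
    have h4 := relIndex_padicRamificationGroup_le p L i
    have h5 := Subgroup.relIndex_mul_relIndex ⊥ (padicRamificationGroup p L (i + 2))
      (padicRamificationGroup p L (i + 1)) bot_le (congruenceSubgroup_antitone (by omega))
    rw [Subgroup.relIndex_bot_left, Subgroup.relIndex_bot_left] at h5
    rw [← h3, hi, ← h5, mul_comm]
    refine Nat.mul_le_mul_right _ (h4.trans (le_of_eq (if_congr ?_ rfl rfl)))
    have h6 : k = 0 ↔ p ^ k = 1 := (Nat.pow_eq_one.trans (or_iff_right hp.one_lt.ne')).symm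
    rw [h6, hi]
    omega
  have hlow : ∀ k, p ^ (n - 1) ≤ Nat.card (padicRamificationGroup p L (p ^ (k + 1))) * p ^ k := by
    intro k
    induction k with
    | zero =>
      have h3 := hstep 0
      obtain ⟨n', rfl⟩ := Nat.exists_eq_succ_of_ne_zero hn
      rw [if_pos rfl, pow_zero, h2, Nat.totient_prime_pow_succ hp, mul_comm] at h3
      simpa using Nat.le_of_mul_le_mul_left h3 (Nat.sub_pos_of_lt hp.one_lt)
    | succ k ih =>
      refine ih.trans ((Nat.mul_le_mul_right _ (hstep (k + 1))).trans (le_of_eq ?_))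
      rw [if_neg (by omega)]
      ring
  have hup : ∀ j < n, Nat.card (padicRamificationGroup p L (p ^ (n - j))) ≤ p ^ j := by
    intro j
    induction j with
    | zero =>
      intro _
      rw [pow_zero, (Subgroup.eq_bot_iff_forall (padicRamificationGroup p L (p ^ (n - 0)))).2]
      · simp
      · intro σ hσ
        rw [Nat.sub_zero, mem_padicRamificationGroup_cyclotomic_iff hn hm hζ hξ hgen (k := n)
          (Nat.one_le_pow _ _ hp.pos) fun j _ => Nat.pow_le_pow_iff_right hp.one_lt] at hσ
        exact hgen σ (by simpa using hσ.2) hσ.1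
    | succ j ih =>
      intro hj
      have h3 := hstep (n - (j + 1))
      rw [if_neg (by omega), show n - (j + 1) + 1 = n - j by omega] at h3
      rw [pow_succ']
      exact h3.trans (Nat.mul_le_mul_left _ (ih (by omega)))
  obtain ⟨k, rfl⟩ := Nat.exists_eq_succ_of_ne_zero hk0
  refine le_antisymm ?_ ?_
  · have h3 := hup (n - (k + 1)) (by omega)
    rwa [show n - (n - (k + 1)) = k + 1 by omega] at h3
  · have h3 := hlow k
    rw [show n - 1 = n - (k + 1) + k by omega, pow_add] at h3
    exact Nat.le_of_mul_le_mul_right h3 (pow_pos hp.pos k)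

/-- Between p^k - 1 and p^(k+1) - 1 the slope is p^(n-k-1)/φ(p^n) = 1/(p^k(p - 1)), and the interval
has length p^k(p - 1), so φ increases by 1. -/
theorem herbrandPhi_cyclotomic (hn : n ≠ 0) (hm : m ≠ 0)
    (hζ : IsPrimitiveRoot ζ (p ^ n)) (hξ : IsPrimitiveRoot ξ (p ^ m - 1))
    (hgen : ∀ σ : Gal(L/ℚ_[p]), σ • ζ = ζ → σ • ξ = ξ → σ = 1) {k : ℕ} (hkn : k ≤ n) :
    herbrandPhi (integralClosure ℤ_[p] L) Gal(L/ℚ_[p]) ((p : ℝ) ^ k - 1) = k := by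
  have hp : p.Prime := Fact.out
  obtain ⟨-, h2, -⟩ := uniformizer_and_card_inertia hn hm hζ hξ hgen
  induction k with
  | zero => simp [herbrandPhi]
  | succ k ih =>
    have hlow : ∀ t ∈ Set.Ioc ((p : ℝ) ^ k - 1) ((p : ℝ) ^ (k + 1) - 1),
        lowerRamificationGroup (integralClosure ℤ_[p] L) Gal(L/ℚ_[p]) t =
          padicRamificationGroup p L (p ^ (k + 1)) := by
      intro t ht
      rw [lowerRamificationGroup_eq]
      have h3 : ((p ^ k : ℕ) : ℤ) < ⌈t⌉ + 1 := by
        rw [← sub_lt_iff_lt_add, Int.lt_ceil]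
        push_cast
        exact ht.1
      have h4 : ⌈t⌉ + 1 ≤ ((p ^ (k + 1) : ℕ) : ℤ) := by
        rw [← le_sub_iff_add_le, Int.ceil_le]
        push_cast
        exact ht.2
      have h5 : 0 < p ^ k := pow_pos hp.pos k
      refine padicRamificationGroup_eq_of_forall_le_iff hn hm hζ hξ hgen (by omega) fun j _ => ?_
      constructor <;> intro h
      · exact (Nat.pow_lt_pow_iff_right hp.one_lt).1 (show p ^ k < p ^ j by omega)
      · have := Nat.pow_le_pow_right hp.pos h
        omega
    have hpk : (p : ℝ) ^ k < (p : ℝ) ^ (k + 1) :=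
      pow_lt_pow_right₀ (by exact_mod_cast hp.one_lt) (Nat.lt_succ_self k)
    have hright := hlow _ (Set.right_mem_Ioc.2 (sub_lt_sub_right hpk 1))
    have h6 := herbrandPhi_sub_herbrandPhi (B := integralClosure ℤ_[p] L) (G := Gal(L/ℚ_[p]))
      (sub_le_sub_right hpk.le 1) fun t ht => (hlow t ht).trans hright.symm
    rw [ih (by omega), hright, lowerRamificationGroup_zero_eq, h2,
      card_padicRamificationGroup_cyclotomic hn hm hζ hξ hgen (by omega) hkn] at h6
    obtain ⟨j, rfl⟩ := Nat.exists_eq_add_of_le hkn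
    rw [show k + 1 + j = k + j + 1 by omega, Nat.totient_prime_pow_succ hp,
      show k + j + 1 - (k + 1) = j by omega] at h6
    have hp1 : (1 : ℝ) < p := by exact_mod_cast hp.one_lt
    have h7 : ((p : ℝ) ^ (k + 1) - 1 - (p ^ k - 1)) *
        (((p ^ j : ℕ) : ℝ) / ((p ^ (k + j) * (p - 1) : ℕ) : ℝ)) = 1 := by
      rw [mul_div_assoc', div_eq_one_iff_eq]
      · push_cast [Nat.cast_sub hp.one_lt.le]
        ring
      · have := Nat.sub_pos_of_lt hp.one_lt
        have := pow_pos hp.pos (k + j)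
        positivity
    rw [h7] at h6
    push_cast
    linarith

theorem mem_padicUpperRamificationGroup_cyclotomic_iff (hn : n ≠ 0) (hm : m ≠ 0)
    (hζ : IsPrimitiveRoot ζ (p ^ n)) (hξ : IsPrimitiveRoot ξ (p ^ m - 1))
    (hgen : ∀ σ : Gal(L/ℚ_[p]), σ • ζ = ζ → σ • ξ = ξ → σ = 1) {v : ℝ} (hv : -1 < v)
    {σ : Gal(L/ℚ_[p])} : σ ∈ padicUpperRamificationGroup p L v ↔
      σ • ξ = ξ ∧ σ • (ζ ^ p ^ (n - ⌈v⌉.toNat)) = ζ ^ p ^ (n - ⌈v⌉.toNat) := by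
  have hp : p.Prime := Fact.out
  rw [padicUpperRamificationGroup, upperRamificationGroup, lowerRamificationGroup_eq]
  set u := herbrandPsi (integralClosure ℤ_[p] L) Gal(L/ℚ_[p]) v with hu
  have hu1 : -1 < u := by
    by_contra! h
    rw [hu, herbrandPsi_le_iff le_rfl hv.le, herbrandPhi_neg_one] at h
    linarith
  have hcu : -1 < ⌈u⌉ := Int.lt_ceil.2 (by push_cast; exact hu1)
  refine mem_padicRamificationGroup_cyclotomic_iff hn hm hζ hξ hgen (by omega) fun j hj => ?_
  have h1 : (1 : ℝ) ≤ (p : ℝ) ^ j := one_le_pow₀ (by exact_mod_cast hp.one_lt.le)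
  have h2 : u ≤ (p : ℝ) ^ j - 1 ↔ v ≤ j := by
    rw [hu, herbrandPsi_le_iff (by linarith) hv.le,
      herbrandPhi_cyclotomic hn hm hζ hξ hgen hj.le]
  rw [Int.toNat_le, Int.toNat_le, Int.ceil_le, ← le_sub_iff_add_le, Int.ceil_le]
  push_cast
  exact h2

end Cyclotomic

theorem mem_fixedField_zpowers_iff {K L : Type*} [Field K] [Field L] [Algebra K L]
    {σ : Gal(L/K)} {x : L} :
    x ∈ IntermediateField.fixedField (Subgroup.zpowers σ) ↔ σ x = x := by
  rw [IntermediateField.mem_fixedField_iff]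
  refine ⟨fun h => h σ (Subgroup.mem_zpowers σ), fun h τ hτ => ?_⟩
  have h1 : Subgroup.zpowers σ ≤ MulAction.stabilizer Gal(L/K) x := Subgroup.zpowers_le.2 h
  exact h1 hτ

/-! ### The local Kronecker–Weber theorem -/

section KroneckerWeber

variable {p : ℕ} [Fact p.Prime]

theorem coprime_pow_pow_sub_one (n : ℕ) {m : ℕ} (hm : m ≠ 0) :
    (p ^ n).Coprime (p ^ m - 1) := by
  refine Nat.Coprime.pow_left n ((Nat.Prime.coprime_iff_not_dvd Fact.out).2 fun h => ?_)
  have hp : p.Prime := Fact.out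
  have h1 := (Nat.dvd_sub_iff_right (Nat.one_le_pow m p hp.pos) (dvd_pow_self p hm)).1 h
  exact hp.one_lt.ne' (Nat.dvd_one.1 h1)

variable (p) in
theorem pow_mul_pow_sub_one_ne_zero (n : ℕ) {m : ℕ} (hm : m ≠ 0) : p ^ n * (p ^ m - 1) ≠ 0 := by
  have hp : p.Prime := Fact.out
  exact Nat.mul_ne_zero (pow_pos hp.pos n).ne'
    (Nat.sub_pos_of_lt (Nat.one_lt_pow hm hp.one_lt)).ne'

theorem exists_isPrimitiveRoot_integralClosure (L : Type*) [Field L] [Algebra ℚ_[p] L]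
    [Algebra ℤ_[p] L] [IsScalarTower ℤ_[p] ℚ_[p] L] {n m : ℕ} (hm : m ≠ 0)
    [hL : IsCyclotomicExtension {p ^ n * (p ^ m - 1)} ℚ_[p] L] :
    ∃ ζ ξ : integralClosure ℤ_[p] L, IsPrimitiveRoot ζ (p ^ n) ∧ IsPrimitiveRoot ξ (p ^ m - 1) ∧
      ∀ σ : Gal(L/ℚ_[p]), σ • ζ = ζ → σ • ξ = ξ → σ = 1 := by
  have hp : p.Prime := Fact.out
  have hN := pow_mul_pow_sub_one_ne_zero p n hm
  have : NeZero (p ^ n * (p ^ m - 1)) := ⟨hN⟩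
  have hη := IsCyclotomicExtension.zeta_spec (p ^ n * (p ^ m - 1)) ℚ_[p] L
  set η := IsCyclotomicExtension.zeta (p ^ n * (p ^ m - 1)) ℚ_[p] L
  have hint : IsIntegral ℤ_[p] η := IsIntegral.of_pow (n := p ^ n * (p ^ m - 1))
    (Nat.pos_of_ne_zero hN) (by rw [hη.pow_eq_one]; exact isIntegral_one)
  have hη' : IsPrimitiveRoot (⟨η, hint⟩ : integralClosure ℤ_[p] L) (p ^ n * (p ^ m - 1)) :=
    IsPrimitiveRoot.coe_submonoidClass_iff.1 hη
  refine ⟨_, _, hη'.pow (Nat.pos_of_ne_zero hN) (mul_comm _ _),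
    hη'.pow (Nat.pos_of_ne_zero hN) rfl, fun σ h1 h2 => ?_⟩
  refine IsCyclotomicExtension.algEquiv_eq_of_apply_eq {p ^ n * (p ^ m - 1)} ℚ_[p] L ?_
  rintro _ rfl -
  refine ⟨η, hη, ?_⟩
  have h1' : σ η ^ (p ^ m - 1) = η ^ (p ^ m - 1) := by
    rw [← map_pow]; exact congrArg Subtype.val h1
  have h2' : σ η ^ p ^ n = η ^ p ^ n := by
    rw [← map_pow]; exact congrArg Subtype.val h2
  have hη0 : η ≠ 0 := hη.ne_zero hN
  have h3 : orderOf (σ η / η) ∣ 1 := by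
    rw [← (coprime_pow_pow_sub_one (p := p) n hm).gcd_eq_one]
    exact Nat.dvd_gcd
      (orderOf_dvd_of_pow_eq_one (by rw [div_pow, h2', div_self (pow_ne_zero _ hη0)]))
      (orderOf_dvd_of_pow_eq_one (by rw [div_pow, h1', div_self (pow_ne_zero _ hη0)]))
  rw [Nat.dvd_one, orderOf_eq_one_iff, div_eq_one_iff_eq hη0] at h3
  exact h3

theorem card_gal_le {L : Type*} [Field L] [Algebra ℚ_[p] L]
    [Algebra ℤ_[p] L] [IsScalarTower ℤ_[p] ℚ_[p] L] [FiniteDimensional ℚ_[p] L]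
    [IsAbelianGalois ℚ_[p] L] (hι : p = 2 → ∃ ι : L, ι ^ 2 = -1) {r d : ℕ} (hd : p.Coprime d)
    (hd0 : 0 < d) (h : ∀ σ : Gal(L/ℚ_[p]), σ ^ (p ^ (r + 1) * d) = 1) :
    Nat.card Gal(L/ℚ_[p]) ≤
      (p ^ (r + 1) * d) * (p ^ (r + lastExponentPrimeBreak p + 1)).totient := by
  rw [Nat.totient_prime_pow_succ Fact.out]
  by_cases hp : p = 2
  · subst hp
    obtain ⟨ι, hι⟩ := hι rfl
    simpa [lastExponentPrimeBreak] using card_gal_le_of_two L hι hd hd0 h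
  · refine (card_gal_le_of_odd p L hp hd hd0 h).trans (le_of_eq ?_)
    rw [lastExponentPrimeBreak, if_neg hp, pow_succ p r]

theorem sq_pow_sub_one_dvd (r : ℕ) {a : ℤ} (ha : Odd a) :
    (2 ^ (r + 3) : ℤ) ∣ a ^ 2 ^ (r + 1) - 1 := by
  induction r with
  | zero =>
    obtain ⟨b, rfl⟩ := ha
    obtain ⟨c, hc⟩ := Int.even_mul_succ_self b
    exact ⟨c, by linear_combination 4 * hc⟩
  | succ r ih =>
    obtain ⟨b, hb⟩ := ih
    have h1 : a ^ 2 ^ (r + 1) = 1 + 2 ^ (r + 3) * b := by linear_combination hb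
    refine ⟨b + 2 ^ (r + 2) * b ^ 2, ?_⟩
    rw [pow_succ 2 (r + 1), pow_mul, h1]
    ring

/-- For odd p the modulus is p^(r+2), and p^(r+1)(p - 1) is its totient. For p = 2 the modulus is
2^(r+3), whose unit group is already killed by 2^(r+1). -/
theorem pow_modEq_one_of_coprime {a r d : ℕ} (ha : a.Coprime p) (hd : (p - 1) ∣ d) :
    a ^ (p ^ (r + 1) * d) ≡ 1 [MOD p ^ (r + lastExponentPrimeBreak p + 1)] := by
  have hp : p.Prime := Fact.out
  by_cases hp2 : p = 2
  · subst hp2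
    rw [pow_mul]
    have h1 := sq_pow_sub_one_dvd r (a := a) (by
      rw [Int.odd_coe_nat, ← Nat.coprime_two_right]; exact ha)
    have h2 : a ^ 2 ^ (r + 1) ≡ 1 [MOD 2 ^ (r + lastExponentPrimeBreak 2 + 1)] := by
      rw [Nat.ModEq.comm, Nat.modEq_iff_dvd]
      simpa [lastExponentPrimeBreak] using h1
    simpa using h2.pow d
  · obtain ⟨c, rfl⟩ := hd
    rw [← mul_assoc, lastExponentPrimeBreak, if_neg hp2, ← Nat.totient_prime_pow_succ hp, pow_mul]
    simpa using (Nat.ModEq.pow_totient (ha.pow_right (r + 1 + 1))).pow c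

theorem exists_forall_smul_eq_pow_pow {L : Type*} [Field L] [Algebra ℚ_[p] L]
    [Algebra ℤ_[p] L] [IsScalarTower ℤ_[p] ℚ_[p] L] [FiniteDimensional ℚ_[p] L]
    [IsAbelianGalois ℚ_[p] L] (σ : Gal(L/ℚ_[p])) :
    ∃ j : ℕ, ∀ m ≠ 0, ∀ ξ : L, ξ ^ (p ^ m - 1) = 1 → σ ξ = ξ ^ p ^ j := by
  have hp : p.Prime := Fact.out
  obtain ⟨j, hj⟩ := exists_smul_sub_pow_mem p L σ
  refine ⟨j, fun m hm ξ hξ => ?_⟩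
  have hint : IsIntegral ℤ_[p] ξ := by
    refine IsIntegral.of_pow (n := p ^ m - 1) (Nat.sub_pos_of_lt (Nat.one_lt_pow hm hp.one_lt)) ?_
    rw [hξ]
    exact isIntegral_one
  have hξ' : (⟨ξ, hint⟩ : integralClosure ℤ_[p] L) ^ (p ^ m - 1) = 1 := Subtype.ext hξ
  refine congrArg Subtype.val (eq_of_pow_eq_one_of_sub_mem (natCast_pow_sub_one_notMem p L hm)
    (x := σ • ⟨ξ, hint⟩) (y := ⟨ξ, hint⟩ ^ p ^ j) ?_ ?_ (hj _))
  · rw [← smul_pow', hξ', smul_one]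
  · rw [← pow_mul, mul_comm, pow_mul, hξ', one_pow]

variable {M : Type*} [Field M] [Algebra ℚ_[p] M] [Algebra ℤ_[p] M] [IsScalarTower ℤ_[p] ℚ_[p] M]
  [IsAbelianGalois ℚ_[p] M]

/-- The groups of L and C, hence that of their compositum, are killed by d, and the order of Gal(C)
reaches the bound valid for every abelian group over ℚ_p killed by d. So the compositum is no larger
than C. -/
theorem exists_forall_le_of_isCyclotomicExtension (L : IntermediateField ℚ_[p] M)
    [FiniteDimensional ℚ_[p] L] : ∃ n ≠ 0, ∃ m ≠ 0, ∀ C : IntermediateField ℚ_[p] M,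
      IsCyclotomicExtension {p ^ n * (p ^ m - 1)} ℚ_[p] C → L ≤ C := by
  have hp : p.Prime := Fact.out
  have hN : Nat.card Gal(L/ℚ_[p]) ≠ 0 := Nat.card_pos.ne'
  obtain ⟨r, N', hpN', hrN⟩ := Nat.exists_eq_pow_mul_and_not_dvd hN p hp.ne_one
  -- The factor p - 1 here, and the extra p in d, make d kill the units modulo p^n. With m = d and
  -- this n, the bound of `card_gal_le` is exactly d·φ(p^n).
  set d' := N' * (p - 1) with hd'
  have hN'0 : 0 < N' := Nat.pos_of_ne_zero fun h => hpN' (h ▸ dvd_zero p)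
  have hd0 : 0 < d' := Nat.mul_pos hN'0 (Nat.sub_pos_of_lt hp.one_lt)
  have hcop : p.Coprime d' := by
    refine (hp.coprime_iff_not_dvd).2 fun h => ?_
    rcases hp.dvd_mul.1 h with h | h
    · exact hpN' h
    · have := Nat.le_of_dvd (Nat.sub_pos_of_lt hp.one_lt) h
      have := hp.pos
      omega
  set d := p ^ (r + 1) * d' with hd
  have hd_ne : d ≠ 0 := (Nat.mul_pos (pow_pos hp.pos _) hd0).ne'
  have hNd : Nat.card Gal(L/ℚ_[p]) ∣ d := ⟨p * (p - 1), by rw [hrN, hd, hd']; ring⟩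
  set n := r + lastExponentPrimeBreak p + 1 with hn
  have hn0 : n ≠ 0 := by omega
  refine ⟨n, hn0, d, hd_ne, fun C hC => ?_⟩
  have hfinC : FiniteDimensional ℚ_[p] C :=
    IsCyclotomicExtension.finiteDimensional {p ^ n * (p ^ d - 1)} ℚ_[p] C
  obtain ⟨ζ, ξ, hζ, hξ, hgen⟩ := exists_isPrimitiveRoot_integralClosure (p := p) C (n := n) hd_ne
  have hexpL : ∀ s : Gal(M/ℚ_[p]), ∀ x : L, (s ^ d) (x : M) = x := by
    intro s x
    rw [← AlgEquiv.restrictNormalHom_apply, map_pow]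
    obtain ⟨k, hk⟩ := hNd
    rw [hk, pow_mul, pow_card_eq_one', one_pow, AlgEquiv.one_apply]
  have hexpC : ∀ σ : Gal(C/ℚ_[p]), σ ^ d = 1 := by
    intro σ
    have hprim : IsPrimitiveRoot (σ • ζ) (p ^ n) :=
      hζ.map_of_injective (MulSemiringAction.toRingEquiv Gal(C/ℚ_[p]) (integralClosure ℤ_[p] C)
        σ).injective
    obtain ⟨a, -, ha, haζ⟩ := hζ.isPrimitiveRoot_iff.1 hprim
    have hpowζ : ∀ k : ℕ, σ ^ k • ζ = ζ ^ a ^ k := by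
      intro k
      induction k with
      | zero => simp
      | succ k ih => rw [pow_succ, mul_smul, ← haζ, smul_pow', ih, ← pow_mul, pow_succ]
    obtain ⟨j, hj⟩ := exists_forall_smul_eq_pow_pow σ
    have hjξ : σ • ξ = ξ ^ p ^ j := Subtype.ext (hj d hd_ne ξ
      (congrArg Subtype.val hξ.pow_eq_one))
    have hpowξ : ∀ k : ℕ, σ ^ k • ξ = ξ ^ p ^ (j * k) := by
      intro k
      induction k with
      | zero => simp
      | succ k ih => rw [pow_succ, mul_smul, hjξ, smul_pow', ih, ← pow_mul, ← pow_add,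
          Nat.mul_succ]
    refine hgen _ ?_ ?_
    · have ha' := pow_modEq_one_of_coprime (p := p) (r := r) (d := d')
        ((Nat.coprime_pow_right_iff (Nat.pos_of_ne_zero hn0) _ _).1 ha) (dvd_mul_left _ _)
      rw [hpowζ]
      exact (pow_eq_pow_of_modEq ha' hζ.pow_eq_one).trans (pow_one ζ)
    · rw [hpowξ]
      conv_rhs => rw [← pow_one ξ, ← pow_zero p]
      rw [hξ.pow_pow_eq_iff hp.one_lt hd_ne]
      exact (Nat.modEq_zero_iff_dvd).2 (dvd_mul_left _ _)
  have hexp : ∀ σ : Gal((L ⊔ C : IntermediateField ℚ_[p] M)/ℚ_[p]),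
      σ ^ (p ^ (r + 1) * d') = 1 := by
    intro σ
    obtain ⟨s, rfl⟩ := AlgEquiv.restrictNormalHom_surjective (F := ℚ_[p]) (E := M) σ
    rw [← map_pow]
    have hle : L ⊔ C ≤ IntermediateField.fixedField (Subgroup.zpowers (s ^ d)) := by
      refine sup_le (fun x hx => ?_) (fun x hx => ?_) <;>
        rw [mem_fixedField_zpowers_iff]
      · exact hexpL s ⟨x, hx⟩
      · have h1 := AlgEquiv.restrictNormalHom_apply C (s ^ d) ⟨x, hx⟩
        rw [map_pow, hexpC, AlgEquiv.one_apply] at h1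
        exact h1.symm
    ext x
    rw [AlgEquiv.restrictNormalHom_apply, AlgEquiv.one_apply]
    exact mem_fixedField_zpowers_iff.1 (hle x.2)
  -- For p = 2 the exponent n is r + 3, so C contains a primitive fourth root of unity.
  have hι : p = 2 → ∃ ι : (L ⊔ C : IntermediateField ℚ_[p] M), ι ^ 2 = -1 := by
    rintro rfl
    have h4 : 4 ∣ 2 ^ n := ⟨2 ^ (r + 1), by
      rw [hn, lastExponentPrimeBreak, if_pos rfl]; ring⟩
    obtain ⟨k, hk⟩ := h4
    have h5 := (hζ.pow (pow_pos two_pos n) (hk.trans (mul_comm _ _))).pow (a := 2) (b := 2)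
      (by norm_num) (by norm_num)
    have h6 := h5.eq_neg_one_of_two_right
    have h7 : ((ζ ^ k : integralClosure ℤ_[2] C) : C) ^ 2 = -1 := congrArg Subtype.val h6
    exact ⟨IntermediateField.inclusion le_sup_right _, by
      rw [← map_pow, h7, map_neg, map_one]⟩
  have h1 := card_gal_le hι hcop hd0 hexp
  have h2 := mul_totient_le_card_gal hn0 hd_ne hζ hξ hgen
  have h3 := h1.trans h2
  rw [IsGalois.card_aut_eq_finrank, IsGalois.card_aut_eq_finrank] at h3
  rw [IntermediateField.eq_of_le_of_finrank_le le_sup_right h3]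
  exact le_sup_left

end KroneckerWeber

/-! ### The isomorphism given by the action on roots of unity -/

theorem IsPrimitiveRoot.pow_eq_pow_iff_modEq {M : Type*} [CommMonoid M] {N : ℕ} (hN : N ≠ 0)
    {ζ : M} (hζ : IsPrimitiveRoot ζ N) {i j : ℕ} : ζ ^ i = ζ ^ j ↔ i ≡ j [MOD N] := by
  refine ⟨fun h => ?_, fun h => pow_eq_pow_of_modEq h hζ.pow_eq_one⟩
  have h3 : ∀ i, ζ ^ i = ζ ^ (i % N) := fun i =>
    pow_eq_pow_of_modEq (Nat.mod_modEq i N).symm hζ.pow_eq_one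
  rw [h3 i, h3 j] at h
  exact hζ.pow_inj (Nat.mod_lt _ (Nat.pos_of_ne_zero hN)) (Nat.mod_lt _ (Nat.pos_of_ne_zero hN)) h

theorem isOpen_setOf_apply_mem {K L : Type*} [Field K] [Field L] [Algebra K L]
    [Algebra.IsIntegral K L] (x : L) (Y : Set L) : IsOpen {σ : Gal(L/K) | σ x ∈ Y} := by
  refine isOpen_iff_forall_mem_open.2 fun σ hσ =>
    ⟨(fun τ => σ⁻¹ * τ) ⁻¹' (MulAction.stabilizer Gal(L/K) x), fun τ hτ => ?_,
      (stabilizer_isOpen_of_isIntegral x).preimage (continuous_const_mul _), ?_⟩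
  · have h1 : (σ⁻¹ * τ) • x = x := hτ
    rw [mul_smul, inv_smul_eq_iff] at h1
    exact (congrArg (· ∈ Y) h1).mpr hσ
  · simp

theorem pow_sub_one_ne_zero (p : ℕ) [Fact p.Prime] {m : ℕ} (hm : m ≠ 0) : p ^ m - 1 ≠ 0 :=
  (Nat.sub_pos_of_lt (Nat.one_lt_pow hm (Fact.out : p.Prime).one_lt)).ne'

theorem isClosed_setOf_apply_mem {K L : Type*} [Field K] [Field L] [Algebra K L]
    [Algebra.IsIntegral K L] (x : L) (Y : Set L) : IsClosed {σ : Gal(L/K) | σ x ∈ Y} :=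
  ⟨isOpen_setOf_apply_mem x Yᶜ⟩

section Characters

variable {p : ℕ} [Fact p.Prime] {M : Type*} [Field M] [Algebra ℚ_[p] M] [Algebra ℤ_[p] M]
  [IsScalarTower ℤ_[p] ℚ_[p] M] [IsAbelianGalois ℚ_[p] M]
  (hM : ∀ N : ℕ, N ≠ 0 → ∃ η : M, IsPrimitiveRoot η N)

include hM

omit [Algebra ℤ_[p] M] [IsScalarTower ℤ_[p] ℚ_[p] M] in
variable (p) in
theorem exists_intermediateField_isCyclotomicExtension (n : ℕ) {m : ℕ} (hm : m ≠ 0) :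
    ∃ C : IntermediateField ℚ_[p] M, IsCyclotomicExtension {p ^ n * (p ^ m - 1)} ℚ_[p] C := by
  have hN := pow_mul_pow_sub_one_ne_zero p n hm
  obtain ⟨η, hη⟩ := hM _ hN
  have : NeZero (p ^ n * (p ^ m - 1)) := ⟨hN⟩
  exact ⟨_, hη.intermediateField_adjoin_isCyclotomicExtension ℚ_[p]⟩

theorem exists_zmod_forall_apply_eq_pow (σ : Gal(M/ℚ_[p])) (m : ℕ+) :
    ∃ j : ZMod m, ∀ ξ : M, ξ ^ (p ^ (m : ℕ) - 1) = 1 → σ ξ = ξ ^ p ^ j.val := by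
  have hp : p.Prime := Fact.out
  obtain ⟨C, hC⟩ := exists_intermediateField_isCyclotomicExtension p hM 0 m.ne_zero
  have hfinC : FiniteDimensional ℚ_[p] C :=
    IsCyclotomicExtension.finiteDimensional {p ^ 0 * (p ^ (m : ℕ) - 1)} ℚ_[p] C
  obtain ⟨-, ξ₀, -, hξ₀, -⟩ := exists_isPrimitiveRoot_integralClosure (p := p) C (n := 0) m.ne_zero
  obtain ⟨j, hj⟩ := exists_forall_smul_eq_pow_pow (AlgEquiv.restrictNormalHom C σ)
  refine ⟨(j : ZMod m), fun ξ hξ => ?_⟩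
  rw [pow_pow_eq_of_modEq hp.pos hξ (j := j) (by rw [ZMod.val_natCast]; exact Nat.mod_modEq _ _)]
  have hξ₀M : IsPrimitiveRoot (((ξ₀ : C) : M)) (p ^ (m : ℕ) - 1) :=
    IsPrimitiveRoot.coe_submonoidClass_iff.2 (IsPrimitiveRoot.coe_submonoidClass_iff.2 hξ₀)
  have : NeZero (p ^ (m : ℕ) - 1) := ⟨pow_sub_one_ne_zero p m.ne_zero⟩
  obtain ⟨i, -, rfl⟩ := hξ₀M.eq_pow_of_pow_eq_one hξ
  have h1 := congrArg (algebraMap C M) (hj m m.ne_zero (ξ₀ : C)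
    (congrArg Subtype.val hξ₀.pow_eq_one))
  have h2 : σ ((ξ₀ : C) : M) = ((ξ₀ : C) : M) ^ p ^ j := by
    rw [← AlgEquiv.restrictNormalHom_apply]
    exact h1
  rw [map_pow, h2, ← pow_mul, ← pow_mul, mul_comm]

/-- The exponent `b : ℤ / m` such that `σ` raises the roots of unity of order dividing `p ^ m - 1`
to the power `p ^ b`. -/
noncomputable def frobeniusExponent (σ : Gal(M/ℚ_[p])) (m : ℕ+) : ZMod m :=
  (exists_zmod_forall_apply_eq_pow hM σ m).choose

theorem apply_eq_pow_frobeniusExponent (σ : Gal(M/ℚ_[p])) (m : ℕ+) {ξ : M}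
    (hξ : ξ ^ (p ^ (m : ℕ) - 1) = 1) : σ ξ = ξ ^ p ^ (frobeniusExponent hM σ m).val :=
  (exists_zmod_forall_apply_eq_pow hM σ m).choose_spec ξ hξ

theorem frobeniusExponent_eq_natCast_iff (σ : Gal(M/ℚ_[p])) (m : ℕ+) {ξ : M}
    (hξ : IsPrimitiveRoot ξ (p ^ (m : ℕ) - 1)) {j : ℕ} :
    frobeniusExponent hM σ m = j ↔ σ ξ = ξ ^ p ^ j := by
  rw [apply_eq_pow_frobeniusExponent hM σ m hξ.pow_eq_one,
    hξ.pow_pow_eq_iff (Fact.out : p.Prime).one_lt m.ne_zero, ← ZMod.natCast_eq_natCast_iff,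
    ZMod.natCast_zmod_val]

/-- The action on the roots of unity of order prime to `p`. -/
noncomputable def unramifiedCharacter : Gal(M/ℚ_[p]) →* Multiplicative ZHat where
  toFun σ := .ofAdd ⟨frobeniusExponent hM σ, fun d m h => by
    obtain ⟨ξ, hξ⟩ := hM _ (pow_sub_one_ne_zero p d.ne_zero)
    rw [ZMod.castHom_apply, ← ZMod.natCast_val, eq_comm,
      frobeniusExponent_eq_natCast_iff hM σ d hξ]
    refine apply_eq_pow_frobeniusExponent hM σ m ?_
    obtain ⟨c, hc⟩ := Nat.pow_sub_one_dvd_pow_sub_one p h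
    rw [hc, pow_mul, hξ.pow_eq_one, one_pow]⟩
  map_one' := by
    refine congrArg Multiplicative.ofAdd (Subtype.ext (funext fun m => ?_))
    obtain ⟨ξ, hξ⟩ := hM _ (pow_sub_one_ne_zero p m.ne_zero)
    have := (frobeniusExponent_eq_natCast_iff hM 1 m hξ (j := 0)).2 (by simp)
    simpa using this
  map_mul' σ τ := by
    rw [← ofAdd_add]
    refine congrArg Multiplicative.ofAdd (Subtype.ext (funext fun m => ?_))
    obtain ⟨ξ, hξ⟩ := hM _ (pow_sub_one_ne_zero p m.ne_zero)
    have := (frobeniusExponent_eq_natCast_iff hM (σ * τ) m hξ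
      (j := (frobeniusExponent hM σ m).val + (frobeniusExponent hM τ m).val)).2 (by
        rw [AlgEquiv.mul_apply, apply_eq_pow_frobeniusExponent hM τ m hξ.pow_eq_one, map_pow,
          apply_eq_pow_frobeniusExponent hM σ m hξ.pow_eq_one, ← pow_mul, ← pow_add])
    rw [Nat.cast_add, ZMod.natCast_zmod_val, ZMod.natCast_zmod_val] at this
    exact this

theorem continuous_unramifiedCharacter : Continuous (unramifiedCharacter (p := p) hM) := by
  refine continuous_ofAdd.comp (Continuous.subtype_mk (continuous_pi fun m => ?_) _)
  refine continuous_discrete_rng.2 fun x => ?_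
  obtain ⟨ξ, hξ⟩ := hM _ (pow_sub_one_ne_zero p m.ne_zero)
  convert isOpen_setOf_apply_mem (K := ℚ_[p]) ξ {ξ ^ p ^ x.val} using 1
  ext σ
  rw [Set.mem_preimage, Set.mem_singleton_iff, Set.mem_ofPred_eq, Set.mem_singleton_iff,
    ← frobeniusExponent_eq_natCast_iff hM σ m hξ, ZMod.natCast_zmod_val]

omit [Algebra ℚ_[p] M] [Algebra ℤ_[p] M] [IsScalarTower ℤ_[p] ℚ_[p] M]
  [IsAbelianGalois ℚ_[p] M] in
variable (p) in
theorem hasEnoughRootsOfUnity_prime_pow (i : ℕ) : HasEnoughRootsOfUnity M (p ^ i) :=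
  have : NeZero (p ^ i) := ⟨(pow_pos (Fact.out : p.Prime).pos i).ne'⟩
  ⟨hM _ (NeZero.ne _), rootsOfUnity.isCyclic _ _⟩

omit hM in
variable (p M) in
/-- The action on the roots of unity of `p`-power order. -/
noncomputable def galoisCyclotomicCharacter : Gal(M/ℚ_[p]) →* ℤ_[p]ˣ :=
  (cyclotomicCharacter M p).comp (MulSemiringAction.toRingAut Gal(M/ℚ_[p]) M)

omit [Algebra ℤ_[p] M] [IsScalarTower ℤ_[p] ℚ_[p] M] [IsAbelianGalois ℚ_[p] M] in
theorem apply_eq_pow_galoisCyclotomicCharacter (σ : Gal(M/ℚ_[p])) {n : ℕ} {ζ : M}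
    (hζ : ζ ^ p ^ n = 1) :
    σ ζ = ζ ^ (PadicInt.toZModPow n (galoisCyclotomicCharacter p M σ : ℤ_[p])).val :=
  have := hasEnoughRootsOfUnity_prime_pow p hM
  cyclotomicCharacter.spec p (MulSemiringAction.toRingAut Gal(M/ℚ_[p]) M σ) ζ hζ

omit [Algebra ℤ_[p] M] [IsScalarTower ℤ_[p] ℚ_[p] M] [IsAbelianGalois ℚ_[p] M] in
theorem toZModPow_galoisCyclotomicCharacter_eq_natCast_iff (σ : Gal(M/ℚ_[p])) {n : ℕ} {ζ : M}
    (hζ : IsPrimitiveRoot ζ (p ^ n)) {j : ℕ} :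
    PadicInt.toZModPow n (galoisCyclotomicCharacter p M σ : ℤ_[p]) = j ↔ σ ζ = ζ ^ j := by
  have hpn := (pow_pos (Fact.out : p.Prime).pos n).ne'
  have : NeZero (p ^ n) := ⟨hpn⟩
  rw [apply_eq_pow_galoisCyclotomicCharacter hM σ hζ.pow_eq_one, hζ.pow_eq_pow_iff_modEq hpn,
    ← ZMod.natCast_eq_natCast_iff, ZMod.natCast_zmod_val]

theorem exists_le_intermediateField_isCyclotomicExtension (L : IntermediateField ℚ_[p] M)
    [FiniteDimensional ℚ_[p] L] : ∃ n ≠ 0, ∃ m ≠ 0, ∃ C : IntermediateField ℚ_[p] M,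
      IsCyclotomicExtension {p ^ n * (p ^ m - 1)} ℚ_[p] C ∧ L ≤ C := by
  obtain ⟨n, hn, m, hm, h⟩ := exists_forall_le_of_isCyclotomicExtension L
  obtain ⟨C, hC⟩ := exists_intermediateField_isCyclotomicExtension p hM n hm
  exact ⟨n, hn, m, hm, C, hC, h C hC⟩

/-- Every element lies in a cyclotomic field by Kronecker–Weber, and there an automorphism is
determined by its effect on ζ and ξ. -/
theorem eq_one_of_characters_eq_one {σ : Gal(M/ℚ_[p])} (h1 : galoisCyclotomicCharacter p M σ = 1)
    (h2 : unramifiedCharacter hM σ = 1) : σ = 1 := by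
  ext x
  have : FiniteDimensional ℚ_[p] (IntermediateField.adjoin ℚ_[p] {x}) :=
    IntermediateField.adjoin.finiteDimensional (Algebra.IsIntegral.isIntegral x)
  obtain ⟨n, hn, m, hm, C, hC, hle⟩ :=
    exists_le_intermediateField_isCyclotomicExtension hM (IntermediateField.adjoin ℚ_[p] {x})
  obtain ⟨ζ, ξ, hζ, hξ, hgen⟩ := exists_isPrimitiveRoot_integralClosure (p := p) C (n := n) hm
  have h3 : AlgEquiv.restrictNormalHom C σ = 1 := by
    refine hgen _ (Subtype.ext (Subtype.ext ?_)) (Subtype.ext (Subtype.ext ?_))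
    · refine (AlgEquiv.restrictNormalHom_apply C σ ζ).trans ?_
      have h4 := (toZModPow_galoisCyclotomicCharacter_eq_natCast_iff hM σ
        (IsPrimitiveRoot.coe_submonoidClass_iff.2 (IsPrimitiveRoot.coe_submonoidClass_iff.2 hζ) :
          IsPrimitiveRoot ((ζ : C) : M) (p ^ n)) (j := 1)).1 (by rw [h1]; simp)
      rwa [pow_one] at h4
    · refine (AlgEquiv.restrictNormalHom_apply C σ ξ).trans ?_
      have h4 := (frobeniusExponent_eq_natCast_iff hM σ ⟨m, Nat.pos_of_ne_zero hm⟩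
        (IsPrimitiveRoot.coe_submonoidClass_iff.2 (IsPrimitiveRoot.coe_submonoidClass_iff.2 hξ) :
          IsPrimitiveRoot ((ξ : C) : M) (p ^ m - 1)) (j := 0)).1 (by
            have h5 := congrArg (fun b : Multiplicative ZHat => b.toAdd.1) h2
            rw [Nat.cast_zero]
            exact congrFun h5 _)
      rwa [pow_zero, pow_one] at h4
  have h4 := AlgEquiv.restrictNormalHom_apply C σ
    ⟨x, hle (IntermediateField.mem_adjoin_simple_self ℚ_[p] x)⟩
  rw [h3] at h4
  exact h4.symm

theorem exists_characters_eq (a : ℤ_[p]ˣ) (b : ZHat) (n : ℕ) (m : ℕ+) : ∃ σ : Gal(M/ℚ_[p]),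
    PadicInt.toZModPow n (galoisCyclotomicCharacter p M σ : ℤ_[p]) =
      PadicInt.toZModPow n (a : ℤ_[p]) ∧ frobeniusExponent hM σ m = b.1 m := by
  have hp : p.Prime := Fact.out
  -- The level n + 1 keeps the exponent nonzero when n = 0; the congruence is reduced modulo p^n at
  -- the end.
  obtain ⟨C, hC⟩ := exists_intermediateField_isCyclotomicExtension p hM (n + 1) m.ne_zero
  have hfinC : FiniteDimensional ℚ_[p] C :=
    IsCyclotomicExtension.finiteDimensional {p ^ (n + 1) * (p ^ (m : ℕ) - 1)} ℚ_[p] C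
  obtain ⟨ζ, ξ, hζ, hξ, hgen⟩ :=
    exists_isPrimitiveRoot_integralClosure (p := p) C (n := n + 1) m.ne_zero
  have hcop := ZMod.val_coe_unit_coprime
    (Units.map (PadicInt.toZModPow (p := p) (n + 1)).toMonoidHom a)
  obtain ⟨σ', hσζ, hσξ⟩ := exists_smul_eq_pow (Nat.succ_ne_zero n) m.ne_zero hζ hξ hgen
    ((Nat.coprime_pow_right_iff (Nat.succ_pos n) _ _).1 hcop) (b.1 m).val
  obtain ⟨σ, rfl⟩ := AlgEquiv.restrictNormalHom_surjective (F := ℚ_[p]) (E := M) σ'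
  refine ⟨σ, ?_, ?_⟩
  · have h4 := (toZModPow_galoisCyclotomicCharacter_eq_natCast_iff hM σ
      (IsPrimitiveRoot.coe_submonoidClass_iff.2 (IsPrimitiveRoot.coe_submonoidClass_iff.2 hζ) :
        IsPrimitiveRoot ((ζ : C) : M) (p ^ (n + 1)))).2 (by
      rw [← AlgEquiv.restrictNormalHom_apply C σ]
      exact congrArg (fun x : integralClosure ℤ_[p] C => ((x : C) : M)) hσζ)
    have : NeZero (p ^ (n + 1)) := ⟨(pow_pos hp.pos _).ne'⟩
    rw [ZMod.natCast_zmod_val] at h4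
    rw [← PadicInt.cast_toZModPow n (n + 1) (Nat.le_succ n), h4,
      ← PadicInt.cast_toZModPow n (n + 1) (Nat.le_succ n) (a : ℤ_[p])]
    rfl
  · have h4 := (frobeniusExponent_eq_natCast_iff hM σ m
      (IsPrimitiveRoot.coe_submonoidClass_iff.2 (IsPrimitiveRoot.coe_submonoidClass_iff.2 hξ) :
        IsPrimitiveRoot ((ξ : C) : M) (p ^ (m : ℕ) - 1))).2 (by
      rw [← AlgEquiv.restrictNormalHom_apply C σ]
      exact congrArg (fun x : integralClosure ℤ_[p] C => ((x : C) : M)) hσξ)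
    rwa [ZMod.natCast_zmod_val] at h4

/-- The action on the roots of unity, as a homomorphism of groups. -/
noncomputable def rootsOfUnityCharacter : Gal(M/ℚ_[p]) →* ℤ_[p]ˣ × Multiplicative ZHat :=
  (galoisCyclotomicCharacter p M).prod (unramifiedCharacter hM)

theorem continuous_rootsOfUnityCharacter : Continuous (rootsOfUnityCharacter (p := p) hM) :=
  (cyclotomicCharacter.continuous p ℚ_[p] M).prodMk (continuous_unramifiedCharacter hM)

/-- Surjectivity follows from the finite levels by compactness: the conditions at level k cut out a
decreasing sequence of nonempty closed sets. -/
theorem bijective_rootsOfUnityCharacter :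
    Function.Bijective (rootsOfUnityCharacter (p := p) hM) := by
  have hp : p.Prime := Fact.out
  refine ⟨(injective_iff_map_eq_one _).2 fun σ hσ => eq_one_of_characters_eq_one hM
    (congrArg Prod.fst hσ) (congrArg Prod.snd hσ), ?_⟩
  rintro ⟨a, b⟩
  -- Factorials are cofinal for divisibility, so one sequence controls all components of an element
  -- of Ẑ.
  let m : ℕ → ℕ+ := fun k => ⟨k.factorial, k.factorial_pos⟩
  let S : ℕ → Set Gal(M/ℚ_[p]) := fun k =>
    {σ | PadicInt.toZModPow k (galoisCyclotomicCharacter p M σ : ℤ_[p]) =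
      PadicInt.toZModPow k (a : ℤ_[p]) ∧ frobeniusExponent hM σ (m k) = b.toAdd.1 (m k)}
  have hcompat : ∀ (c : ZHat) (d : ℕ+) (k : ℕ) (h : (d : ℕ) ∣ k.factorial),
      c.1 d = ZMod.castHom h (ZMod d) (c.1 (m k)) := fun c d k h => (c.2 d (m k) h).symm
  have hS : ∀ k l, l ≤ k → ∀ d : ℕ+, (d : ℕ) ∣ k.factorial → ∀ σ ∈ S k,
      PadicInt.toZModPow l (galoisCyclotomicCharacter p M σ : ℤ_[p]) =
        PadicInt.toZModPow l (a : ℤ_[p]) ∧ frobeniusExponent hM σ d = b.toAdd.1 d := by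
    rintro k l hlk d hd σ ⟨h1, h2⟩
    constructor
    · rw [← PadicInt.cast_toZModPow l k hlk, h1, PadicInt.cast_toZModPow l k hlk]
    · rw [hcompat b.toAdd d k hd, ← h2]
      exact hcompat (unramifiedCharacter hM σ).toAdd d k hd
  have hcl : ∀ k, IsClosed (S k) := by
    intro k
    have hpk : NeZero (p ^ k) := ⟨(pow_pos hp.pos k).ne'⟩
    obtain ⟨ζ, hζ⟩ := hM _ hpk.ne
    obtain ⟨ξ, hξ⟩ := hM _ (pow_sub_one_ne_zero p (m k).ne_zero)
    convert (isClosed_setOf_apply_mem (K := ℚ_[p]) ζ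
      {ζ ^ (PadicInt.toZModPow k (a : ℤ_[p])).val}).inter
      (isClosed_setOf_apply_mem (K := ℚ_[p]) ξ {ξ ^ p ^ (b.toAdd.1 (m k)).val}) using 1
    ext σ
    simp only [S, Set.mem_inter_iff, Set.mem_ofPred_eq, Set.mem_singleton_iff]
    rw [← toZModPow_galoisCyclotomicCharacter_eq_natCast_iff hM σ hζ,
      ← frobeniusExponent_eq_natCast_iff hM σ (m k) hξ, ZMod.natCast_zmod_val,
      ZMod.natCast_zmod_val]
  obtain ⟨σ, hσ⟩ := IsCompact.nonempty_iInter_of_sequence_nonempty_isCompact_isClosed S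
    (fun k σ hσ => hS (k + 1) k (Nat.le_succ k) (m k) (Nat.factorial_dvd_factorial (Nat.le_succ k))
      σ hσ)
    (fun k => exists_characters_eq hM a b.toAdd k (m k))
    (hcl 0).isCompact hcl
  rw [Set.mem_iInter] at hσ
  refine ⟨σ, Prod.ext (Units.ext (PadicInt.ext_of_toZModPow.1 fun n => (hσ n).1)) ?_⟩
  refine congrArg Multiplicative.ofAdd (Subtype.ext (funext fun d => ?_))
  exact (hS d 0 (Nat.zero_le _) d (Nat.dvd_factorial d.pos le_rfl) σ (hσ d)).2

/-- The isomorphism of `Gal(M | ℚ_[p])` with `ℤ_[p]ˣ × Ẑ`. -/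
noncomputable def rootsOfUnityEquiv : Gal(M/ℚ_[p]) ≃ₜ* ℤ_[p]ˣ × Multiplicative ZHat :=
  { MulEquiv.ofBijective _ (bijective_rootsOfUnityCharacter (p := p) hM) with
    continuous_toFun := continuous_rootsOfUnityCharacter hM
    continuous_invFun := (continuous_rootsOfUnityCharacter (p := p) hM).continuous_symm_of_equiv_compact_to_t2 (f := Equiv.ofBijective _ (bijective_rootsOfUnityCharacter hM))  }

end Characters

/-! ### The maximal abelian extension and its upper filtration -/

section SSup

/-- A commutator restricts trivially to each of the given abelian extensions, so its fixed field
contains their compositum. -/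
theorem isAbelianGalois_sSup {K Ω : Type*} [Field K] [Field Ω] [Algebra K Ω]
    {S : Set (IntermediateField K Ω)} (hS : ∀ E ∈ S, IsAbelianGalois K E) :
    IsAbelianGalois K (sSup S : IntermediateField K Ω) := by
  have hnormal : Normal K (sSup S : IntermediateField K Ω) := by
    rw [sSup_eq_iSup']
    have : ∀ E : S, Normal K E.1 := fun E => (hS E.1 E.2).to_normal
    exact IntermediateField.normal_iSup K Ω _
  have hsep : Algebra.IsSeparable K (sSup S : IntermediateField K Ω) := by
    rw [sSup_eq_iSup']
    have : ∀ E : S, Algebra.IsSeparable K E.1 := fun E => (hS E.1 E.2).to_isSeparable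
    exact IntermediateField.isSeparable_iSup K Ω
  have hgal : IsGalois K (sSup S : IntermediateField K Ω) := {}
  refine { hgal with is_comm := ⟨fun σ τ => ?_⟩ }
  rw [← inv_mul_eq_one]
  set t := (σ * τ)⁻¹ * (τ * σ)
  have hle : sSup S ≤ IntermediateField.lift (IntermediateField.fixedField (Subgroup.zpowers t)) := by
    refine sSup_le fun E hE x hx => ?_
    have hEM : E ≤ sSup S := le_sSup hE
    have := hS E hE
    have hab : IsAbelianGalois K (IntermediateField.restrict hEM) :=
      IsAbelianGalois.of_algHom
        (IntermediateField.restrictAlgEquiv hEM).symm.toAlgHom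
    have ht : AlgEquiv.restrictNormalHom (IntermediateField.restrict hEM) t = 1 := by
      rw [map_mul, map_inv, map_mul, map_mul, inv_mul_eq_one]
      exact mul_comm' _ _
    have hxM : (⟨x, hEM hx⟩ : (sSup S : IntermediateField K Ω)) ∈
        IntermediateField.restrict hEM := (IntermediateField.mem_restrict hEM _).2 hx
    have h1 := AlgEquiv.restrictNormalHom_apply (IntermediateField.restrict hEM) t ⟨_, hxM⟩
    rw [ht] at h1
    exact (IntermediateField.mem_lift (F := sSup S) ⟨x, hEM hx⟩).2
      (mem_fixedField_zpowers_iff.2 h1.symm)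
  ext x
  exact congrArg Subtype.val (mem_fixedField_zpowers_iff.1
    ((IntermediateField.mem_lift (F := sSup S) x).1 (hle x.2)))

end SSup

section MaximalAbelianExtension

variable (p : ℕ) [Fact p.Prime]

instance isAbelianGalois_maximalAbelianExtension :
    IsAbelianGalois ℚ_[p] (maximalAbelianExtension p) :=
  isAbelianGalois_sSup fun _ hE => hE

theorem exists_isPrimitiveRoot_maximalAbelianExtension (N : ℕ) (hN : N ≠ 0) :
    ∃ η : maximalAbelianExtension p, IsPrimitiveRoot η N := by
  have : NeZero N := ⟨hN⟩
  obtain ⟨η, hη⟩ := HasEnoughRootsOfUnity.exists_primitiveRoot (AlgebraicClosure ℚ_[p]) N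
  have hcyc := hη.intermediateField_adjoin_isCyclotomicExtension ℚ_[p]
  have hab : IsAbelianGalois ℚ_[p] (IntermediateField.adjoin ℚ_[p] {η}) :=
    IsCyclotomicExtension.isAbelianGalois {N} ℚ_[p] _
  have hle : IntermediateField.adjoin ℚ_[p] {η} ≤ maximalAbelianExtension p := le_sSup hab
  exact ⟨⟨η, hle (IntermediateField.mem_adjoin_simple_self ℚ_[p] η)⟩,
    IsPrimitiveRoot.coe_submonoidClass_iff.1 hη⟩

variable {p} {M : IntermediateField ℚ_[p] (AlgebraicClosure ℚ_[p])}

theorem galoisUpperRamificationGroup_neg_one : galoisUpperRamificationGroup p M (-1) = ⊤ := by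
  refine eq_top_iff.2 fun σ _ => (Subgroup.mem_iInf).2 fun E => ?_
  have h := upperRamificationGroup_herbrandPhi (B := integralClosure ℤ_[p] E)
    (G := Gal(E/ℚ_[p])) (u := -1) le_rfl
  rw [herbrandPhi_neg_one] at h
  rw [Subgroup.mem_comap, h, lowerRamificationGroup_eq,
    show (⌈(-1 : ℝ)⌉ + 1).toNat = 0 by norm_num, congruenceSubgroup_zero]
  exact Subgroup.mem_top _

/-- Cyclotomic layers suffice: each finite Galois subextension lies in one by Kronecker–Weber, and
Herbrand's theorem sends the upper groups of the layer onto those of the subextension. -/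
theorem mem_galoisUpperRamificationGroup_iff [IsAbelianGalois ℚ_[p] M]
    (hM : ∀ N : ℕ, N ≠ 0 → ∃ η : M, IsPrimitiveRoot η N) {v : ℝ} (hv : -1 < v)
    {σ : Gal(M/ℚ_[p])} : σ ∈ galoisUpperRamificationGroup p M v ↔
      rootsOfUnityCharacter hM σ ∈ (padicPrincipalUnits p ⌈v⌉.toNat).prod ⊥ := by
  have hp : p.Prime := Fact.out
  set k := ⌈v⌉.toNat with hk
  rw [galoisUpperRamificationGroup, Subgroup.mem_iInf, Subgroup.mem_prod, Subgroup.mem_bot]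
  have hmem : ∀ a : ℤ_[p]ˣ, a ∈ padicPrincipalUnits p k ↔ PadicInt.toZModPow k (a : ℤ_[p]) = 1 :=
    fun a => MonoidHom.mem_ker.trans Units.ext_iff
  rw [hmem]
  constructor
  · intro h
    have key : ∀ m : ℕ+, PadicInt.toZModPow k (galoisCyclotomicCharacter p M σ : ℤ_[p]) = 1 ∧
        frobeniusExponent hM σ m = 0 := by
      intro m
      -- At level k + 1 the criterion concerns ζ^p, which is a primitive root of order p^k, and the
      -- level is nonzero even if k = 0.
      obtain ⟨C, hC⟩ := exists_intermediateField_isCyclotomicExtension p hM (k + 1) m.ne_zero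
      have hfinC : FiniteDimensional ℚ_[p] C :=
        IsCyclotomicExtension.finiteDimensional {p ^ (k + 1) * (p ^ (m : ℕ) - 1)} ℚ_[p] C
      obtain ⟨ζ, ξ, hζ, hξ, hgen⟩ :=
        exists_isPrimitiveRoot_integralClosure (p := p) C (n := k + 1) m.ne_zero
      have h1 : AlgEquiv.restrictNormalHom C σ ∈ padicUpperRamificationGroup p C v :=
        h { toIntermediateField := C, finiteDimensional := hfinC, isGalois := inferInstance }
      obtain ⟨h2, h3⟩ := (mem_padicUpperRamificationGroup_cyclotomic_iff (Nat.succ_ne_zero k)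
        m.ne_zero hζ hξ hgen hv).1 h1
      rw [← hk, show k.succ - k = 1 by omega, pow_one] at h3
      have hζp : IsPrimitiveRoot (ζ ^ p) (p ^ k) := hζ.pow (pow_pos hp.pos _) (pow_succ' p k)
      constructor
      · have h4 := (toZModPow_galoisCyclotomicCharacter_eq_natCast_iff hM σ
          (IsPrimitiveRoot.coe_submonoidClass_iff.2 (IsPrimitiveRoot.coe_submonoidClass_iff.2 hζp) :
            IsPrimitiveRoot (((ζ ^ p : integralClosure ℤ_[p] C) : C) : M) (p ^ k)) (j := 1)).2 (by
          rw [← AlgEquiv.restrictNormalHom_apply C σ, pow_one]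
          exact congrArg (fun x : integralClosure ℤ_[p] C => ((x : C) : M)) h3)
        rwa [Nat.cast_one] at h4
      · have h4 := (frobeniusExponent_eq_natCast_iff hM σ m
          (IsPrimitiveRoot.coe_submonoidClass_iff.2 (IsPrimitiveRoot.coe_submonoidClass_iff.2 hξ) :
            IsPrimitiveRoot ((ξ : C) : M) (p ^ (m : ℕ) - 1)) (j := 0)).2 (by
          rw [← AlgEquiv.restrictNormalHom_apply C σ, pow_zero, pow_one]
          exact congrArg (fun x : integralClosure ℤ_[p] C => ((x : C) : M)) h2)
        rwa [Nat.cast_zero] at h4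
    exact ⟨(key 1).1, congrArg Multiplicative.ofAdd (Subtype.ext (funext fun m => (key m).2))⟩
  · rintro ⟨h1, h2⟩ E
    obtain ⟨n, hn, m, hm, C, hC, hle⟩ :=
      exists_le_intermediateField_isCyclotomicExtension hM E.toIntermediateField
    have hfinC : FiniteDimensional ℚ_[p] C :=
      IsCyclotomicExtension.finiteDimensional {p ^ n * (p ^ m - 1)} ℚ_[p] C
    obtain ⟨ζ, ξ, hζ, hξ, hgen⟩ := exists_isPrimitiveRoot_integralClosure (p := p) C (n := n) hm
    have h3 : AlgEquiv.restrictNormalHom C σ ∈ padicUpperRamificationGroup p C v := by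
      refine (mem_padicUpperRamificationGroup_cyclotomic_iff hn hm hζ hξ hgen hv).2
        ⟨Subtype.ext (Subtype.ext ?_), Subtype.ext (Subtype.ext ?_)⟩
      · refine (AlgEquiv.restrictNormalHom_apply C σ ξ).trans ?_
        have h4 := (frobeniusExponent_eq_natCast_iff hM σ ⟨m, Nat.pos_of_ne_zero hm⟩
          (IsPrimitiveRoot.coe_submonoidClass_iff.2 (IsPrimitiveRoot.coe_submonoidClass_iff.2 hξ) :
            IsPrimitiveRoot ((ξ : C) : M) (p ^ m - 1)) (j := 0)).1 (by
              have h5 := congrArg (fun b : Multiplicative ZHat => b.toAdd.1) h2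
              rw [Nat.cast_zero]
              exact congrFun h5 _)
        rwa [pow_zero, pow_one] at h4
      · refine (AlgEquiv.restrictNormalHom_apply C σ
          (ζ ^ p ^ (n - k) : integralClosure ℤ_[p] C)).trans ?_
        have h4 : (((ζ ^ p ^ (n - k) : integralClosure ℤ_[p] C) : C) : M) ^ p ^ k = 1 := by
          have h5 : (ζ ^ p ^ (n - k)) ^ p ^ k = 1 := by
            rw [← pow_mul, ← pow_add]
            exact (hζ.pow_eq_one_iff_dvd _).2 (pow_dvd_pow p (by omega))
          exact congrArg (fun x : integralClosure ℤ_[p] C => ((x : C) : M)) h5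
        rw [apply_eq_pow_galoisCyclotomicCharacter hM σ h4]
        have h6 : PadicInt.toZModPow k (galoisCyclotomicCharacter p M σ : ℤ_[p]) = (1 : ℕ) := by
          rw [Nat.cast_one]; exact h1
        refine (pow_eq_pow_of_modEq ?_ h4).trans (pow_one _)
        have : NeZero (p ^ k) := ⟨(pow_pos hp.pos k).ne'⟩
        rw [← ZMod.natCast_eq_natCast_iff, ZMod.natCast_zmod_val, h6]
    let _ : Algebra E C := (IntermediateField.inclusion hle).toRingHom.toAlgebra
    have htower : IsScalarTower ℚ_[p] E C :=
      IsScalarTower.of_algHom (IntermediateField.inclusion hle)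
    have h4 := map_restrictNormalHom_upperRamificationGroup p E C hv.le
    rw [Subgroup.mem_comap, ← h4]
    refine ⟨_, h3, ?_⟩
    ext x
    rw [AlgEquiv.restrictNormalHom_apply]
    have h5 := AlgEquiv.restrictNormal_commutes (AlgEquiv.restrictNormalHom C σ) E x
    have h6 := congrArg (algebraMap C M) h5
    refine congrArg Subtype.val (h6.trans ?_)
    exact AlgEquiv.restrictNormalHom_apply C σ _

end MaximalAbelianExtension

/-! ### Principal units and the breaks -/

section Breaks

variable (p : ℕ) [Fact p.Prime]

theorem mem_padicPrincipalUnits_iff {n : ℕ} {a : ℤ_[p]ˣ} :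
    a ∈ padicPrincipalUnits p n ↔ PadicInt.toZModPow n (a : ℤ_[p]) = 1 :=
  MonoidHom.mem_ker.trans Units.ext_iff

theorem padicPrincipalUnits_zero : padicPrincipalUnits p 0 = ⊤ := by
  refine eq_top_iff.2 fun a _ => (mem_padicPrincipalUnits_iff p).2 ?_
  have : Subsingleton (ZMod (p ^ 0)) := by rw [pow_zero]; infer_instance
  exact Subsingleton.elim _ _

theorem padicPrincipalUnits_antitone : Antitone (padicPrincipalUnits p) := by
  intro m n hmn a ha
  rw [mem_padicPrincipalUnits_iff] at ha ⊢
  have : (1 : ZMod (p ^ m)) = ((1 : ZMod (p ^ n)).cast : ZMod (p ^ m)) := by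
    rw [ZMod.cast_one (pow_dvd_pow p hmn)]
  rw [← PadicInt.cast_toZModPow m n hmn, ha, this]

/-- The witness is 1 + p^n. For n = 0 it is 2, a unit only when p ≠ 2. -/
theorem padicPrincipalUnits_succ_ne {n : ℕ} (hn : p = 2 → n ≠ 0) :
    padicPrincipalUnits p (n + 1) ≠ padicPrincipalUnits p n := by
  have hp : p.Prime := Fact.out
  intro h
  have hndvd : ¬ p ∣ 1 + p ^ n := by
    intro hdvd
    rcases Nat.eq_zero_or_pos n with rfl | hn0
    · rw [pow_zero] at hdvd
      exact hn ((Nat.prime_dvd_prime_iff_eq hp Nat.prime_two).1 hdvd) rfl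
    · exact hp.one_lt.ne' (Nat.dvd_one.1 ((Nat.dvd_add_left (dvd_pow_self p hn0.ne')).1 hdvd))
  have hunit : IsUnit (((1 + p ^ n : ℕ)) : ℤ_[p]) := by
    rw [PadicInt.isUnit_iff]
    refine le_antisymm (PadicInt.norm_le_one _) (not_lt.1 fun hlt => hndvd ?_)
    exact_mod_cast (PadicInt.norm_int_lt_one_iff_dvd (p := p) ((1 + p ^ n : ℕ) : ℤ)).1
      (by exact_mod_cast hlt)
  obtain ⟨u, hu⟩ := hunit
  have h1 : u ∈ padicPrincipalUnits p n := by
    rw [mem_padicPrincipalUnits_iff, hu, map_natCast, Nat.cast_add, ZMod.natCast_self, Nat.cast_one,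
      add_zero]
  rw [← h, mem_padicPrincipalUnits_iff, hu, map_natCast, Nat.cast_add, Nat.cast_one,
    add_eq_left, ZMod.natCast_eq_zero_iff, Nat.pow_dvd_pow_iff_le_right hp.one_lt] at h1
  omega

theorem padicPrincipalUnits_two_one : padicPrincipalUnits 2 1 = ⊤ := by
  refine eq_top_iff.2 fun a _ => ?_
  rw [padicPrincipalUnits, MonoidHom.mem_ker]
  have key : ∀ x : (ZMod (2 ^ 1))ˣ, x = 1 := by decide
  exact key _

theorem exists_zhat_ne_zero : ∃ b : ZHat, b ≠ 0 := by
  refine ⟨⟨fun m => 1, fun d m h => by rw [map_one]⟩, fun h => ?_⟩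
  exact (by decide : (1 : ZMod ((2 : ℕ+) : ℕ)) ≠ 0) (congrFun (congrArg Subtype.val h) 2)

end Breaks

theorem mainTheorem2 (p : ℕ) [Fact p.Prime] :
    ∃ e : Gal(maximalAbelianExtension p/ℚ_[p]) ≃ₜ* ℤ_[p]ˣ × Multiplicative ZHat,
      -- the first component of `e` is the action on the roots of unity of `p`-power order
      (∀ (σ : Gal(maximalAbelianExtension p/ℚ_[p])) (n : ℕ) (ζ : maximalAbelianExtension p),
        ζ ^ p ^ n = 1 → σ ζ = ζ ^ (PadicInt.toZModPow n ((e σ).1 : ℤ_[p])).val) ∧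
      -- the second one is the action on those of order prime to `p`: `1 ∈ Ẑ` acts as `ζ ↦ ζ ^ p`
      (∀ (σ : Gal(maximalAbelianExtension p/ℚ_[p])) (m : ℕ+) (ζ : maximalAbelianExtension p),
        ζ ^ (p ^ (m : ℕ) - 1) = 1 → σ ζ = ζ ^ p ^ ((e σ).2.toAdd.1 m).val) ∧
      galoisUpperRamificationGroup p (maximalAbelianExtension p) (-1) = ⊤ ∧
      (galoisUpperRamificationGroup p (maximalAbelianExtension p) 0).map
        (e : Gal(maximalAbelianExtension p/ℚ_[p]) →* ℤ_[p]ˣ × Multiplicative ZHat) =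
          Subgroup.prod ⊤ ⊥ ∧
      (∀ n : ℕ, 0 < n →
        (galoisUpperRamificationGroup p (maximalAbelianExtension p) n).map
          (e : Gal(maximalAbelianExtension p/ℚ_[p]) →* ℤ_[p]ˣ × Multiplicative ZHat) =
            (padicPrincipalUnits p n).prod ⊥) ∧
      ∀ u : ℝ,
        IsFiltrationBreak (galoisUpperRamificationGroup p (maximalAbelianExtension p)) u ↔
          u = -1 ∨ ∃ n : ℕ, u = n ∧ (p = 2 → n ≠ 0) := by
  have hM := exists_isPrimitiveRoot_maximalAbelianExtension p
  let e : Gal(maximalAbelianExtension p/ℚ_[p]) ≃ₜ* ℤ_[p]ˣ × Multiplicative ZHat :=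
    rootsOfUnityEquiv hM
  set F := galoisUpperRamificationGroup p (maximalAbelianExtension p) with hF
  have hneg : F (-1) = ⊤ := galoisUpperRamificationGroup_neg_one
  have hmem : ∀ {v : ℝ}, -1 < v → ∀ {σ}, σ ∈ F v ↔
      e σ ∈ (padicPrincipalUnits p ⌈v⌉.toNat).prod ⊥ :=
    fun hv => mem_galoisUpperRamificationGroup_iff hM hv
  have hmap : ∀ {v : ℝ}, -1 < v → (F v).map (e :
      Gal(maximalAbelianExtension p/ℚ_[p]) →* ℤ_[p]ˣ × Multiplicative ZHat) =
        (padicPrincipalUnits p ⌈v⌉.toNat).prod ⊥ := by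
    intro v hv
    ext x
    obtain ⟨σ, rfl⟩ := e.surjective x
    rw [← hmem hv]
    exact Subgroup.mem_map_equiv.trans (by simp)
  have hext : ∀ {v w : ℝ}, -1 < v → -1 < w → (F v = F w ↔
      padicPrincipalUnits p ⌈v⌉.toNat = padicPrincipalUnits p ⌈w⌉.toNat) := by
    intro v w hv hw
    constructor
    · intro h
      ext a
      obtain ⟨σ, hσ⟩ := e.surjective (a, 1)
      have h1 := hmem hv (σ := σ)
      rw [h, hmem hw, hσ] at h1
      simpa [Subgroup.mem_prod] using h1.symm
    · intro h
      ext σ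
      rw [hmem hv, hmem hw, h]
  refine ⟨e, fun σ n ζ hζ => apply_eq_pow_galoisCyclotomicCharacter hM σ hζ,
    fun σ m ξ hξ => apply_eq_pow_frobeniusExponent hM σ m hξ, hneg, ?_, fun n hn => ?_, fun u => ?_⟩
  · rw [hmap (by norm_num)]
    simp [padicPrincipalUnits_zero]
  · rw [hmap (by linarith [Nat.cast_nonneg (α := ℝ) n])]
    simp
  constructor
  · rintro ⟨hu, h⟩
    by_contra! hcon
    obtain ⟨hu1, hn⟩ := hcon
    have hu' : -1 < u := lt_of_le_of_ne hu (Ne.symm hu1)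
    -- F depends only on the ceiling for v > -1, so moving a non-integral u up to its ceiling
    -- changes nothing. The only integer left is 0 with p = 2, where U_1 = U_0 and ε = 1 works.
    rcases (Int.le_ceil u).lt_or_eq with hlt | heq
    · refine h (⌈u⌉ - u) (by linarith) ?_
      rw [hext (by linarith) hu', add_sub_cancel, Int.ceil_intCast]
    · have hc : -1 < ⌈u⌉ := Int.lt_ceil.2 (by push_cast; exact hu')
      obtain ⟨n, hn'⟩ := Int.eq_ofNat_of_zero_le (show 0 ≤ ⌈u⌉ by omega)
      rw [hn', Int.cast_natCast] at heq
      obtain ⟨rfl, rfl⟩ := hn n heq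
      refine h 1 one_pos ?_
      rw [hext (by linarith) hu', heq]
      simp [padicPrincipalUnits_zero, padicPrincipalUnits_two_one]
  · rintro (rfl | ⟨n, rfl, hn⟩)
    · refine ⟨le_rfl, fun ε hε h => ?_⟩
      -- At -1 the group loses its component in Ẑ, so an element with nonzero second coordinate
      -- detects the break.
      obtain ⟨b, hb⟩ := exists_zhat_ne_zero
      obtain ⟨σ, hσ⟩ := e.surjective (1, Multiplicative.ofAdd b)
      have h1 : σ ∈ F (-1 + ε) := by rw [h, hneg]; exact Subgroup.mem_top σ
      rw [hmem (by linarith), hσ] at h1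
      exact hb h1.2
    · have hn0 := Nat.cast_nonneg (α := ℝ) n
      refine ⟨by linarith, fun ε hε h => ?_⟩
      rw [hext (by linarith) (by linarith), Int.ceil_natCast, Int.toNat_natCast] at h
      refine padicPrincipalUnits_succ_ne p hn (le_antisymm
        (padicPrincipalUnits_antitone p (Nat.le_succ n)) ?_)
      rw [← h]
      refine padicPrincipalUnits_antitone p ?_
      have h2 : (n : ℤ) < ⌈(n : ℝ) + ε⌉ := Int.lt_ceil.2 (by push_cast; linarith)
      omega
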